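/- For a locally integrable $f:\mathbb R\to\mathbb R$ put $$M^+f(x)=\sup_{h>0}\frac1h\int_x^{x+h}|f(y)|\,dy,\qquad M^{\sharp,+}f(x)=\sup_{h>0}\frac1h\int_x^{x+h}\Bigl(f(y)-\frac1h\int_{x+h}^{x+2h}f\Bigr)^+dy ,$$ where $t^+=\max\{t,0\}$. A weight is a nonnegative locally integrable function $w$ on $\mathbb R$, and $\|g\|_{L^p(w)}=\bigl(\int_{\mathbb R}|g|^p\,w\bigr)^{1/p}\in[0,\infty]$. For $1<p<\infty$, a weight $w$ belongs to $C_p^+$ if there are $\varepsilon>0$ and $C>0$ such that, for all $a<b<c$ with $c-b<b-a$ and every measurable set $E\subset(a,b)$, $$\int_E w\le C\Bigl(\frac{|E|}{c-b}\Bigr)^{\varepsilon}\int_{\mathbb R}\bigl(M^+\chi_{(a,c)}\bigr)^p\,w$$ (the integral on the right may be infinite, with $0\cdot\infty=0$). For a weight $w$ and $1<p<\infty$ consider the estimate (S) there is a constant $C<\infty$ such that $\|M^+f\|_{L^p(w)}\le C\,\|M^{\sharp,+}f\|_{L^p(w)}$ for every nonnegative bounded measurable function $f$ with compact support for which $\|M^+f\|_{L^p(w)}<\infty$.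 **Theorem 1.** (i) Let $1<p<q<\infty$ and let $w\in C_q^+$ be a weight. Then (S) holds for $p$ and $w$. (ii) Conversely, let $1<p<\infty$ and let $w$ be a weight such that (S) holds for $p$ and $w$. Then $w\in C_p^+$. -/

import Mathlib

open MeasureTheory Set
open scoped ENNReal NNReal

noncomputable section

namespace OneSided

/-- The one-sided maximal function
`M⁺ f (x) = sup_{h > 0} (1 / h) ∫_x^{x+h} |f|`, with values in `[0, ∞]`. -/
def maximal (f : ℝ → ℝ) (x : ℝ) : ℝ≥0∞ :=
  ⨆ (h : ℝ) (_ : 0 < h), (∫⁻ y in Ioc x (x + h), ‖f y‖ₑ) / ENNReal.ofReal h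

/-- The one-sided sharp maximal function
`M^{♯,+} f (x) = sup_{h > 0} (1 / h) ∫_x^{x+h} (f(y) - (1 / h) ∫_{x+h}^{x+2h} f)⁺ dy`,
with values in `[0, ∞]`; `ENNReal.ofReal` takes the positive part. -/
def sharpMaximal (f : ℝ → ℝ) (x : ℝ) : ℝ≥0∞ :=
  ⨆ (h : ℝ) (_ : 0 < h),
    (∫⁻ y in Ioc x (x + h), ENNReal.ofReal (f y - (1 / h) * ∫ z in (x + h)..(x + 2 * h), f z)) /
      ENNReal.ofReal h

/-- A weight on the line: a nonnegative locally integrable function. -/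
structure IsWeight (w : ℝ → ℝ) : Prop where
  nonneg : ∀ x, 0 ≤ w x
  locallyIntegrable : LocallyIntegrable w volume

/-- The weighted norm `‖g‖_{L^p(w)} = (∫ g^p w)^{1/p}` of a `[0, ∞]`-valued function. -/
def weightedNorm (p : ℝ) (w : ℝ → ℝ) (g : ℝ → ℝ≥0∞) : ℝ≥0∞ :=
  (∫⁻ x, g x ^ p * ENNReal.ofReal (w x)) ^ (1 / p)

/-- The one-sided condition `C_p⁺`. -/
def CPlus (p : ℝ) (w : ℝ → ℝ) : Prop :=
  ∃ ε C : ℝ, 0 < ε ∧ 0 < C ∧ ∀ a b c : ℝ, a < b → b < c → c - b < b - a →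
    ∀ E : Set ℝ, MeasurableSet E → E ⊆ Ioo a b →
      ∫⁻ x in E, ENNReal.ofReal (w x) ≤
        ENNReal.ofReal C * (volume E / ENNReal.ofReal (c - b)) ^ ε *
          ∫⁻ x, maximal ((Ioo a c).indicator 1) x ^ p * ENNReal.ofReal (w x)

/-- The estimate `‖M⁺ f‖_{L^p(w)} ≲ ‖M^{♯,+} f‖_{L^p(w)}`, with a constant independent of `f`, for
all nonnegative bounded `f` of compact support whose left-hand side is finite. -/
def SharpEstimate (p : ℝ) (w : ℝ → ℝ) : Prop :=
  ∃ C : ℝ≥0, ∀ f : ℝ → ℝ, (∀ x, 0 ≤ f x) → MemLp f ∞ volume → HasCompactSupport f →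
    weightedNorm p w (maximal f) < ∞ →
      weightedNorm p w (maximal f) ≤ C * weightedNorm p w (sharpMaximal f)

end OneSided

end

/-!
# The one-sided sharp maximal function and the condition `C_p⁺`

Everything is expressed through the distribution function `F` of `f`: the set `{M⁺ f > t}` is then
the set `risingSet F t` of the rising sun lemma, whose components `I` satisfy `∫_I f = t |I|`. The
maximal function of an interval is the explicit function `hat I`, and the weight is replaced by the
measure `μ = w dx`.

**Sufficiency.** On a component `(α, β)` of `{M⁺ f > t}` the average of `f` over any interval
starting at `β` is at most `t`. Hence a bound `M^{♯,+} f (x) ≤ γ t` makes the excess of `f` over `t`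
small on `(x, β)`, and the weak type inequality gives a good-lambda inequality on the pieces
`(xᵢ, xᵢ₊₁)`, `xᵢ = β - 2⁻ⁱ (β - α)` (`volume_goodLambda_le`). With `C_q⁺` applied to the triples
`xᵢ < xᵢ₊₁ < xᵢ₊₂`, the exceptional sets have `μ`-measure at most a small multiple of
`∑_I ∫ (hat I) ^ q dμ`, the sum running over the components at height `t`. It remains to
bound `∑_k A ^ (k p) ∑_I ∫ (hat I) ^ q dμ`, with `I` running over the components at height `A ^ k`,
by `∑_k A ^ (k p) μ {M⁺ f > A ^ k}`, which is comparable to `∫ (M⁺ f) ^ p dμ`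
(`TailCondition.exists_tsum_levelSum_le`). This is a recursion in `k`. The components at height `t`
inside a component at height `t / A` together have only `1 / A` of its length, so that far from it
they cost `A ^ (-q)`, which beats `A ^ p` because `p < q`. Near it, all points lie in the level set
of height `t / A ^ 2`, and there the sum of `(hat J) ^ q` is in every Lebesgue space `L ^ n`
(`lintegral_sum_hat_pow_le`), so that by `C_q⁺` it acts as a constant `T` up to a small error
(`TailCondition.exists_lintegral_tsum_hat_le`). Absorption into the left-hand side requires a priori
finiteness, which comes from `M⁺ f ∈ L^p(w)` and the compact support of `f`.

**Necessity.** For an open set `U ⊆ (a, b)` let `N` be the left maximal function of `χ_U` and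
`λ = |U| / (c - b)`. The function `f = max (1, N / λ) ^ δ - 1` is supported in `(a, c)` and equals
`λ ^ (-δ) - 1` on `U` (when `λ ≤ 1`). Its oscillation is of order `δ` relative to its size, so
`M^{♯,+} f ≤ 12 δ (M⁺ χ_(a,c) + M⁺ f)` (`sharpMaximal_testFun_le`). For small `δ` the
last term is absorbed by the sharp maximal estimate, which leaves `∫ (M⁺ f) ^ p w` bounded by
`∫ (M⁺ χ_(a,c)) ^ p w`, and this is `C_p⁺` with `ε = δ p`.
-/

namespace OneSided

/-! ### Monotone functions and the rising sun lemma -/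

/-- `F` is continuous, nondecreasing, and constant to the left of `l` and to the right of `r`: the
distribution function, up to an additive constant, of an atomless finite measure on `[l, r]`. -/
structure IsCDF (F : ℝ → ℝ) (l r : ℝ) : Prop where
  cont : Continuous F
  mono : Monotone F
  left : ∀ x ≤ l, F x = F l
  right : ∀ x, r ≤ x → F x = F r

/-- The set where the right maximal function of `dF` exceeds `t`, in the form in which the rising
sun lemma applies to it. -/
def risingSet (F : ℝ → ℝ) (t : ℝ) : Set ℝ := {x | ∃ y, x < y ∧ t * (y - x) < F y - F x}

/-- The bounded connected components of an open set `Ω`, encoded by their pairs of endpoints. -/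
def components (Ω : Set ℝ) : Set (ℝ × ℝ) :=
  {I | I.1 < I.2 ∧ I.1 ∉ Ω ∧ I.2 ∉ Ω ∧ Ioo I.1 I.2 ⊆ Ω}

theorem isOpen_risingSet {F : ℝ → ℝ} (hF : Continuous F) (t : ℝ) : IsOpen (risingSet F t) := by
  have : risingSet F t = ⋃ y, {x | x < y ∧ t * (y - x) < F y - F x} := by
    ext x; simp [risingSet]
  rw [this]
  refine isOpen_iUnion fun y => ?_
  exact (isOpen_lt continuous_id continuous_const).inter
    (isOpen_lt (f := fun x => t * (y - x)) (g := fun x => F y - F x) (by fun_prop) (by fun_prop))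

theorem risingSet_anti {F : ℝ → ℝ} {s t : ℝ} (h : s ≤ t) : risingSet F t ⊆ risingSet F s := by
  rintro x ⟨y, hxy, hy⟩
  exact ⟨y, hxy, lt_of_le_of_lt (mul_le_mul_of_nonneg_right h (by linarith)) hy⟩

/-- An interval contained in `Ω` that meets a component lies in that component. -/
theorem le_of_mem_components {Ω : Set ℝ} {I : ℝ × ℝ} (hI : I ∈ components Ω) {x y z : ℝ}
    (hx : x ∈ Ioo I.1 I.2) (hxyz : x ∈ Ioo y z) (h : Ioo y z ⊆ Ω) : I.1 ≤ y ∧ z ≤ I.2 := by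
  obtain ⟨-, h1, h2, -⟩ := hI
  constructor
  · by_contra! hlt
    exact h1 (h ⟨hlt, hx.1.trans hxyz.2⟩)
  · by_contra! hlt
    exact h2 (h ⟨hxyz.1.trans hx.2, hlt⟩)

theorem components_pairwiseDisjoint (Ω : Set ℝ) :
    (components Ω).PairwiseDisjoint (fun I => Ioo I.1 I.2) := by
  intro I hI J hJ hne
  refine Set.disjoint_left.2 fun x hxI hxJ => hne ?_
  obtain ⟨a, b⟩ := le_of_mem_components hI hxI hxJ hJ.2.2.2
  obtain ⟨c, d⟩ := le_of_mem_components hJ hxJ hxI hI.2.2.2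
  exact Prod.ext (le_antisymm a c) (le_antisymm d b)

theorem components_countable (Ω : Set ℝ) : (components Ω).Countable :=
  (components_pairwiseDisjoint Ω).countable_of_isOpen (fun _ _ => isOpen_Ioo)
    (fun _ hI => nonempty_Ioo.2 hI.1)

theorem exists_mem_components {Ω : Set ℝ} (hΩ : IsOpen Ω) {l x r : ℝ} (hx : x ∈ Ω)
    (hl : l ∉ Ω) (hlx : l ≤ x) (hr : r ∉ Ω) (hxr : x ≤ r) :
    ∃ I ∈ components Ω, x ∈ Ioo I.1 I.2 := by
  have hA : IsCompact (Icc l x ∩ Ωᶜ) := isCompact_Icc.inter_right hΩ.isClosed_compl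
  have hB : IsCompact (Icc x r ∩ Ωᶜ) := isCompact_Icc.inter_right hΩ.isClosed_compl
  obtain ⟨a, ha, ha'⟩ := hA.exists_isGreatest ⟨l, ⟨le_rfl, hlx⟩, hl⟩
  obtain ⟨b, hb, hb'⟩ := hB.exists_isLeast ⟨r, ⟨hxr, le_rfl⟩, hr⟩
  have hax : a < x := lt_of_le_of_ne ha.1.2 (fun h => ha.2 (h ▸ hx))
  have hxb : x < b := lt_of_le_of_ne hb.1.1 (fun h => hb.2 (h ▸ hx))
  refine ⟨(a, b), ⟨hax.trans hxb, ha.2, hb.2, fun y hy => ?_⟩, hax, hxb⟩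
  by_contra hyΩ
  rcases le_total y x with h | h
  · exact absurd (ha' ⟨⟨ha.1.1.trans hy.1.le, h⟩, hyΩ⟩) (not_le.2 hy.1)
  · exact absurd (hb' ⟨⟨h, hy.2.le.trans hb.1.2⟩, hyΩ⟩) (not_le.2 hy.2)

theorem iUnion_components {Ω : Set ℝ} (hΩ : IsOpen Ω) {l r : ℝ}
    (hl : ∀ x ≤ l, x ∉ Ω) (hr : ∀ x, r ≤ x → x ∉ Ω) :
    ⋃ I ∈ components Ω, Ioo I.1 I.2 = Ω := by
  ext x
  simp only [mem_iUnion, exists_prop]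
  constructor
  · rintro ⟨I, hI, hx⟩
    exact hI.2.2.2 hx
  · intro hx
    exact exists_mem_components hΩ hx (hl _ (min_le_right x l)) (min_le_left _ _)
      (hr _ (le_max_right x r)) (le_max_left _ _)

namespace IsCDF

variable {F : ℝ → ℝ} {l r : ℝ}

theorem sub_le (hF : IsCDF F l r) (x y : ℝ) : F y - F x ≤ F r - F l := by
  have h1 : F y ≤ F r := by
    rcases le_total y r with h | h
    · exact hF.mono h
    · exact (hF.right y h).le
  have h2 : F l ≤ F x := by
    rcases le_total l x with h | h
    · exact hF.mono h
    · exact (hF.left x h).ge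
  linarith

theorem lt_of_mem_risingSet (hF : IsCDF F l r) {t : ℝ} (ht : 0 < t) {x : ℝ}
    (hx : x ∈ risingSet F t) : x < r := by
  by_contra! h
  obtain ⟨y, hxy, hy⟩ := hx
  rw [hF.right x h, hF.right y (h.trans hxy.le), sub_self] at hy
  nlinarith

theorem le_of_mem_risingSet (hF : IsCDF F l r) {t : ℝ} (ht : 0 < t) {x : ℝ}
    (hx : x ∈ risingSet F t) : l - (F r - F l) / t < x := by
  obtain ⟨y, hxy, hy⟩ := hx
  have hly : l < y := by
    by_contra! h
    rw [hF.left x (hxy.le.trans h), hF.left y h, sub_self] at hy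
    nlinarith
  have := hy.trans_le (hF.sub_le x y)
  have : y - x < (F r - F l) / t := by rw [lt_div_iff₀ ht]; linarith
  linarith

theorem exists_component (hF : IsCDF F l r) {t : ℝ} (ht : 0 < t) {x : ℝ}
    (hx : x ∈ risingSet F t) : ∃ I ∈ components (risingSet F t), x ∈ Ioo I.1 I.2 := by
  refine exists_mem_components (l := l - (F r - F l) / t) (r := r)
    (isOpen_risingSet hF.cont t) hx ?_ ?_ ?_ ?_
  · exact fun h => (hF.le_of_mem_risingSet ht h).false
  · exact (hF.le_of_mem_risingSet ht hx).le
  · exact fun h => (hF.lt_of_mem_risingSet ht h).false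
  · exact (hF.lt_of_mem_risingSet ht hx).le

theorem iUnion_components (hF : IsCDF F l r) {t : ℝ} (ht : 0 < t) :
    ⋃ I ∈ components (risingSet F t), Ioo I.1 I.2 = risingSet F t :=
  OneSided.iUnion_components (isOpen_risingSet hF.cont t)
    (fun _ hx h => (hF.le_of_mem_risingSet ht h).not_ge hx)
    (fun _ hx h => (hF.lt_of_mem_risingSet ht h).not_ge hx)

end IsCDF

theorem sub_le_of_notMem_risingSet {F : ℝ → ℝ} {t x y : ℝ} (hx : x ∉ risingSet F t)
    (hxy : x ≤ y) : F y - F x ≤ t * (y - x) := by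
  rcases hxy.eq_or_lt with rfl | h
  · simp
  · by_contra! hlt
    exact hx ⟨y, h, hlt⟩

/-- The rising sun lemma: averages of `dF` over final segments of a component of `risingSet F t`
are at least `t`. -/
theorem le_sub_of_mem_components {F : ℝ → ℝ} (hF : Continuous F) {t : ℝ} {I : ℝ × ℝ}
    (hI : I ∈ components (risingSet F t)) {x : ℝ} (hx : x ∈ Ioo I.1 I.2) :
    t * (I.2 - x) ≤ F I.2 - F x := by
  by_contra! hlt
  have hc : IsCompact (Icc x I.2 ∩ {y | F x - t * x ≤ F y - t * y}) :=
    isCompact_Icc.inter_right (isClosed_le continuous_const (by fun_prop))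
  -- the last point of `[x, I.2]` at which `F - t · id` is at least its value at `x`
  obtain ⟨y, ⟨hy, hyF⟩, hmax⟩ := hc.exists_isGreatest ⟨x, ⟨le_rfl, hx.2.le⟩, le_refl (F x - t * x)⟩
  simp only [mem_ofPred_eq] at hyF
  have hy2 : y < I.2 := by
    refine lt_of_le_of_ne hy.2 ?_
    rintro rfl
    linarith
  obtain ⟨z, hyz, hz⟩ := hI.2.2.2 ⟨hx.1.trans_le hy.1, hy2⟩
  rcases le_or_gt z I.2 with h | h
  · have := hmax ⟨⟨hy.1.trans hyz.le, h⟩, by simp only [mem_ofPred_eq]; linarith⟩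
    linarith
  · have := sub_le_of_notMem_risingSet hI.2.2.1 h.le
    linarith

theorem sub_eq_of_mem_components {F : ℝ → ℝ} (hF : Continuous F) {t : ℝ} {I : ℝ × ℝ}
    (hI : I ∈ components (risingSet F t)) : F I.2 - F I.1 = t * (I.2 - I.1) := by
  refine le_antisymm (sub_le_of_notMem_risingSet hI.2.1 hI.1.le) ?_
  have h1 : Filter.Tendsto (fun x => t * (I.2 - x)) (nhdsWithin I.1 (Ioi I.1))
      (nhds (t * (I.2 - I.1))) :=
    ((by fun_prop : Continuous fun x => t * (I.2 - x)).tendsto _).mono_left nhdsWithin_le_nhds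
  have h2 : Filter.Tendsto (fun x => F I.2 - F x) (nhdsWithin I.1 (Ioi I.1))
      (nhds (F I.2 - F I.1)) :=
    ((by fun_prop : Continuous fun x => F I.2 - F x).tendsto _).mono_left nhdsWithin_le_nhds
  refine le_of_tendsto_of_tendsto h1 h2 ?_
  filter_upwards [Ioo_mem_nhdsGT hI.1] with x hx using le_sub_of_mem_components hF hI hx

/-- The increments of a nondecreasing function over disjoint subintervals of `(x, y)` add up to at
most its increment over `(x, y)`. -/
theorem tsum_sub_le {F : ℝ → ℝ} (hF : Continuous F) (hm : Monotone F) {T : Set (ℝ × ℝ)}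
    (hT : T.Countable) (hd : T.PairwiseDisjoint (fun I => Ioo I.1 I.2)) {x y : ℝ}
    (hsub : ∀ I ∈ T, Ioo I.1 I.2 ⊆ Ioo x y) :
    ∑' I : T, ENNReal.ofReal (F I.1.2 - F I.1.1) ≤ ENNReal.ofReal (F y - F x) := by
  let S : StieltjesFunction ℝ := ⟨F, hm, fun x => hF.continuousWithinAt⟩
  have hS : ∀ a b : ℝ, S.measure (Ioo a b) = ENNReal.ofReal (F b - F a) := by
    intro a b
    rw [StieltjesFunction.measure_Ioo]
    congr 2
    exact ContinuousWithinAt.leftLim_eq hF.continuousWithinAt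
  calc ∑' I : T, ENNReal.ofReal (F I.1.2 - F I.1.1)
      = ∑' I : T, S.measure (Ioo I.1.1 I.1.2) := by simp_rw [hS]
    _ = S.measure (⋃ I ∈ T, Ioo I.1 I.2) :=
        (measure_biUnion hT hd fun _ _ => measurableSet_Ioo).symm
    _ ≤ S.measure (Ioo x y) := measure_mono (iUnion₂_subset hsub)
    _ = _ := hS x y

theorem measurableSet_risingSet {F : ℝ → ℝ} (hF : Continuous F) (t : ℝ) :
    MeasurableSet (risingSet F t) := (isOpen_risingSet hF t).measurableSet

/-- A measure of `risingSet F t` is the sum of the measures of the components. -/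
theorem IsCDF.tsum_measure_components {F : ℝ → ℝ} {l r : ℝ} (hF : IsCDF F l r) {t : ℝ}
    (ht : 0 < t) (μ : Measure ℝ) :
    ∑' I : components (risingSet F t), μ (Ioo I.1.1 I.1.2) = μ (risingSet F t) := by
  conv_rhs => rw [← hF.iUnion_components ht]
  exact (measure_biUnion (components_countable _) (components_pairwiseDisjoint _)
    fun _ _ => measurableSet_Ioo).symm

/-- The weak type `(1, 1)` inequality for the right maximal function, with constant `1`. -/
theorem IsCDF.volume_risingSet_le {F : ℝ → ℝ} {l r : ℝ} (hF : IsCDF F l r) {t : ℝ}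
    (ht : 0 < t) : volume (risingSet F t) ≤ ENNReal.ofReal ((F r - F l) / t) := by
  rw [← hF.tsum_measure_components ht]
  set T := components (risingSet F t)
  have h1 : ∀ I : T, volume (Ioo I.1.1 I.1.2)
      = ENNReal.ofReal t⁻¹ * ENNReal.ofReal (F I.1.2 - F I.1.1) := by
    intro I
    rw [Real.volume_Ioo, sub_eq_of_mem_components hF.cont I.2,
      ← ENNReal.ofReal_mul (by positivity), inv_mul_cancel_left₀ ht.ne']
  simp_rw [h1]
  rw [ENNReal.tsum_mul_left, div_eq_inv_mul, ENNReal.ofReal_mul (by positivity)]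
  gcongr
  refine (tsum_sub_le hF.cont hF.mono (components_countable _) (components_pairwiseDisjoint _)
    (x := l - (F r - F l) / t) (y := r) ?_).trans ?_
  · intro I hI x hx
    exact ⟨hF.le_of_mem_risingSet ht (hI.2.2.2 hx), hF.lt_of_mem_risingSet ht (hI.2.2.2 hx)⟩
  · exact ENNReal.ofReal_le_ofReal (hF.sub_le _ _)

/-- Truncating a nondecreasing function to `[l, r]` gives a distribution function. -/
theorem isCDF_clamp {F : ℝ → ℝ} (hF : Continuous F) (hm : Monotone F) {l r : ℝ} (hlr : l ≤ r) :
    IsCDF (fun x => F (max l (min x r))) l r where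
  cont := by fun_prop
  mono := fun x y h => hm (max_le_max le_rfl (min_le_min h le_rfl))
  left := fun x hx => by
    have : min x r ≤ l := (min_le_left _ _).trans hx
    simp [this, hlr]
  right := fun x hx => by simp [hx]

/-! ### The maximal function of an interval -/

/-- The explicit form of `M⁺ χ_I` for the interval `I = (I.1, I.2)`: it is `1` on `I`, `0` to the
right of `I`, and `|I| / (I.2 - x)` to the left of `I`. -/
noncomputable def hat (I : ℝ × ℝ) (x : ℝ) : ℝ≥0∞ :=
  ENNReal.ofReal (if x < I.2 then (I.2 - I.1) / (I.2 - min x I.1) else 0)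

theorem hat_of_right {I : ℝ × ℝ} {x : ℝ} (h : I.2 ≤ x) : hat I x = 0 := by
  simp [hat, h.not_gt]

theorem hat_of_mem {I : ℝ × ℝ} {x : ℝ} (h1 : I.1 ≤ x) (h2 : x < I.2) : hat I x = 1 := by
  have : I.2 - I.1 ≠ 0 := by linarith
  simp [hat, h2, h1, this]

theorem hat_of_left {I : ℝ × ℝ} {x : ℝ} (hI : I.1 < I.2) (h : x ≤ I.1) :
    hat I x = ENNReal.ofReal ((I.2 - I.1) / (I.2 - x)) := by
  simp [hat, h, h.trans_lt hI]

theorem hat_le_one {I : ℝ × ℝ} (hI : I.1 < I.2) (x : ℝ) : hat I x ≤ 1 := by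
  unfold hat
  split_ifs with h
  · rw [ENNReal.ofReal_le_one]
    exact div_le_one_of_le₀ (by linarith [min_le_right x I.1])
      (by linarith [min_le_right x I.1])
  · simp

theorem measurable_hat (I : ℝ × ℝ) : Measurable (hat I) := by
  unfold hat
  exact (Measurable.ite measurableSet_Iio (by fun_prop) measurable_const).ennreal_ofReal

/-- To the left of `I`, the function `hat I` is increasing. -/
theorem hat_mono_left {I : ℝ × ℝ} (hI : I.1 < I.2) {x y : ℝ} (hxy : x ≤ y) (hy : y ≤ I.1) :
    hat I x ≤ hat I y := by
  rw [hat_of_left hI (hxy.trans hy), hat_of_left hI hy]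
  refine ENNReal.ofReal_le_ofReal ?_
  exact div_le_div_of_nonneg_left (by linarith) (by linarith) (by linarith)

theorem maximal_indicator_Ioo {a c : ℝ} (hac : a < c) (x : ℝ) :
    maximal ((Ioo a c).indicator 1) x = hat (a, c) x := by
  have key : ∀ h : ℝ, 0 < h →
      (∫⁻ y in Ioc x (x + h), ‖(Ioo a c).indicator (1 : ℝ → ℝ) y‖ₑ) / ENNReal.ofReal h
        = ENNReal.ofReal ((min c (x + h) - max a x) / h) := by
    intro h hh
    have h1 : ∀ y, ‖(Ioo a c).indicator (1 : ℝ → ℝ) y‖ₑ = (Ioo a c).indicator 1 y := by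
      intro y
      by_cases hy : y ∈ Ioo a c <;> simp [hy]
    simp_rw [h1]
    rw [lintegral_indicator_one measurableSet_Ioo, Measure.restrict_apply measurableSet_Ioo,
      ENNReal.ofReal_div_of_pos hh, measure_congr (Ioo_ae_eq_Ioc.inter (ae_eq_refl (Ioc x (x + h)))),
      Ioc_inter_Ioc, Real.volume_Ioc]
  unfold maximal
  apply le_antisymm
  · refine iSup₂_le fun h hh => ?_
    rw [key h hh]
    unfold hat
    split_ifs with hx
    · refine ENNReal.ofReal_le_ofReal ?_
      simp only at hx ⊢
      have hm : min x a ≤ a := min_le_right _ _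
      rw [div_le_div_iff₀ hh (by linarith)]
      rcases le_total x a with hxa | hxa
      · rw [min_eq_left hxa, max_eq_left hxa]
        rcases le_total c (x + h) with h' | h'
        · rw [min_eq_left h']
          nlinarith
        · rw [min_eq_right h']
          nlinarith
      · rw [min_eq_right hxa, max_eq_right hxa]
        have : min c (x + h) ≤ x + h := min_le_right _ _
        nlinarith
    · simp only [not_lt] at hx
      rw [ENNReal.ofReal_of_nonpos]
      · exact bot_le
      · exact div_nonpos_of_nonpos_of_nonneg
          (by linarith [min_le_left c (x + h), le_max_right a x]) hh.le
  · rcases le_or_gt c x with hx | hx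
    · rw [hat_of_right (by exact hx)]
      exact bot_le
    · refine le_iSup₂_of_le (c - x) (sub_pos.2 hx) ?_
      rw [key _ (sub_pos.2 hx)]
      rcases le_total x a with hxa | hxa
      · rw [hat_of_left hac (by exact hxa), max_eq_left hxa]
        simp
      · rw [hat_of_mem (by exact hxa) (by exact hx), max_eq_right hxa]
        have : c - x ≠ 0 := by linarith
        simp [this]

theorem lintegral_Iic_hat_rpow_le {I : ℝ × ℝ} (hI : I.1 < I.2) {q : ℝ} (hq : 1 < q) :
    ∫⁻ x in Iic I.1, hat I x ^ q ≤ ENNReal.ofReal (1 / (q - 1)) * ENNReal.ofReal (I.2 - I.1) := by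
  set L := I.2 - I.1 with hL
  have hLpos : 0 < L := by linarith
  have h1 : ∫⁻ x in Iic I.1, hat I x ^ q
      = ∫⁻ x in Iic I.1, (fun u => ENNReal.ofReal (L ^ q * u ^ (-q))) (I.2 - x) := by
    refine setLIntegral_congr_fun measurableSet_Iic fun x hx => ?_
    simp only [mem_Iic] at hx
    have hx2 : 0 < I.2 - x := by linarith
    simp only
    rw [hat_of_left hI hx, ENNReal.ofReal_rpow_of_nonneg (by positivity) (by linarith),
      Real.div_rpow hLpos.le hx2.le, Real.rpow_neg hx2.le, div_eq_mul_inv]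
  have hpre : Iic I.1 = (fun x => I.2 - x) ⁻¹' (Ici L) := by
    ext x; simp only [mem_Iic, mem_preimage, mem_Ici, hL]; constructor <;> intro h <;> linarith
  have hmp := (Measure.measurePreserving_sub_left volume I.2).setLIntegral_comp_preimage
    (measurableSet_Ici (a := L)) (f := fun u => ENNReal.ofReal (L ^ q * u ^ (-q))) (by fun_prop)
  rw [h1, hpre, hmp, setLIntegral_congr (Ioi_ae_eq_Ici (a := L)).symm,
    ← ofReal_integral_eq_lintegral_ofReal, integral_const_mul,
    integral_Ioi_rpow_of_lt (by linarith) hLpos, ← ENNReal.ofReal_mul (by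
      have : 0 < q - 1 := by linarith
      positivity)]
  · refine ENNReal.ofReal_le_ofReal (le_of_eq ?_)
    have e1 : L ^ q * L ^ (-q + 1) = L := by
      rw [← Real.rpow_add hLpos]; simp
    have e2 : q - 1 ≠ 0 := by linarith
    have e3 : -q + 1 = -(q - 1) := by ring
    calc L ^ q * (-L ^ (-q + 1) / (-q + 1)) = (L ^ q * L ^ (-q + 1)) / (q - 1) := by
          rw [e3]; field_simp
      _ = _ := by rw [e1]; ring
  · exact (integrableOn_Ioi_rpow_of_lt (by linarith) hLpos).const_mul _
  · filter_upwards [self_mem_ae_restrict measurableSet_Ioi] with u hu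
    have : 0 < u := hLpos.trans hu
    exact mul_nonneg (by positivity) (by positivity)

/-- The points `b - 2⁻ⁱ (b - a)` of the interval `I = (a, b)`, which accumulate at its right end. -/
noncomputable def whitneyPoint (I : ℝ × ℝ) (i : ℕ) : ℝ := I.2 - (I.2 - I.1) * (1 / 2) ^ i

theorem whitneyPoint_zero (I : ℝ × ℝ) : whitneyPoint I 0 = I.1 := by simp [whitneyPoint]

theorem whitneyPoint_succ_sub (I : ℝ × ℝ) (i : ℕ) :
    whitneyPoint I (i + 1) - whitneyPoint I i = (I.2 - I.1) * (1 / 2) ^ i / 2 := by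
  simp only [whitneyPoint, pow_succ]; ring

theorem whitneyPoint_strictMono {I : ℝ × ℝ} (hI : I.1 < I.2) : StrictMono (whitneyPoint I) := by
  refine strictMono_nat_of_lt_succ fun i => ?_
  have := whitneyPoint_succ_sub I i
  have h2 : 0 < (I.2 - I.1) * (1 / 2) ^ i / 2 := by
    have : 0 < I.2 - I.1 := by linarith
    positivity
  linarith

theorem whitneyPoint_lt {I : ℝ × ℝ} (hI : I.1 < I.2) (i : ℕ) : whitneyPoint I i < I.2 := by
  have : 0 < I.2 - I.1 := by linarith
  have : 0 < (I.2 - I.1) * (1 / 2) ^ i := by positivity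
  simp only [whitneyPoint]; linarith

theorem sub_whitneyPoint (I : ℝ × ℝ) (i : ℕ) :
    I.2 - whitneyPoint I i = (I.2 - I.1) * (1 / 2) ^ i := by
  simp [whitneyPoint]

theorem iUnion_Ioc_whitneyPoint {I : ℝ × ℝ} (hI : I.1 < I.2) :
    ⋃ i, Ioc (whitneyPoint I i) (whitneyPoint I (i + 1)) = Ioo I.1 I.2 := by
  have hmono := whitneyPoint_strictMono hI
  ext x
  simp only [mem_iUnion, mem_Ioc, mem_Ioo]
  constructor
  · rintro ⟨i, h1, h2⟩
    refine ⟨?_, h2.trans_lt (whitneyPoint_lt hI _)⟩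
    have := hmono.monotone (Nat.zero_le i)
    rw [whitneyPoint_zero] at this
    linarith
  · rintro ⟨h1, h2⟩
    have hL : 0 < I.2 - I.1 := by linarith
    have hex : ∃ n, x ≤ whitneyPoint I n := by
      obtain ⟨n, hn⟩ := exists_pow_lt_of_lt_one (div_pos (sub_pos.2 h2) hL)
        (by norm_num : (1 / 2 : ℝ) < 1)
      rw [lt_div_iff₀ hL] at hn
      exact ⟨n, by simp only [whitneyPoint]; linarith⟩
    classical
    have hspec := Nat.find_spec hex
    rcases hn : Nat.find hex with _ | i
    · rw [hn, whitneyPoint_zero] at hspec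
      linarith
    · refine ⟨i, ?_, hn ▸ hspec⟩
      have := Nat.find_min hex (m := i) (by omega)
      exact not_le.1 this

theorem pairwise_disjoint_Ioc_whitneyPoint {I : ℝ × ℝ} (hI : I.1 < I.2) :
    Pairwise (Function.onFun Disjoint
      fun i => Ioc (whitneyPoint I i) (whitneyPoint I (i + 1))) :=
  (whitneyPoint_strictMono hI).monotone.pairwise_disjoint_on_Ioc_succ

/-- The maximal functions of the Whitney pieces `(xᵢ, xᵢ₊₂)` of `I` sum to a multiple of that of
`I`, because at a given point they form a geometric progression. -/
theorem tsum_hat_whitney_rpow_le {I : ℝ × ℝ} (hI : I.1 < I.2) {q : ℝ} (hq : 1 ≤ q) (x : ℝ) :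
    ∑' i, hat (whitneyPoint I i, whitneyPoint I (i + 2)) x ^ q
      ≤ ENNReal.ofReal (2 * 4 ^ q) * hat I x ^ q := by
  have hL : 0 < I.2 - I.1 := by linarith
  rcases le_or_gt I.2 x with hx | hx
  · have : ∀ i, hat (whitneyPoint I i, whitneyPoint I (i + 2)) x = 0 := fun i =>
      hat_of_right ((whitneyPoint_lt hI _).le.trans hx)
    simp [this, ENNReal.zero_rpow_of_pos (by linarith : 0 < q)]
  set d := I.2 - min x I.1 with hd
  have hmx : min x I.1 ≤ x := min_le_left _ _
  have hmI : min x I.1 ≤ I.1 := min_le_right _ _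
  have hdpos : 0 < d := by linarith
  set v := (I.2 - I.1) / d with hv
  have hvpos : 0 < v := by positivity
  have hhat : hat I x = ENNReal.ofReal v := by simp [hat, hx, hv, hd]
  -- the first piece whose right end lies beyond `x`
  have hex : ∃ n, x < whitneyPoint I (n + 2) := by
    obtain ⟨n, hn⟩ := exists_pow_lt_of_lt_one (div_pos (sub_pos.2 hx) hL)
      (by norm_num : (1 / 2 : ℝ) < 1)
    rw [lt_div_iff₀ hL] at hn
    refine ⟨n, lt_trans ?_ (whitneyPoint_strictMono hI (by omega : n < n + 2))⟩
    simp only [whitneyPoint]; linarith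
  classical
  set n := Nat.find hex with hn
  have hspec : x < whitneyPoint I (n + 2) := Nat.find_spec hex
  have hlt : ∀ i < n, hat (whitneyPoint I i, whitneyPoint I (i + 2)) x ^ q = 0 := by
    intro i hi
    rw [hat_of_right (by exact not_lt.1 (Nat.find_min hex hi)),
      ENNReal.zero_rpow_of_pos (by linarith)]
  have hxd : I.2 - x ≤ d := by linarith
  have hn4 : (I.2 - I.1) * (1 / 2) ^ n ≤ 4 * (I.2 - x) := by
    have := hspec
    simp only [whitneyPoint, pow_add] at this
    linarith
  have hvx : (I.2 - I.1) * (1 / 2) ^ n / (I.2 - x) ≤ 4 * v := by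
    have hx' : 0 < I.2 - x := sub_pos.2 hx
    rw [hv, div_le_iff₀ hx']
    rcases le_total x I.1 with h | h
    · have hdx : d = I.2 - x := by rw [hd, min_eq_left h]
      rw [hdx, mul_assoc, div_mul_cancel₀ _ hx'.ne']
      have : ((1 : ℝ) / 2) ^ n ≤ 1 := pow_le_one₀ (by norm_num) (by norm_num)
      nlinarith
    · have hdx : d = I.2 - I.1 := by rw [hd, min_eq_right h]
      rw [hdx, div_self hL.ne']
      linarith
  have hle : ∀ k, hat (whitneyPoint I (k + n), whitneyPoint I (k + n + 2)) x ^ q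
      ≤ ENNReal.ofReal (4 ^ q) * hat I x ^ q * 2⁻¹ ^ k := by
    intro k
    have hx' : 0 < I.2 - x := sub_pos.2 hx
    have hxk : x < whitneyPoint I (k + n + 2) :=
      hspec.trans_le ((whitneyPoint_strictMono hI).monotone (by omega))
    have hbase : hat (whitneyPoint I (k + n), whitneyPoint I (k + n + 2)) x
        ≤ ENNReal.ofReal ((I.2 - I.1) * (1 / 2) ^ (k + n) / (I.2 - x)) := by
      have hm := whitneyPoint_strictMono hI (by omega : k + n < k + n + 2)
      rcases le_total x (whitneyPoint I (k + n)) with h | h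
      · rw [hat_of_left hm h]
        refine ENNReal.ofReal_le_ofReal ?_
        simp only at hm ⊢
        rw [div_le_div_iff₀ (by linarith) hx']
        simp only [whitneyPoint, pow_add] at hm h hxk ⊢
        have hp : 0 < (I.2 - I.1) * ((1 / 2) ^ k * (1 / 2) ^ n) := by positivity
        nlinarith
      · rw [hat_of_mem h hxk, ENNReal.one_le_ofReal, one_le_div hx']
        simp only [whitneyPoint] at h
        linarith
    have hstep : (I.2 - I.1) * (1 / 2) ^ (k + n) / (I.2 - x) ≤ 4 * v * (1 / 2) ^ k := by
      have e : (I.2 - I.1) * (1 / 2) ^ (k + n) / (I.2 - x)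
          = (I.2 - I.1) * (1 / 2) ^ n / (I.2 - x) * (1 / 2) ^ k := by rw [pow_add]; ring
      rw [e]
      gcongr
    have hhalf : ENNReal.ofReal ((1 / 2) ^ k) = 2⁻¹ ^ k := by
      rw [ENNReal.ofReal_pow (by norm_num), one_div, ENNReal.ofReal_inv_of_pos (by norm_num)]
      norm_num
    calc hat (whitneyPoint I (k + n), whitneyPoint I (k + n + 2)) x ^ q
        ≤ ENNReal.ofReal (4 * v * (1 / 2) ^ k) ^ q := by
          gcongr
          exact hbase.trans (ENNReal.ofReal_le_ofReal hstep)
      _ = ENNReal.ofReal (4 ^ q) * hat I x ^ q * (2⁻¹ ^ k) ^ q := by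
          rw [hhat, ENNReal.ofReal_mul (by positivity), ENNReal.ofReal_mul (by positivity),
            ENNReal.mul_rpow_of_nonneg _ _ (by linarith),
            ENNReal.mul_rpow_of_nonneg _ _ (by linarith), hhalf,
            ENNReal.ofReal_rpow_of_pos (by norm_num)]
      _ ≤ _ := by
          gcongr
          calc ((2⁻¹ : ℝ≥0∞) ^ k) ^ q ≤ (2⁻¹ ^ k) ^ (1 : ℝ) :=
                ENNReal.rpow_le_rpow_of_exponent_ge
                  (pow_le_one₀ bot_le (ENNReal.inv_le_one.2 (by norm_num))) hq
            _ = _ := ENNReal.rpow_one _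
  rw [← Summable.sum_add_tsum_nat_add' (k := n) ENNReal.summable,
    Finset.sum_eq_zero (fun i hi => hlt i (Finset.mem_range.1 hi)), zero_add]
  calc ∑' k, hat (whitneyPoint I (k + n), whitneyPoint I (k + n + 2)) x ^ q
      ≤ ∑' k, ENNReal.ofReal (4 ^ q) * hat I x ^ q * 2⁻¹ ^ k := ENNReal.tsum_le_tsum hle
    _ = ENNReal.ofReal (4 ^ q) * hat I x ^ q * 2 := by
        rw [ENNReal.tsum_mul_left, ENNReal.tsum_geometric, ENNReal.one_sub_inv_two, inv_inv]
    _ = _ := by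
        rw [ENNReal.ofReal_mul (by norm_num)]
        norm_num
        ring

/-! ### Moments of sums of maximal functions of disjoint intervals -/

theorem add_pow_le_pow_add (a b : ℝ≥0∞) (n : ℕ) :
    (a + b) ^ (n + 1) ≤ b ^ (n + 1) + (n + 1) * (a * (a + b) ^ n) := by
  induction n with
  | zero => simp [add_comm]
  | succ n ih =>
    calc (a + b) ^ (n + 1 + 1) = a * (a + b) ^ (n + 1) + b * (a + b) ^ (n + 1) := by ring
      _ ≤ a * (a + b) ^ (n + 1) + b * (b ^ (n + 1) + (n + 1) * (a * (a + b) ^ n)) := by gcongr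
      _ = a * (a + b) ^ (n + 1) + b ^ (n + 1 + 1) + (n + 1) * (a * (b * (a + b) ^ n)) := by ring
      _ ≤ a * (a + b) ^ (n + 1) + b ^ (n + 1 + 1)
            + (n + 1) * (a * ((a + b) * (a + b) ^ n)) := by
          gcongr
          exact le_add_self
      _ = _ := by push_cast; ring

/-- Comparison of the tail of `hat J` with its core: if `g` increases up to the left end of `J`
and is bounded on the left by its values on `J`, then `∫ (hat J) ^ q g` is controlled by the
integral of `g` over `J` alone. -/
theorem lintegral_hat_rpow_mul_le {J : ℝ × ℝ} (hJ : J.1 < J.2) {q : ℝ} (hq : 1 < q)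
    {g : ℝ → ℝ≥0∞} (hg : Measurable g) (h : ∀ x ≤ J.1, ∀ y ∈ Ioo J.1 J.2, g x ≤ g y) :
    ∫⁻ x, hat J x ^ q * g x
      ≤ (1 + ENNReal.ofReal (1 / (q - 1))) * ∫⁻ x in Ioo J.1 J.2, g x := by
  have hq0 : 0 < q := by linarith
  have hL : ENNReal.ofReal (J.2 - J.1) ≠ 0 := by simpa using hJ
  have hmeas : Measurable fun x => hat J x ^ q * g x :=
    ((measurable_hat J).pow_const q).mul hg
  have hright : ∫⁻ x in Ioi J.1, hat J x ^ q * g x ≤ ∫⁻ x in Ioo J.1 J.2, g x := by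
    rw [← Ioo_union_Ici_eq_Ioi hJ]
    refine (lintegral_union_le _ _ _).trans ?_
    have h0 : ∫⁻ x in Ici J.2, hat J x ^ q * g x = 0 := by
      rw [setLIntegral_congr_fun (g := fun _ => 0) measurableSet_Ici]
      · simp
      · intro x hx
        simp [hat_of_right hx, ENNReal.zero_rpow_of_pos hq0]
    rw [h0, add_zero]
    refine setLIntegral_mono hg fun x hx => ?_
    rw [hat_of_mem hx.1.le hx.2]
    simp
  have hleft : ∀ x ≤ J.1, g x ≤ (∫⁻ y in Ioo J.1 J.2, g y) / ENNReal.ofReal (J.2 - J.1) := by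
    intro x hx
    rw [ENNReal.le_div_iff_mul_le (Or.inl hL) (Or.inl ENNReal.ofReal_ne_top),
      ← Real.volume_Ioo, ← setLIntegral_const]
    exact setLIntegral_mono hg fun y hy => h x hx y hy
  have hleft' : ∫⁻ x in Iic J.1, hat J x ^ q * g x
      ≤ ENNReal.ofReal (1 / (q - 1)) * ∫⁻ x in Ioo J.1 J.2, g x := by
    calc ∫⁻ x in Iic J.1, hat J x ^ q * g x
        ≤ ∫⁻ x in Iic J.1,
            hat J x ^ q * ((∫⁻ y in Ioo J.1 J.2, g y) / ENNReal.ofReal (J.2 - J.1)) := by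
          refine setLIntegral_mono (((measurable_hat J).pow_const q).mul_const _) fun x hx => ?_
          gcongr
          exact hleft x hx
      _ = (∫⁻ x in Iic J.1, hat J x ^ q)
            * ((∫⁻ y in Ioo J.1 J.2, g y) / ENNReal.ofReal (J.2 - J.1)) :=
          lintegral_mul_const _ ((measurable_hat J).pow_const q)
      _ ≤ ENNReal.ofReal (1 / (q - 1)) * ENNReal.ofReal (J.2 - J.1)
            * ((∫⁻ y in Ioo J.1 J.2, g y) / ENNReal.ofReal (J.2 - J.1)) := by
          gcongr
          exact lintegral_Iic_hat_rpow_le hJ hq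
      _ = _ := by
          rw [mul_assoc, ENNReal.mul_div_cancel hL ENNReal.ofReal_ne_top]
  calc ∫⁻ x, hat J x ^ q * g x
      = ∫⁻ x in Iic J.1 ∪ Ioi J.1, hat J x ^ q * g x := by
        rw [Iic_union_Ioi, Measure.restrict_univ]
    _ ≤ _ := lintegral_union_le _ _ _
    _ ≤ _ := add_le_add hleft' hright
    _ = _ := by ring

theorem measurable_sum_hat_rpow (s : Finset (ℝ × ℝ)) (q : ℝ) :
    Measurable fun x => ∑ I ∈ s, hat I x ^ q :=
  Finset.measurable_sum _ fun I _ => (measurable_hat I).pow_const q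

/-- The inductive step for the moments of `∑ (hat I) ^ q`. The intervals are removed one at a time
from left to right, since to the left of the leftmost interval the whole sum is increasing. -/
theorem lintegral_sum_hat_pow_succ_le {q : ℝ} (hq : 1 < q) (n : ℕ) (s : Finset (ℝ × ℝ))
    (hs : ∀ I ∈ s, I.1 < I.2)
    (hd : (s : Set (ℝ × ℝ)).PairwiseDisjoint (fun I => Ioo I.1 I.2)) :
    ∫⁻ x, (∑ I ∈ s, hat I x ^ q) ^ (n + 1)
      ≤ (n + 1) * (1 + ENNReal.ofReal (1 / (q - 1)))
          * ∑ J ∈ s, ∫⁻ x in Ioo J.1 J.2, (∑ I ∈ s, hat I x ^ q) ^ n := by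
  classical
  induction hk : s.card generalizing s with
  | zero =>
    obtain rfl := Finset.card_eq_zero.1 hk
    simp
  | succ k ih =>
    obtain ⟨J, hJs, hJmin⟩ := s.exists_min_image (fun I => I.1)
      (Finset.card_pos.1 (by omega))
    have hJ := hs J hJs
    set s' := s.erase J with hs'
    have hsub : s' ⊆ s := Finset.erase_subset _ _
    have ih' := ih s' (fun I hI => hs I (hsub hI))
      (hd.subset (Finset.coe_subset.2 hsub)) (by rw [Finset.card_erase_of_mem hJs]; omega)
    have hsum : ∀ x, ∑ I ∈ s, hat I x ^ q = hat J x ^ q + ∑ I ∈ s', hat I x ^ q := fun x =>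
      (Finset.add_sum_erase s (fun I => hat I x ^ q) hJs).symm
    have hmono : ∀ x ≤ J.1, ∀ y ∈ Ioo J.1 J.2,
        (∑ I ∈ s, hat I x ^ q) ^ n ≤ (∑ I ∈ s, hat I y ^ q) ^ n := by
      intro x hx y hy
      gcongr with I hI
      rcases eq_or_ne I J with rfl | hne
      · rw [hat_of_mem hy.1.le hy.2]
        exact hat_le_one hJ x
      · -- an interval other than `J` starts to the right of `J`
        have hIJ : J.2 ≤ I.1 := by
          by_contra! hlt
          have hdis := Set.disjoint_left.1 (hd hI hJs hne)
          obtain ⟨z, hz1, hz2⟩ := exists_between (lt_min hlt (hs I hI))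
          rcases lt_min_iff.1 hz2 with ⟨hz3, hz4⟩
          exact hdis (a := z) ⟨hz1, hz4⟩ ⟨(hJmin I hI).trans_lt hz1, hz3⟩
        exact hat_mono_left (hs I hI) (hx.trans hy.1.le) (hy.2.le.trans hIJ)
    have hmeas := measurable_sum_hat_rpow s q
    have hmeas' := measurable_sum_hat_rpow s' q
    calc ∫⁻ x, (∑ I ∈ s, hat I x ^ q) ^ (n + 1)
        ≤ ∫⁻ x, ((∑ I ∈ s', hat I x ^ q) ^ (n + 1)
            + (n + 1) * (hat J x ^ q * (∑ I ∈ s, hat I x ^ q) ^ n)) := by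
          refine lintegral_mono fun x => ?_
          simp only [hsum x]
          exact add_pow_le_pow_add _ _ n
      _ = (∫⁻ x, (∑ I ∈ s', hat I x ^ q) ^ (n + 1))
            + (n + 1) * ∫⁻ x, hat J x ^ q * (∑ I ∈ s, hat I x ^ q) ^ n := by
          rw [lintegral_add_left (hmeas'.pow_const _), lintegral_const_mul]
          exact ((measurable_hat J).pow_const q).mul (hmeas.pow_const _)
      _ ≤ (n + 1) * (1 + ENNReal.ofReal (1 / (q - 1)))
            * (∑ K ∈ s', ∫⁻ x in Ioo K.1 K.2, (∑ I ∈ s', hat I x ^ q) ^ n)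
          + (n + 1) * ((1 + ENNReal.ofReal (1 / (q - 1)))
            * ∫⁻ x in Ioo J.1 J.2, (∑ I ∈ s, hat I x ^ q) ^ n) := by
          gcongr
          exact lintegral_hat_rpow_mul_le hJ hq (hmeas.pow_const _) hmono
      _ ≤ (n + 1) * (1 + ENNReal.ofReal (1 / (q - 1)))
            * (∑ K ∈ s', ∫⁻ x in Ioo K.1 K.2, (∑ I ∈ s, hat I x ^ q) ^ n)
          + (n + 1) * ((1 + ENNReal.ofReal (1 / (q - 1)))
            * ∫⁻ x in Ioo J.1 J.2, (∑ I ∈ s, hat I x ^ q) ^ n) := by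
          gcongr
      _ = _ := by
          rw [← Finset.add_sum_erase s _ hJs]
          ring

/-- All moments of `∑ (hat I) ^ q` over finitely many disjoint intervals are controlled by the
total length of the intervals. -/
theorem lintegral_sum_hat_pow_le {q : ℝ} (hq : 1 < q) (n : ℕ) (s : Finset (ℝ × ℝ))
    (hs : ∀ I ∈ s, I.1 < I.2)
    (hd : (s : Set (ℝ × ℝ)).PairwiseDisjoint (fun I => Ioo I.1 I.2)) :
    ∫⁻ x, (∑ I ∈ s, hat I x ^ q) ^ (n + 1)
      ≤ (n + 1).factorial * (1 + ENNReal.ofReal (1 / (q - 1))) ^ (n + 1)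
          * ∑ J ∈ s, ENNReal.ofReal (J.2 - J.1) := by
  induction n with
  | zero =>
    refine (lintegral_sum_hat_pow_succ_le hq 0 s hs hd).trans (le_of_eq ?_)
    simp
  | succ n ih =>
    refine (lintegral_sum_hat_pow_succ_le hq (n + 1) s hs hd).trans ?_
    have h1 : ∑ J ∈ s, ∫⁻ x in Ioo J.1 J.2, (∑ I ∈ s, hat I x ^ q) ^ (n + 1)
        ≤ ∫⁻ x, (∑ I ∈ s, hat I x ^ q) ^ (n + 1) := by
      rw [← lintegral_biUnion_finset hd fun _ _ => measurableSet_Ioo]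
      exact setLIntegral_le_lintegral _ _
    calc _ ≤ ((n + 1 : ℕ) + 1 : ℝ≥0∞) * (1 + ENNReal.ofReal (1 / (q - 1)))
          * ((n + 1).factorial * (1 + ENNReal.ofReal (1 / (q - 1))) ^ (n + 1)
          * ∑ J ∈ s, ENNReal.ofReal (J.2 - J.1)) := by
          gcongr
          exact h1.trans ih
      _ = _ := by
          rw [Nat.factorial_succ (n + 1)]
          push_cast
          ring

/-! ### Consequences of the one-sided `C_q` condition -/

/-- The condition `C_q⁺` for a measure `μ` in place of `w dx`, with given constants and with
`M⁺ χ_(a,c)` in its explicit form. -/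
def TailCondition (μ : Measure ℝ) (q ε : ℝ) (K : ℝ≥0∞) : Prop :=
  ∀ a b c : ℝ, a < b → b < c → c - b < b - a → ∀ E : Set ℝ, MeasurableSet E → E ⊆ Ioo a b →
    μ E ≤ K * (volume E / ENNReal.ofReal (c - b)) ^ ε * ∫⁻ x, hat (a, c) x ^ q ∂μ

/-- Under `C_q⁺`, the `μ`-integral of `g` above height `T` is controlled by a high Lebesgue moment
of `g`, with a gain of `1 / T`. -/
theorem TailCondition.lintegral_le_of_moment {μ : Measure ℝ} {q ε : ℝ} {K : ℝ≥0∞}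
    (hμ : TailCondition μ q ε K) (hε : 0 < ε) {a b c : ℝ} (hab : a < b) (hbc : b < c)
    (habc : c - b < b - a) {g : ℝ → ℝ≥0∞} (hg : Measurable g) (hfin : ∀ x, g x ≠ ∞) {n : ℕ}
    (hn : 2 ≤ n * ε) {M : ℝ≥0∞}
    (hM : ∫⁻ x in Ioo a b, g x ^ n ≤ M * ENNReal.ofReal (c - b)) {T : ℝ≥0∞} (hT : 1 ≤ T)
    (hT' : T ≠ ∞) :
    ∫⁻ x in Ioo a b, g x ∂μ
      ≤ T * μ (Ioo a b) + 4 * K * M ^ ε / T * ∫⁻ x, hat (a, c) x ^ q ∂μ := by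
  have hT0 : T ≠ 0 := (zero_lt_one.trans_le hT).ne'
  set ψ := ∫⁻ x, hat (a, c) x ^ q ∂μ with hψ
  have hc0 : ENNReal.ofReal (c - b) ≠ 0 := by simpa using hbc
  set E : ℕ → Set ℝ := fun m => {x | 2 ^ m * T < g x} with hE
  have hEm : ∀ m, MeasurableSet (E m) := fun m => measurableSet_lt measurable_const hg
  have hpt : ∀ x, g x ≤ T + 2 * ∑' m, (2 ^ m * T) * (E m).indicator 1 x := by
    intro x
    have hex : ∃ m : ℕ, g x ≤ 2 ^ m * T := by
      obtain ⟨m, hm⟩ := ENNReal.exists_nat_gt (hfin x)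
      refine ⟨m, hm.le.trans ?_⟩
      calc (m : ℝ≥0∞) ≤ 2 ^ m * 1 := by
            rw [mul_one]; exact_mod_cast Nat.lt_two_pow_self.le
        _ ≤ _ := by gcongr
    classical
    have hspec := Nat.find_spec hex
    rcases hfind : Nat.find hex with _ | m
    · rw [hfind] at hspec
      simp only [pow_zero, one_mul] at hspec
      exact hspec.trans le_self_add
    · rw [hfind] at hspec
      have hlt : 2 ^ m * T < g x := not_le.1 (Nat.find_min hex (m := m) (by omega))
      calc g x ≤ 2 * (2 ^ m * T) := by rw [← mul_assoc, ← pow_succ']; exact hspec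
        _ = 2 * ((2 ^ m * T) * (E m).indicator 1 x) := by
            rw [indicator_of_mem (show x ∈ E m from hlt)]; simp
        _ ≤ 2 * ∑' m, (2 ^ m * T) * (E m).indicator 1 x := by
            gcongr
            exact ENNReal.le_tsum (f := fun m => (2 ^ m * T) * (E m).indicator 1 x) m
        _ ≤ _ := le_add_self
  have hterm : ∀ m : ℕ, (2 ^ m * T) * μ (E m ∩ Ioo a b) ≤ K * M ^ ε / T * ψ * 2⁻¹ ^ m := by
    intro m
    set τ := 2 ^ m * T with hτ
    have hτ1 : 1 ≤ τ := by
      calc (1 : ℝ≥0∞) ≤ 1 * T := by rwa [one_mul]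
        _ ≤ _ := by
          rw [hτ]
          gcongr
          exact one_le_pow₀ (by norm_num)
    have hτ0 : τ ≠ 0 := (zero_lt_one.trans_le hτ1).ne'
    have hτt : τ ≠ ∞ := ENNReal.mul_ne_top (by finiteness) hT'
    have hvol : volume (E m ∩ Ioo a b) ≤ M * ENNReal.ofReal (c - b) / τ ^ n := by
      rw [← Measure.restrict_apply (hEm m)]
      calc volume.restrict (Ioo a b) (E m)
          ≤ volume.restrict (Ioo a b) {x | τ ^ n ≤ g x ^ n} := by
            refine measure_mono fun x hx => ?_
            exact pow_le_pow_left₀ bot_le (show τ < g x from hx).le n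
        _ ≤ (∫⁻ x in Ioo a b, g x ^ n) / τ ^ n :=
            meas_ge_le_lintegral_div (hg.pow_const n).aemeasurable (by positivity)
              (ENNReal.pow_ne_top hτt)
        _ ≤ _ := by gcongr
    have hvol' : (volume (E m ∩ Ioo a b) / ENNReal.ofReal (c - b)) ^ ε ≤ M ^ ε / τ ^ 2 := by
      calc (volume (E m ∩ Ioo a b) / ENNReal.ofReal (c - b)) ^ ε
          ≤ (M / τ ^ n) ^ ε := by
            refine ENNReal.rpow_le_rpow ?_ hε.le
            rw [ENNReal.div_le_iff hc0 ENNReal.ofReal_ne_top]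
            refine hvol.trans (le_of_eq ?_)
            simp only [div_eq_mul_inv]
            ring
        _ = M ^ ε / τ ^ (n * ε) := by
            rw [ENNReal.div_rpow_of_nonneg _ _ hε.le, ← ENNReal.rpow_natCast, ← ENNReal.rpow_mul]
        _ ≤ M ^ ε / τ ^ (2 : ℝ) := by
            gcongr
        _ = _ := by norm_num
    calc τ * μ (E m ∩ Ioo a b)
        ≤ τ * (K * (M ^ ε / τ ^ 2) * ψ) := by
          gcongr
          refine (hμ a b c hab hbc habc _ ((hEm m).inter measurableSet_Ioo)
            inter_subset_right).trans ?_
          gcongr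
      _ = K * M ^ ε * ψ * (τ * (τ ^ 2)⁻¹) := by
          simp only [div_eq_mul_inv]; ring
      _ = K * M ^ ε * ψ * τ⁻¹ := by
          congr 1
          rw [ENNReal.inv_pow, pow_two, ← mul_assoc, ENNReal.mul_inv_cancel hτ0 hτt, one_mul]
      _ = _ := by
          rw [hτ, ENNReal.mul_inv (by simp) (by simp), ENNReal.inv_pow]
          simp only [div_eq_mul_inv]
          ring
  calc ∫⁻ x in Ioo a b, g x ∂μ
      ≤ ∫⁻ x in Ioo a b, (T + 2 * ∑' m, (2 ^ m * T) * (E m).indicator 1 x) ∂μ :=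
        lintegral_mono hpt
    _ = T * μ (Ioo a b) + 2 * ∑' m : ℕ, (2 ^ m * T) * μ (E m ∩ Ioo a b) := by
        have hm : ∀ m, Measurable fun x => (2 ^ m * T) * (E m).indicator (1 : ℝ → ℝ≥0∞) x :=
          fun m => (measurable_one.indicator (hEm m)).const_mul _
        rw [lintegral_add_left measurable_const, setLIntegral_const, lintegral_const_mul,
          lintegral_tsum fun m => (hm m).aemeasurable]
        · congr 3
          ext m
          rw [lintegral_const_mul _ (measurable_one.indicator (hEm m)),
            lintegral_indicator_one (hEm m), Measure.restrict_apply (hEm m)]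
        · exact Measurable.tsum hm
    _ ≤ T * μ (Ioo a b) + 2 * ∑' m : ℕ, K * M ^ ε / T * ψ * 2⁻¹ ^ m := by
        gcongr 2 with m
        exact ENNReal.tsum_le_tsum hterm
    _ = _ := by
        rw [ENNReal.tsum_mul_left, ENNReal.tsum_geometric, ENNReal.one_sub_inv_two, inv_inv]
        simp only [div_eq_mul_inv]
        ring

/-- The measure of a subset of `I` whose density in the Whitney pieces of `I` is at most `η`. -/
theorem TailCondition.measure_le_of_density {μ : Measure ℝ} {q ε : ℝ} {K : ℝ≥0∞}
    (hμ : TailCondition μ q ε K) (hε : 0 < ε) (hq : 1 ≤ q) [NullSingletonClass μ] {I : ℝ × ℝ}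
    (hI : I.1 < I.2) {E : Set ℝ} (hE : MeasurableSet E) (hEI : E ⊆ Ioo I.1 I.2) {η : ℝ≥0∞}
    (h : ∀ i, volume (E ∩ Ioo (whitneyPoint I i) (whitneyPoint I (i + 1)))
      ≤ η * ENNReal.ofReal (whitneyPoint I (i + 2) - whitneyPoint I (i + 1))) :
    μ E ≤ K * η ^ ε * (ENNReal.ofReal (2 * 4 ^ q) * ∫⁻ x, hat I x ^ q ∂μ) := by
  have hL : 0 < I.2 - I.1 := by linarith
  have hmono := whitneyPoint_strictMono hI
  have hE' : E = ⋃ i, E ∩ Ioc (whitneyPoint I i) (whitneyPoint I (i + 1)) := by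
    rw [← inter_iUnion, iUnion_Ioc_whitneyPoint hI, inter_eq_left.2 hEI]
  have hpiece : ∀ i, μ (E ∩ Ioc (whitneyPoint I i) (whitneyPoint I (i + 1)))
      ≤ K * η ^ ε * ∫⁻ x, hat (whitneyPoint I i, whitneyPoint I (i + 2)) x ^ q ∂μ := by
    intro i
    have h12 : whitneyPoint I (i + 1) < whitneyPoint I (i + 2) := hmono (by omega)
    rw [measure_congr ((ae_eq_refl E).inter Ioo_ae_eq_Ioc.symm)]
    refine (hμ _ _ (whitneyPoint I (i + 2)) (hmono (by omega)) h12 ?_ _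
      (hE.inter measurableSet_Ioo) inter_subset_right).trans ?_
    · rw [whitneyPoint_succ_sub I i, whitneyPoint_succ_sub I (i + 1), pow_succ]
      have : 0 < (I.2 - I.1) * (1 / 2) ^ i := by positivity
      linarith
    · gcongr
      rw [ENNReal.div_le_iff (by simpa using h12) ENNReal.ofReal_ne_top]
      exact h i
  calc μ E ≤ ∑' i, μ (E ∩ Ioc (whitneyPoint I i) (whitneyPoint I (i + 1))) := by
        conv_lhs => rw [hE']
        exact measure_iUnion_le _
    _ ≤ ∑' i, K * η ^ ε * ∫⁻ x, hat (whitneyPoint I i, whitneyPoint I (i + 2)) x ^ q ∂μ :=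
        ENNReal.tsum_le_tsum hpiece
    _ = K * η ^ ε * ∫⁻ x, ∑' i, hat (whitneyPoint I i, whitneyPoint I (i + 2)) x ^ q ∂μ := by
        rw [ENNReal.tsum_mul_left, lintegral_tsum]
        exact fun i => ((measurable_hat _).pow_const q).aemeasurable
    _ ≤ K * η ^ ε * ∫⁻ x, ENNReal.ofReal (2 * 4 ^ q) * hat I x ^ q ∂μ := by
        gcongr with x
        exact tsum_hat_whitney_rpow_le hI hq x
    _ = _ := by rw [lintegral_const_mul _ ((measurable_hat I).pow_const q)]

/-- Moments of `∑ (hat J) ^ q` to the right of `x₀`: the intervals may be cut off at `x₀`, after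
which their total length is at most `b - x₀`. -/
theorem setLIntegral_sum_hat_pow_le {q : ℝ} (hq : 1 < q) (n : ℕ) (s : Finset (ℝ × ℝ))
    (hs : ∀ I ∈ s, I.1 < I.2)
    (hd : (s : Set (ℝ × ℝ)).PairwiseDisjoint (fun I => Ioo I.1 I.2)) {x₀ b : ℝ}
    (hb : ∀ I ∈ s, I.2 ≤ b) :
    ∫⁻ x in Ioi x₀, (∑ I ∈ s, hat I x ^ q) ^ (n + 1)
      ≤ (n + 1).factorial * (1 + ENNReal.ofReal (1 / (q - 1))) ^ (n + 1)
          * ENNReal.ofReal (b - x₀) := by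
  classical
  set u := s.filter fun I => x₀ < I.2 with hu
  set cut : ℝ × ℝ → ℝ × ℝ := fun I => (max I.1 x₀, I.2) with hcut
  have hlt : ∀ I ∈ u, (cut I).1 < (cut I).2 := by
    intro I hI
    rw [hu, Finset.mem_filter] at hI
    exact max_lt (hs I hI.1) hI.2
  have hcs : ∀ I, Ioo (cut I).1 (cut I).2 ⊆ Ioo I.1 I.2 := fun I x hx =>
    ⟨(le_max_left _ _).trans_lt hx.1, hx.2⟩
  have hdis : ∀ I ∈ u, ∀ J ∈ u, I ≠ J →
      Disjoint (Ioo (cut I).1 (cut I).2) (Ioo (cut J).1 (cut J).2) := fun I hI J hJ hne =>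
    (hd (Finset.mem_filter.1 hI).1 (Finset.mem_filter.1 hJ).1 hne).mono (hcs I) (hcs J)
  have hinj : Set.InjOn cut u := by
    intro I hI J hJ hIJ
    by_contra hne
    have := hdis I hI J hJ hne
    rw [← hIJ, disjoint_self, bot_eq_empty, Ioo_eq_empty_iff] at this
    exact this (hlt I hI)
  have hlt' : ∀ I ∈ u.image cut, I.1 < I.2 := by
    intro I hI
    obtain ⟨J, hJ, rfl⟩ := Finset.mem_image.1 hI
    exact hlt J hJ
  have hdis' : ((u.image cut : Finset (ℝ × ℝ)) : Set (ℝ × ℝ)).PairwiseDisjoint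
      (fun I => Ioo I.1 I.2) := by
    intro I hI J hJ hne
    obtain ⟨I', hI', rfl⟩ := Finset.mem_image.1 hI
    obtain ⟨J', hJ', rfl⟩ := Finset.mem_image.1 hJ
    exact hdis I' hI' J' hJ' fun h => hne (h ▸ rfl)
  have hsum : ∀ x ∈ Ioi x₀, ∑ I ∈ s, hat I x ^ q = ∑ I ∈ u.image cut, hat I x ^ q := by
    intro x hx
    rw [Finset.sum_image hinj, hu, Finset.sum_filter]
    refine Finset.sum_congr rfl fun I hI => ?_
    split_ifs with h
    · rcases le_or_gt I.2 x with h2 | h2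
      · rw [hat_of_right h2, hat_of_right (I := cut I) h2]
      · rcases le_or_gt I.1 x with h1 | h1
        · rw [hat_of_mem h1 h2, hat_of_mem (I := cut I) (max_le h1 (le_of_lt hx)) h2]
        · have : cut I = I := by
            simp only [hcut]
            rw [max_eq_left ((mem_Ioi.1 hx).trans h1).le]
          rw [this]
    · rw [hat_of_right ((not_lt.1 h).trans (le_of_lt hx)),
        ENNReal.zero_rpow_of_pos (by linarith)]
  rw [setLIntegral_congr_fun measurableSet_Ioi fun x hx => by
    show _ = (∑ I ∈ u.image cut, hat I x ^ q) ^ (n + 1)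
    rw [hsum x hx]]
  refine (setLIntegral_le_lintegral _ _).trans
    ((lintegral_sum_hat_pow_le hq n _ hlt' hdis').trans ?_)
  gcongr
  have := tsum_sub_le continuous_id monotone_id (Finset.countable_toSet _) hdis'
    (x := x₀) (y := b) ?_
  · simp only [id_eq] at this
    rwa [Finset.tsum_subtype' (u.image cut) fun J => ENNReal.ofReal (J.2 - J.1)] at this
  · intro I hI x hx
    obtain ⟨J, hJ, rfl⟩ := Finset.mem_image.1 hI
    exact ⟨(le_max_right _ _).trans_lt hx.1, hx.2.trans_le (hb J (Finset.mem_filter.1 hJ).1)⟩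

/-- The key estimate: inside an interval `I`, the sum of `(hat J) ^ q` over disjoint intervals `J`
costs no more than the constant `T`, up to a small multiple of `∫ (hat I) ^ q`. -/
theorem TailCondition.exists_lintegral_sum_hat_le {μ : Measure ℝ} {q ε : ℝ} {K : ℝ≥0∞}
    (hμ : TailCondition μ q ε K) (hε : 0 < ε) (hK : K ≠ ∞) (hq : 1 < q) [NullSingletonClass μ] :
    ∃ C : ℝ≥0∞, C ≠ ∞ ∧ ∀ T : ℝ≥0∞, 1 ≤ T → T ≠ ∞ → ∀ I : ℝ × ℝ, I.1 < I.2 →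
      ∀ s : Finset (ℝ × ℝ), (∀ J ∈ s, J.1 < J.2) →
        (s : Set (ℝ × ℝ)).PairwiseDisjoint (fun J => Ioo J.1 J.2) → (∀ J ∈ s, J.2 ≤ I.2) →
        ∫⁻ x in Ioo I.1 I.2, ∑ J ∈ s, hat J x ^ q ∂μ
          ≤ T * μ (Ioo I.1 I.2) + C / T * ∫⁻ x, hat I x ^ q ∂μ := by
  obtain ⟨n, hn⟩ : ∃ n : ℕ, 2 ≤ ((n + 1 : ℕ) : ℝ) * ε := by
    obtain ⟨n, hn⟩ := exists_nat_gt (2 / ε)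
    refine ⟨n, ?_⟩
    rw [div_lt_iff₀ hε] at hn
    push_cast
    nlinarith
  set M : ℝ≥0∞ := (n + 1).factorial * (1 + ENNReal.ofReal (1 / (q - 1))) ^ (n + 1) * 4 with hM
  have hMt : M ≠ ∞ := by rw [hM]; finiteness
  refine ⟨4 * K * M ^ ε * ENNReal.ofReal (2 * 4 ^ q), by finiteness, ?_⟩
  intro T hT hT' I hI s hs hd hb
  have hL : 0 < I.2 - I.1 := by linarith
  have hmono := whitneyPoint_strictMono hI
  have hgm := measurable_sum_hat_rpow s q
  have hgfin : ∀ x, ∑ J ∈ s, hat J x ^ q ≠ ∞ := by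
    intro x
    refine (ENNReal.sum_lt_top.2 fun J hJ => ?_).ne
    refine ENNReal.rpow_lt_top_of_nonneg (by linarith) ?_
    exact ((hat_le_one (hs J hJ) x).trans_lt ENNReal.one_lt_top).ne
  have hpiece : ∀ i, ∫⁻ x in Ioc (whitneyPoint I i) (whitneyPoint I (i + 1)),
        ∑ J ∈ s, hat J x ^ q ∂μ
      ≤ T * μ (Ioc (whitneyPoint I i) (whitneyPoint I (i + 1))) + 4 * K * M ^ ε / T
        * ∫⁻ x, hat (whitneyPoint I i, whitneyPoint I (i + 2)) x ^ q ∂μ := by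
    intro i
    rw [setLIntegral_congr Ioo_ae_eq_Ioc.symm, ← measure_congr Ioo_ae_eq_Ioc]
    refine hμ.lintegral_le_of_moment hε (hmono (by omega)) (hmono (by omega)) ?_ hgm hgfin
      hn ?_ hT hT'
    · rw [whitneyPoint_succ_sub I i, whitneyPoint_succ_sub I (i + 1), pow_succ]
      have : 0 < (I.2 - I.1) * (1 / 2) ^ i := by positivity
      linarith
    · refine (lintegral_mono_set Ioo_subset_Ioi_self).trans
        ((setLIntegral_sum_hat_pow_le hq n s hs hd hb).trans (le_of_eq ?_))
      rw [hM, mul_assoc _ (4 : ℝ≥0∞)]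
      congr 1
      rw [sub_whitneyPoint, whitneyPoint_succ_sub I (i + 1),
        show (4 : ℝ≥0∞) = ENNReal.ofReal 4 by simp, ← ENNReal.ofReal_mul (by norm_num)]
      congr 1
      rw [pow_succ]
      ring
  rw [← iUnion_Ioc_whitneyPoint hI]
  rw [lintegral_iUnion (fun _ => measurableSet_Ioc) (pairwise_disjoint_Ioc_whitneyPoint hI),
    measure_iUnion (pairwise_disjoint_Ioc_whitneyPoint hI) fun _ => measurableSet_Ioc]
  refine (ENNReal.tsum_le_tsum hpiece).trans ?_
  rw [ENNReal.tsum_add, ENNReal.tsum_mul_left, ENNReal.tsum_mul_left, ← lintegral_tsum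
    fun i => ((measurable_hat _).pow_const q).aemeasurable]
  refine add_le_add le_rfl ?_
  calc 4 * K * M ^ ε / T
        * ∫⁻ x, ∑' i, hat (whitneyPoint I i, whitneyPoint I (i + 2)) x ^ q ∂μ
      ≤ 4 * K * M ^ ε / T * ∫⁻ x, ENNReal.ofReal (2 * 4 ^ q) * hat I x ^ q ∂μ := by
        gcongr with x
        exact tsum_hat_whitney_rpow_le hI hq.le x
    _ = _ := by
        rw [lintegral_const_mul _ ((measurable_hat I).pow_const q)]
        simp only [div_eq_mul_inv]
        ring

/-- The key estimate for countable families of disjoint intervals. -/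
theorem TailCondition.exists_lintegral_tsum_hat_le {μ : Measure ℝ} {q ε : ℝ} {K : ℝ≥0∞}
    (hμ : TailCondition μ q ε K) (hε : 0 < ε) (hK : K ≠ ∞) (hq : 1 < q) [NullSingletonClass μ] :
    ∃ C : ℝ≥0∞, C ≠ ∞ ∧ ∀ T : ℝ≥0∞, 1 ≤ T → T ≠ ∞ → ∀ I : ℝ × ℝ, I.1 < I.2 →
      ∀ S : Set (ℝ × ℝ), S.Countable → (∀ J ∈ S, J.1 < J.2) →
        S.PairwiseDisjoint (fun J => Ioo J.1 J.2) → (∀ J ∈ S, J.2 ≤ I.2) →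
        ∑' J : S, ∫⁻ x in Ioo I.1 I.2, hat J x ^ q ∂μ
          ≤ T * μ (Ioo I.1 I.2) + C / T * ∫⁻ x, hat I x ^ q ∂μ := by
  obtain ⟨C, hC, h⟩ := hμ.exists_lintegral_sum_hat_le hε hK hq
  refine ⟨C, hC, fun T hT hT' I hI S _ hS hd hb => ?_⟩
  classical
  rw [ENNReal.tsum_eq_iSup_sum]
  refine iSup_le fun s => ?_
  have hmem : ∀ J ∈ s.map (Function.Embedding.subtype (· ∈ S)), J ∈ S := by
    intro J hJ
    obtain ⟨J', -, rfl⟩ := Finset.mem_map.1 hJ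
    exact J'.2
  have := h T hT hT' I hI (s.map (Function.Embedding.subtype (· ∈ S)))
    (fun J hJ => hS J (hmem J hJ)) (hd.subset hmem) (fun J hJ => hb J (hmem J hJ))
  rw [lintegral_finsetSum _ fun J _ => (measurable_hat J).pow_const q, Finset.sum_map] at this
  exact this

/-! ### Comparison of the sums over components at different levels -/

/-- The sum of `∫ (M⁺ χ_I) ^ q dμ` over the components `I` of the level set of height `t`. -/
noncomputable def levelSum (μ : Measure ℝ) (q : ℝ) (F : ℝ → ℝ) (t : ℝ) : ℝ≥0∞ :=
  ∑' I : components (risingSet F t), ∫⁻ x, hat I x ^ q ∂μ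

/-- A sum over `S`, grouped according to a map `π : S → S'`. -/
theorem tsum_le_tsum_of_fibers {α : Type*} {S S' : Set α} (π : S → S') (f : α → α → ℝ≥0∞)
    (B : α → ℝ≥0∞)
    (h : ∀ I : S', ∀ U ⊆ S, (∀ J ∈ U, ∃ hJ : J ∈ S, π ⟨J, hJ⟩ = I) → ∑' J : U, f J I ≤ B I) :
    ∑' J : S, f J (π J) ≤ ∑' I : S', B I := by
  rw [← ENNReal.tsum_fiberwise (fun J : S => f J (π J)) π]
  refine ENNReal.tsum_le_tsum fun I => ?_
  have key := h I (Subtype.val '' (π ⁻¹' {I})) (by rintro _ ⟨J, -, rfl⟩; exact J.2) (by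
    rintro _ ⟨J, hJ, rfl⟩
    exact ⟨J.2, hJ⟩)
  rw [tsum_image (fun J => f J I) Subtype.val_injective.injOn] at key
  refine le_trans (le_of_eq (tsum_congr fun J => ?_)) key
  rw [show π J = I from J.2]

/-- A component `J` at height `t` lies in a component `I` at the lower height `t / A`, and the
extension of `I` to the left by its own length lies in a component at height `t / A ^ 2`. -/
theorem IsCDF.exists_ancestors {F : ℝ → ℝ} {l r : ℝ} (hF : IsCDF F l r) {t A : ℝ} (ht : 0 < t)
    (hA : 2 ≤ A) {J : ℝ × ℝ} (hJ : J ∈ components (risingSet F t)) :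
    ∃ I ∈ components (risingSet F (t / A)), ∃ I' ∈ components (risingSet F (t / A ^ 2)),
      I.1 ≤ J.1 ∧ J.2 ≤ I.2 ∧ I'.1 ≤ I.1 - (I.2 - I.1) ∧ I.2 ≤ I'.2 := by
  have hA0 : 0 < A := by linarith
  have hA1 : t / A ≤ t := div_le_self ht.le (by linarith)
  have hA2 : t / A ^ 2 ≤ t / A := by
    rw [pow_two, ← div_div]
    exact div_le_self (by positivity) (by linarith)
  obtain ⟨x, hx⟩ := nonempty_Ioo.2 hJ.1
  have hx1 : x ∈ risingSet F (t / A) := risingSet_anti hA1 (hJ.2.2.2 hx)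
  obtain ⟨I, hI, hxI⟩ := hF.exists_component (by positivity) hx1
  obtain ⟨I', hI', hxI'⟩ := hF.exists_component (t := t / A ^ 2) (by positivity)
    (risingSet_anti hA2 hx1)
  obtain ⟨h1, h2⟩ := le_of_mem_components hI hxI hx
    (hJ.2.2.2.trans (risingSet_anti hA1))
  have hsub : Ioo (I.1 - (I.2 - I.1)) I.2 ⊆ risingSet F (t / A ^ 2) := by
    intro y hy
    rcases lt_or_ge I.1 y with h | h
    · exact risingSet_anti hA2 (hI.2.2.2 ⟨h, hy.2⟩)
    · refine ⟨I.2, hy.2, ?_⟩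
      have e1 := sub_eq_of_mem_components hF.cont hI
      have e2 := hF.mono h
      have hlen : I.2 - y < A * (I.2 - I.1) := by nlinarith [hy.1, hI.1]
      calc t / A ^ 2 * (I.2 - y) < t / A ^ 2 * (A * (I.2 - I.1)) := by gcongr
        _ = t / A * (I.2 - I.1) := by field_simp
        _ ≤ F I.2 - F y := by linarith
  obtain ⟨h3, h4⟩ := le_of_mem_components hI' hxI' ⟨by linarith [hxI.1, hI.1], hxI.2⟩ hsub
  exact ⟨I, hI, I', hI', h1, h2, h3, h4⟩

/-- Far to the left of a component `I` at height `t / A`, the components at height `t` inside `I`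
together count as an interval of length `|I| / A`. -/
theorem IsCDF.tsum_lintegral_far_le {F : ℝ → ℝ} {l r : ℝ} (hF : IsCDF F l r) (μ : Measure ℝ)
    {q : ℝ} (hq : 1 < q) {t A : ℝ} (ht : 0 < t) (hA : 2 ≤ A) {I : ℝ × ℝ}
    (hI : I ∈ components (risingSet F (t / A))) {U : Set (ℝ × ℝ)}
    (hU : U ⊆ components (risingSet F t)) (hUI : ∀ J ∈ U, I.1 ≤ J.1 ∧ J.2 ≤ I.2) :
    ∑' J : U, ∫⁻ x in Iic (I.1 - (I.2 - I.1)), hat J x ^ q ∂μ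
      ≤ ENNReal.ofReal ((2 / A) ^ q) * ∫⁻ x, hat I x ^ q ∂μ := by
  have hA0 : 0 < A := by linarith
  have hUc : U.Countable := (components_countable _).mono hU
  have hL : 0 < I.2 - I.1 := by linarith [hI.1]
  have hlen : ∑' J : U, ENNReal.ofReal (J.1.2 - J.1.1) ≤ ENNReal.ofReal ((I.2 - I.1) / A) := by
    have h1 := tsum_sub_le hF.cont hF.mono hUc ((components_pairwiseDisjoint _).subset hU)
      (x := I.1) (y := I.2) fun J hJ x hx =>
        ⟨(hUI J hJ).1.trans_lt hx.1, hx.2.trans_le (hUI J hJ).2⟩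
    have h2 : ∀ J : U, ENNReal.ofReal (F J.1.2 - F J.1.1)
        = ENNReal.ofReal t * ENNReal.ofReal (J.1.2 - J.1.1) := fun J => by
      rw [sub_eq_of_mem_components hF.cont (hU J.2), ENNReal.ofReal_mul ht.le]
    simp_rw [h2] at h1
    rw [ENNReal.tsum_mul_left, sub_eq_of_mem_components hF.cont hI, div_mul_eq_mul_div,
      mul_div_assoc, ENNReal.ofReal_mul ht.le] at h1
    exact (ENNReal.mul_le_mul_iff_right (by simpa using ht) ENNReal.ofReal_ne_top).1 h1
  have hpt : ∀ x ∈ Iic (I.1 - (I.2 - I.1)),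
      ∑' J : U, hat J x ^ q ≤ ENNReal.ofReal ((2 / A) ^ q) * hat I x ^ q := by
    intro x hx
    simp only [mem_Iic] at hx
    have hd : 0 < I.2 - x := by linarith
    set v := (I.2 - I.1) / (I.2 - x) with hv
    have hv0 : 0 < v := by positivity
    have hhat : hat I x = ENNReal.ofReal v := hat_of_left hI.1 (by linarith)
    have hJ : ∀ J : U, hat J x ≤ ENNReal.ofReal (J.1.2 - J.1.1) * ENNReal.ofReal (2 / (I.2 - x)) := by
      intro J
      have hJ1 := (hU J.2).1
      have hIJ := (hUI J J.2).1
      rw [hat_of_left hJ1 (by linarith), ← ENNReal.ofReal_mul (by linarith)]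
      refine ENNReal.ofReal_le_ofReal ?_
      rw [mul_div_assoc', div_le_div_iff₀ (by linarith) hd]
      nlinarith
    have hsum : ∑' J : U, hat J x ≤ ENNReal.ofReal (2 / A * v) := by
      calc ∑' J : U, hat J x
          ≤ ∑' J : U, ENNReal.ofReal (J.1.2 - J.1.1) * ENNReal.ofReal (2 / (I.2 - x)) :=
            ENNReal.tsum_le_tsum hJ
        _ ≤ ENNReal.ofReal ((I.2 - I.1) / A) * ENNReal.ofReal (2 / (I.2 - x)) := by
            rw [ENNReal.tsum_mul_right]
            gcongr
        _ = _ := by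
            rw [← ENNReal.ofReal_mul (by positivity), hv]
            congr 1
            ring
    have hpow : ∀ J : U, hat J x ^ q ≤ ENNReal.ofReal (2 / A * v) ^ (q - 1) * hat J x := by
      intro J
      have h1 : hat J x ≤ ENNReal.ofReal (2 / A * v) :=
        (ENNReal.le_tsum (f := fun J : U => hat J x) J).trans hsum
      calc hat J x ^ q = hat J x ^ (q - 1 + 1) := by ring_nf
        _ = hat J x ^ (q - 1) * hat J x := by
            rw [ENNReal.rpow_add_of_nonneg _ _ (by linarith) zero_le_one, ENNReal.rpow_one]
        _ ≤ _ := by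
            gcongr
    calc ∑' J : U, hat J x ^ q ≤ ENNReal.ofReal (2 / A * v) ^ (q - 1) * ∑' J : U, hat J x := by
          rw [← ENNReal.tsum_mul_left]
          exact ENNReal.tsum_le_tsum hpow
      _ ≤ ENNReal.ofReal (2 / A * v) ^ (q - 1) * ENNReal.ofReal (2 / A * v) := by gcongr
      _ = ENNReal.ofReal (2 / A * v) ^ q := by
          conv_rhs => rw [show q = q - 1 + 1 by ring]
          rw [ENNReal.rpow_add_of_nonneg _ _ (by linarith) zero_le_one, ENNReal.rpow_one]
      _ = _ := by
          rw [hhat, ENNReal.ofReal_mul (by positivity),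
            ENNReal.mul_rpow_of_nonneg _ _ (by linarith), ENNReal.ofReal_rpow_of_pos (by positivity)]
  have := hUc.to_subtype
  rw [← lintegral_tsum fun J => ((measurable_hat _).pow_const q).aemeasurable,
    ← lintegral_const_mul _ ((measurable_hat I).pow_const q)]
  refine (setLIntegral_mono (((measurable_hat I).pow_const q).const_mul _) hpt).trans ?_
  exact setLIntegral_le_lintegral _ _

/-- The recursive inequality for `levelSum`: components at height `t` are compared with those at
heights `t / A` (far away) and `t / A ^ 2` (nearby). -/
theorem TailCondition.exists_levelSum_le {μ : Measure ℝ} {q ε : ℝ} {K : ℝ≥0∞}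
    (hμ : TailCondition μ q ε K) (hε : 0 < ε) (hK : K ≠ ∞) (hq : 1 < q)
    [NullSingletonClass μ] :
    ∃ C : ℝ≥0∞, C ≠ ∞ ∧ ∀ T : ℝ≥0∞, 1 ≤ T → T ≠ ∞ → ∀ {F : ℝ → ℝ} {l r : ℝ}, IsCDF F l r →
      ∀ t A : ℝ, 0 < t → 2 ≤ A → levelSum μ q F t
        ≤ ENNReal.ofReal ((2 / A) ^ q) * levelSum μ q F (t / A)
          + (T * μ (risingSet F (t / A ^ 2)) + C / T * levelSum μ q F (t / A ^ 2)) := by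
  obtain ⟨C, hC, h⟩ := hμ.exists_lintegral_tsum_hat_le hε hK hq
  refine ⟨C, hC, fun T hT hT' F l r hF t A ht hA => ?_⟩
  have hA0 : 0 < A := by linarith
  have hex := fun J : components (risingSet F t) => hF.exists_ancestors ht hA J.2
  choose P hP P' hP' h1 h2 h3 h4 using hex
  have hsplit : ∀ J : components (risingSet F t), ∫⁻ x, hat J x ^ q ∂μ
      ≤ ∫⁻ x in Iic ((P J).1 - ((P J).2 - (P J).1)), hat J x ^ q ∂μ
        + ∫⁻ x in Ioo (P' J).1 (P' J).2, hat J x ^ q ∂μ := by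
    intro J
    have hr : ∫⁻ x in Ici (P J).2, hat J x ^ q ∂μ = 0 := by
      rw [setLIntegral_congr_fun (g := fun _ => 0) measurableSet_Ici]
      · simp
      · intro x hx
        simp [hat_of_right ((h2 J).trans hx), ENNReal.zero_rpow_of_pos (by linarith : 0 < q)]
    calc ∫⁻ x, hat J x ^ q ∂μ
        ≤ ∫⁻ x in (Iic ((P J).1 - ((P J).2 - (P J).1)) ∪ Ioo (P' J).1 (P' J).2) ∪ Ici (P J).2,
            hat J x ^ q ∂μ := by
          rw [← setLIntegral_univ]
          refine lintegral_mono_set fun x _ => ?_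
          rcases le_or_gt (P J).2 x with hx | hx
          · exact Or.inr hx
          · rcases le_or_gt x ((P J).1 - ((P J).2 - (P J).1)) with hx' | hx'
            · exact Or.inl (Or.inl hx')
            · exact Or.inl (Or.inr ⟨(h3 J).trans_lt hx', hx.trans_le (h4 J)⟩)
      _ ≤ _ := by
          refine (lintegral_union_le _ _ _).trans ?_
          rw [hr, add_zero]
          exact lintegral_union_le _ _ _
  calc levelSum μ q F t
      ≤ ∑' J : components (risingSet F t),
          (∫⁻ x in Iic ((P J).1 - ((P J).2 - (P J).1)), hat J x ^ q ∂μ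
            + ∫⁻ x in Ioo (P' J).1 (P' J).2, hat J x ^ q ∂μ) := ENNReal.tsum_le_tsum hsplit
    _ ≤ _ := by
        rw [ENNReal.tsum_add]
        refine add_le_add ?_ ?_
        · rw [levelSum, ← ENNReal.tsum_mul_left]
          refine tsum_le_tsum_of_fibers (fun J => ⟨P J, hP J⟩)
            (fun J I => ∫⁻ x in Iic (I.1 - (I.2 - I.1)), hat J x ^ q ∂μ)
            (fun I => ENNReal.ofReal ((2 / A) ^ q) * ∫⁻ x, hat I x ^ q ∂μ) ?_
          intro I U hU hUI
          refine hF.tsum_lintegral_far_le μ hq ht hA I.2 hU fun J hJ => ?_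
          obtain ⟨hJ', hJI⟩ := hUI J hJ
          rw [← hJI]
          exact ⟨h1 ⟨J, hJ'⟩, h2 ⟨J, hJ'⟩⟩
        · rw [levelSum, ← hF.tsum_measure_components (by positivity), ← ENNReal.tsum_mul_left,
            ← ENNReal.tsum_mul_left, ← ENNReal.tsum_add]
          refine tsum_le_tsum_of_fibers (fun J => ⟨P' J, hP' J⟩)
            (fun J I => ∫⁻ x in Ioo I.1 I.2, hat J x ^ q ∂μ)
            (fun I => T * μ (Ioo I.1 I.2) + C / T * ∫⁻ x, hat I x ^ q ∂μ) ?_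
          intro I U hU hUI
          refine h T hT hT' I I.2.1 U ((components_countable _).mono hU)
            (fun J hJ => (hU hJ).1) ((components_pairwiseDisjoint _).subset hU) fun J hJ => ?_
          obtain ⟨hJ', hJI⟩ := hUI J hJ
          rw [← hJI]
          exact (h2 ⟨J, hJ'⟩).trans (h4 ⟨J, hJ'⟩)

theorem le_two_mul_of_le_half_add {x y : ℝ≥0∞} (hx : x ≠ ∞) (h : x ≤ x / 2 + y) :
    x ≤ 2 * y := by
  have h1 : x / 2 + x / 2 ≤ x / 2 + y := by rwa [ENNReal.add_halves]
  have h2 : x / 2 ≤ y :=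
    (ENNReal.add_le_add_iff_left (ENNReal.div_ne_top hx (by norm_num))).1 h1
  rw [mul_comm]
  exact (ENNReal.div_le_iff (by norm_num) (by norm_num)).1 h2

/-- Summation of a recursive inequality with total weight `1 / 2`. Boundedness of the sequence is
what makes it possible to absorb the sum on the right. -/
theorem tsum_le_of_recursion {s m : ℤ → ℝ≥0∞} {B : ℝ≥0∞} {k₀ : ℤ}
    (h : ∀ k, s k ≤ s (k - 1) / 4 + s (k - 2) / 4 + m (k - 2)) (hB : ∀ k, s k ≤ B)
    (hBt : B ≠ ∞) (h0 : ∀ k, k₀ ≤ k → s k = 0) (hm : ∑' k, m k ≠ ∞) :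
    ∑' k, s k ≤ 2 * ∑' k, m k := by
  have hshift : ∀ (f : ℤ → ℝ≥0∞) (j : ℤ), ∑' k, f (k - j) = ∑' k, f k := fun f j =>
    (Equiv.subRight j).tsum_eq f
  have hquarter : ∀ x : ℝ≥0∞, x / 4 + x / 4 = x / 2 := fun x => by
    have e1 : (4 : ℝ≥0∞)⁻¹ + 4⁻¹ = 2⁻¹ := by
      rw [show (4 : ℝ≥0∞) = 2 * 2 by norm_num, ENNReal.mul_inv (by simp) (by simp), ← two_mul,
        ← mul_assoc, ENNReal.mul_inv_cancel (by simp) (by simp), one_mul]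
    rw [div_eq_mul_inv, div_eq_mul_inv, ← mul_add, e1]
  have hfin : ∑' k, s k ≠ ∞ := by
    have hpart : ∀ a : ℤ, ∑ k ∈ Finset.Ico a k₀, s k ≤ 2 * (2 * B + ∑' k, m k) := by
      intro a
      set P := ∑ k ∈ Finset.Ico a k₀, s k with hP
      have hPt : P ≠ ∞ :=
        ENNReal.sum_ne_top.2 fun k _ => ((hB k).trans_lt hBt.lt_top).ne
      have hs : ∀ j : ℤ, 0 ≤ j → j ≤ 2 → ∑ k ∈ Finset.Ico a k₀, s (k - j) ≤ P + 2 * B := by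
        intro j hj hj2
        have hinj : Set.InjOn (fun k : ℤ => k - j) (Finset.Ico a k₀) := fun x _ y _ hxy => by
          simpa using hxy
        rw [← Finset.sum_image (f := s) hinj]
        calc ∑ k ∈ (Finset.Ico a k₀).image (fun k => k - j), s k
            ≤ ∑ k ∈ Finset.Ico a k₀ ∪ Finset.Ico (a - 2) a, s k := by
              refine Finset.sum_le_sum_of_subset fun k hk => ?_
              obtain ⟨i, hi, rfl⟩ := Finset.mem_image.1 hk
              simp only [Finset.mem_union, Finset.mem_Ico] at hi ⊢
              omega
          _ ≤ P + ∑ k ∈ Finset.Ico (a - 2) a, s k := by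
              rw [← Finset.sum_union_inter]
              exact le_self_add
          _ ≤ P + 2 * B := by
              gcongr
              refine (Finset.sum_le_card_nsmul _ _ B fun k _ => hB k).trans ?_
              simp
      refine le_two_mul_of_le_half_add hPt ?_
      calc P ≤ ∑ k ∈ Finset.Ico a k₀, (s (k - 1) / 4 + s (k - 2) / 4 + m (k - 2)) :=
            Finset.sum_le_sum fun k _ => h k
        _ ≤ (P + 2 * B) / 4 + (P + 2 * B) / 4 + ∑' k, m k := by
            rw [Finset.sum_add_distrib, Finset.sum_add_distrib]
            simp only [div_eq_mul_inv]
            rw [← Finset.sum_mul, ← Finset.sum_mul]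
            gcongr
            · exact hs 1 (by norm_num) (by norm_num)
            · exact hs 2 (by norm_num) (by norm_num)
            · rw [← hshift m 2]
              exact ENNReal.sum_le_tsum _
        _ ≤ P / 2 + (2 * B + ∑' k, m k) := by
            rw [hquarter, ENNReal.add_div, add_assoc]
            gcongr
            exact ENNReal.half_le_self
    have : ∑' k, s k ≤ 2 * (2 * B + ∑' k, m k) := by
      rw [ENNReal.tsum_eq_iSup_sum]
      refine iSup_le fun u => ?_
      obtain ⟨a, ha⟩ := u.bddBelow
      refine le_trans ?_ (hpart a)
      rw [← Finset.sum_filter_add_sum_filter_not u (fun k => k < k₀),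
        Finset.sum_eq_zero (s := u.filter fun k => ¬ k < k₀), add_zero]
      · refine Finset.sum_le_sum_of_subset fun k hk => ?_
        rw [Finset.mem_filter] at hk
        exact Finset.mem_Ico.2 ⟨ha hk.1, hk.2⟩
      · intro k hk
        exact h0 k (not_lt.1 (Finset.mem_filter.1 hk).2)
    exact (this.trans_lt (by finiteness)).ne
  refine le_two_mul_of_le_half_add hfin ?_
  calc ∑' k, s k ≤ ∑' k, (s (k - 1) / 4 + s (k - 2) / 4 + m (k - 2)) := ENNReal.tsum_le_tsum h
    _ = _ := by
        rw [ENNReal.tsum_add, ENNReal.tsum_add, hshift m 2]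
        simp only [div_eq_mul_inv]
        rw [ENNReal.tsum_mul_right, ENNReal.tsum_mul_right, hshift s 1, hshift s 2,
          ← div_eq_mul_inv, ← div_eq_mul_inv, hquarter]

/-- The heart of the sufficiency: when `p < q`, the sums of `∫ (M⁺ χ_I) ^ q dμ` over the components
of all the level sets of heights `A ^ k` are controlled by the measures of these level sets. -/
theorem TailCondition.exists_tsum_levelSum_le {μ : Measure ℝ} {p q ε : ℝ} {K : ℝ≥0∞}
    (hμ : TailCondition μ q ε K) (hε : 0 < ε) (hK : K ≠ ∞) (hpq : p < q)
    (hq : 1 < q) [NullSingletonClass μ] :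
    ∃ A : ℝ, 2 ≤ A ∧ ∃ D : ℝ≥0∞, D ≠ ∞ ∧ ∀ {F : ℝ → ℝ} {l r : ℝ}, IsCDF F l r →
      (∃ B : ℝ≥0∞, B ≠ ∞ ∧ ∀ t > 0, ENNReal.ofReal (t ^ p) * levelSum μ q F t ≤ B) →
      (∃ t₀, ∀ t ≥ t₀, risingSet F t = ∅) →
      ∑' k : ℤ, ENNReal.ofReal ((A ^ k) ^ p) * μ (risingSet F (A ^ k)) ≠ ∞ →
      ∑' k : ℤ, ENNReal.ofReal ((A ^ k) ^ p) * levelSum μ q F (A ^ k)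
        ≤ D * ∑' k : ℤ, ENNReal.ofReal ((A ^ k) ^ p) * μ (risingSet F (A ^ k)) := by
  obtain ⟨C, hC, hrec⟩ := hμ.exists_levelSum_le hε hK hq
  -- `A` is chosen so that `(2 / A) ^ q * A ^ p ≤ 1 / 4`
  obtain ⟨A, hA2, hAq⟩ : ∃ A : ℝ, 2 ≤ A ∧ (2 / A) ^ q * A ^ p ≤ 1 / 4 := by
    set A₀ : ℝ := (4 * 2 ^ q) ^ (1 / (q - p)) with hA₀
    have hqp : 0 < q - p := by linarith
    have hA0 : 0 < max 2 A₀ := lt_max_of_lt_left (by norm_num)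
    refine ⟨max 2 A₀, le_max_left _ _, ?_⟩
    have h1 : 4 * 2 ^ q ≤ (max 2 A₀) ^ (q - p) := by
      calc (4 * 2 ^ q : ℝ) = A₀ ^ (q - p) := by
            rw [hA₀, ← Real.rpow_mul (by positivity), one_div_mul_cancel hqp.ne', Real.rpow_one]
        _ ≤ _ := Real.rpow_le_rpow (by positivity) (le_max_right _ _) hqp.le
    rw [Real.div_rpow (by norm_num) hA0.le, div_mul_eq_mul_div, mul_div_assoc, ← Real.rpow_sub hA0,
      show p - q = -(q - p) by ring, Real.rpow_neg hA0.le, ← div_eq_mul_inv,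
      div_le_div_iff₀ (by positivity) (by norm_num)]
    linarith
  have hA0 : 0 < A := by linarith
  set a := ENNReal.ofReal (A ^ (2 * p)) with ha
  set T : ℝ≥0∞ := 4 * C * a + 1 with hT
  have hTt : T ≠ ∞ := by rw [hT, ha]; finiteness
  have hT1 : 1 ≤ T := le_add_self
  refine ⟨A, hA2, 2 * (T * a), by rw [ha]; finiteness, ?_⟩
  intro F l r hF ⟨B, hBt, hB⟩ ⟨t₀, ht₀⟩ hfin
  have hpos : ∀ k : ℤ, 0 < A ^ k := fun k => zpow_pos hA0 k
  have hw : ∀ k j : ℤ, ENNReal.ofReal ((A ^ k) ^ p)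
      = ENNReal.ofReal (A ^ (j * p)) * ENNReal.ofReal ((A ^ (k - j)) ^ p) := by
    intro k j
    rw [← ENNReal.ofReal_mul (by positivity)]
    congr 1
    rw [← Real.rpow_intCast, ← Real.rpow_intCast, ← Real.rpow_mul hA0.le, ← Real.rpow_mul hA0.le,
      ← Real.rpow_add hA0]
    congr 1
    push_cast
    ring
  have hk1 : ∀ k : ℤ, A ^ k / A = A ^ (k - 1) := fun k => by rw [zpow_sub_one₀ hA0.ne']; rfl
  have hk2 : ∀ k : ℤ, A ^ k / A ^ 2 = A ^ (k - 2) := fun k => by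
    rw [zpow_sub₀ hA0.ne']; rfl
  rw [mul_assoc, ← ENNReal.tsum_mul_left]
  obtain ⟨k₀, hk₀⟩ : ∃ k₀ : ℤ, ∀ k, k₀ ≤ k → t₀ ≤ A ^ k := by
    obtain ⟨n, hn⟩ := pow_unbounded_of_one_lt t₀ (by linarith : 1 < A)
    refine ⟨n, fun k hk => hn.le.trans ?_⟩
    rw [← zpow_natCast]
    exact zpow_le_zpow_right₀ (by linarith) hk
  refine tsum_le_of_recursion (B := B) (k₀ := k₀) ?_ (fun k => hB _ (hpos k)) hBt ?_ ?_
  · intro k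
    have hk := hrec T hT1 hTt hF (A ^ k) A (hpos k) hA2
    rw [hk1, hk2] at hk
    set W₁ := ENNReal.ofReal ((A ^ (k - 1)) ^ p)
    set W₂ := ENNReal.ofReal ((A ^ (k - 2)) ^ p)
    have e1 : ENNReal.ofReal ((A ^ k) ^ p) = ENNReal.ofReal (A ^ p) * W₁ := by
      rw [hw k 1]; norm_num; rfl
    have e2 : ENNReal.ofReal ((A ^ k) ^ p) = a * W₂ := by
      rw [hw k 2]; norm_num; rfl
    have e3 : ENNReal.ofReal (A ^ p) * ENNReal.ofReal ((2 / A) ^ q) ≤ 4⁻¹ := by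
      rw [← ENNReal.ofReal_mul (by positivity), mul_comm]
      refine (ENNReal.ofReal_le_ofReal hAq).trans (le_of_eq ?_)
      rw [one_div, ENNReal.ofReal_inv_of_pos (by norm_num)]
      norm_num
    have e4 : a * (C / T) ≤ 4⁻¹ := by
      rw [ENNReal.le_inv_iff_mul_le, mul_assoc, mul_comm _ (4 : ℝ≥0∞), ← mul_div_assoc,
        ← mul_div_assoc]
      refine ENNReal.div_le_of_le_mul ?_
      rw [one_mul, hT]
      calc a * (4 * C) = 4 * C * a := by ring
        _ ≤ _ := le_self_add
    calc ENNReal.ofReal ((A ^ k) ^ p) * levelSum μ q F (A ^ k)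
        ≤ ENNReal.ofReal ((A ^ k) ^ p) *
          (ENNReal.ofReal ((2 / A) ^ q) * levelSum μ q F (A ^ (k - 1))
          + (T * μ (risingSet F (A ^ (k - 2))) + C / T * levelSum μ q F (A ^ (k - 2)))) := by
          gcongr
      _ = (ENNReal.ofReal (A ^ p) * ENNReal.ofReal ((2 / A) ^ q))
              * (W₁ * levelSum μ q F (A ^ (k - 1)))
            + a * (C / T) * (W₂ * levelSum μ q F (A ^ (k - 2)))
            + T * a * (W₂ * μ (risingSet F (A ^ (k - 2)))) := by
          rw [mul_add, mul_add]
          nth_rw 1 [e1]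
          rw [e2]
          ring
      _ ≤ 4⁻¹ * (W₁ * levelSum μ q F (A ^ (k - 1)))
            + 4⁻¹ * (W₂ * levelSum μ q F (A ^ (k - 2)))
            + T * a * (W₂ * μ (risingSet F (A ^ (k - 2)))) := by gcongr
      _ = _ := by
          simp only [div_eq_mul_inv]
          ring
  · intro k hk
    have : components (risingSet F (A ^ k)) = ∅ := by
      rw [ht₀ _ (hk₀ k hk)]
      refine eq_empty_of_forall_notMem fun I hI => ?_
      obtain ⟨x, hx⟩ := nonempty_Ioo.2 hI.1
      exact hI.2.2.2 hx
    rw [levelSum, this]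
    simp
  · rw [ENNReal.tsum_mul_left]
    refine ENNReal.mul_ne_top (ENNReal.mul_ne_top hTt ENNReal.ofReal_ne_top) hfin

/-! ### The right maximal function of a distribution function -/

/-- The right maximal function of the measure `dF`. -/
noncomputable def rightMax (F : ℝ → ℝ) (x : ℝ) : ℝ≥0∞ :=
  ⨆ (h : ℝ) (_ : 0 < h), ENNReal.ofReal ((F (x + h) - F x) / h)

theorem le_rightMax (F : ℝ → ℝ) {x y : ℝ} (hxy : x < y) :
    ENNReal.ofReal ((F y - F x) / (y - x)) ≤ rightMax F x := by
  refine le_iSup₂_of_le (y - x) (sub_pos.2 hxy) ?_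
  rw [add_sub_cancel]

theorem lt_rightMax_iff {F : ℝ → ℝ} {t : ℝ} (ht : 0 ≤ t) {x : ℝ} :
    ENNReal.ofReal t < rightMax F x ↔ x ∈ risingSet F t := by
  simp only [rightMax, lt_iSup_iff, ENNReal.ofReal_lt_ofReal_iff_of_nonneg ht, risingSet,
    mem_ofPred_eq]
  constructor
  · rintro ⟨h, hh, hlt⟩
    rw [lt_div_iff₀ hh] at hlt
    exact ⟨x + h, by linarith, by rwa [add_sub_cancel_left]⟩
  · rintro ⟨y, hxy, hlt⟩
    refine ⟨y - x, sub_pos.2 hxy, ?_⟩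
    rw [lt_div_iff₀ (sub_pos.2 hxy), add_sub_cancel]
    exact hlt

/-- A priori finiteness: if the right maximal function is in `L^p(μ)`, then the sums over
components are bounded uniformly in the height. Near the support of `dF` this comes from the `C_q⁺`
condition, far to the left of it from the right maximal function itself. -/
theorem TailCondition.exists_levelSum_le_of_lintegral_ne_top {μ : Measure ℝ} {p q ε : ℝ}
    {K : ℝ≥0∞} (hμ : TailCondition μ q ε K) (hε : 0 < ε) (hK : K ≠ ∞) (hp : 1 < p) (hpq : p < q)
    [NullSingletonClass μ] [IsLocallyFiniteMeasure μ] {F : ℝ → ℝ} {l r : ℝ} (hF : IsCDF F l r)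
    (hlr : l < r) (hFlr : F l < F r) {t₀ : ℝ} (ht₀ : ∀ t ≥ t₀, risingSet F t = ∅)
    (hfin : ∫⁻ x, rightMax F x ^ p ∂μ ≠ ∞) :
    ∃ B : ℝ≥0∞, B ≠ ∞ ∧ ∀ t > 0, ENNReal.ofReal (t ^ p) * levelSum μ q F t ≤ B := by
  have hq : 1 < q := hp.trans hpq
  obtain ⟨C, hC, hkey⟩ := hμ.exists_lintegral_tsum_hat_le hε hK hq
  set X := ∫⁻ x, rightMax F x ^ p ∂μ with hX
  set x₀ := 2 * l - r with hx₀
  set I₀ : ℝ × ℝ := (x₀, r) with hI₀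
  have hx₀l : x₀ < l := by linarith
  have hx₀r : x₀ < r := by linarith
  have hI₀lt : I₀.1 < I₀.2 := hx₀r
  have hm : 0 < F r - F l := by linarith
  have hFx : ∀ x ≤ x₀, F x = F l := fun x hx => hF.left x (by linarith)
  have hIcc : μ (Icc x₀ r) ≠ ∞ := isCompact_Icc.measure_lt_top.ne
  -- far to the left, `rightMax F` is comparable to `hat I₀`
  have hfar : ∀ x ≤ x₀, ENNReal.ofReal ((F r - F l) / (r - x)) ≤ rightMax F x := by
    intro x hx
    have := le_rightMax F (hx.trans_lt hx₀r)
    rwa [hFx x hx] at this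
  set c := ENNReal.ofReal (2 * (r - l) / (F r - F l)) with hc
  have hhat0 : ∫⁻ x, hat I₀ x ^ q ∂μ ≤ c ^ p * X + μ (Icc x₀ r) := by
    have h1 : ∫⁻ x in Iic x₀, hat I₀ x ^ q ∂μ ≤ c ^ p * X := by
      rw [hX, ← lintegral_const_mul' _ _ (by rw [hc]; finiteness)]
      refine (setLIntegral_mono' measurableSet_Iic fun x hx => ?_).trans
        (setLIntegral_le_lintegral (Iic x₀) _)
      simp only [mem_Iic] at hx
      have hrx : 0 < r - x := by linarith
      calc hat I₀ x ^ q ≤ hat I₀ x ^ p :=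
            ENNReal.rpow_le_rpow_of_exponent_ge (hat_le_one hI₀lt x) hpq.le
        _ ≤ (c * rightMax F x) ^ p := by
            gcongr
            calc hat I₀ x = c * ENNReal.ofReal ((F r - F l) / (r - x)) := by
                  rw [hat_of_left hI₀lt (by exact hx), hc, ← ENNReal.ofReal_mul (by
                    have : 0 < r - l := by linarith
                    positivity)]
                  congr 1
                  simp only [hI₀, hx₀]
                  field_simp
                  ring
              _ ≤ _ := by
                  gcongr
                  exact hfar x hx
        _ = _ := ENNReal.mul_rpow_of_nonneg _ _ (by linarith)
    have h2 : ∫⁻ x in Ioi x₀, hat I₀ x ^ q ∂μ ≤ μ (Icc x₀ r) := by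
      rw [← lintegral_indicator_one measurableSet_Icc]
      refine (setLIntegral_mono' measurableSet_Ioi fun x hx => ?_).trans
        (setLIntegral_le_lintegral (Ioi x₀) _)
      rcases lt_or_ge x r with h | h
      · rw [indicator_of_mem (show x ∈ Icc x₀ r from ⟨le_of_lt hx, h.le⟩)]
        exact ENNReal.rpow_le_one (hat_le_one hI₀lt x) (by linarith)
      · rw [hat_of_right (by exact h), ENNReal.zero_rpow_of_pos (by linarith)]
        exact bot_le
    calc ∫⁻ x, hat I₀ x ^ q ∂μ = ∫⁻ x in Iic x₀ ∪ Ioi x₀, hat I₀ x ^ q ∂μ := by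
          rw [Iic_union_Ioi, setLIntegral_univ]
      _ ≤ _ := lintegral_union_le _ _ _
      _ ≤ _ := add_le_add h1 h2
  set N := μ (Icc x₀ r) + C * (c ^ p * X + μ (Icc x₀ r)) with hN
  refine ⟨2 ^ p * X + ENNReal.ofReal (t₀ ^ p) * N, ?_, fun t ht => ?_⟩
  · rw [hN]
    have : c ^ p ≠ ∞ := by rw [hc]; finiteness
    finiteness
  rcases le_or_gt t₀ t with htt | htt
  · have : components (risingSet F t) = ∅ := by
      rw [ht₀ t htt]
      refine eq_empty_of_forall_notMem fun I hI => ?_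
      obtain ⟨x, hx⟩ := nonempty_Ioo.2 hI.1
      exact hI.2.2.2 hx
    rw [levelSum, this]
    simp
  have hJr : ∀ J ∈ components (risingSet F t), J.2 ≤ r := by
    intro J hJ
    by_contra! hlt
    obtain ⟨z, hz1, hz2⟩ := exists_between (max_lt hlt hJ.1)
    rcases max_lt_iff.1 hz1 with ⟨hz3, hz4⟩
    exact (hF.lt_of_mem_risingSet ht (hJ.2.2.2 ⟨hz4, hz2⟩)).not_gt hz3
  have hJl : ∀ J ∈ components (risingSet F t), l < J.2 := by
    intro J hJ
    by_contra! hle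
    have h1 := sub_eq_of_mem_components hF.cont hJ
    rw [hF.left _ hle, hF.left _ (hJ.1.le.trans hle), sub_self] at h1
    have := mul_pos ht (sub_pos.2 hJ.1)
    linarith
  have hsplit : ∀ J : components (risingSet F t), ∫⁻ x, hat J x ^ q ∂μ
      ≤ ∫⁻ x in Iic x₀, hat J x ^ q ∂μ + ∫⁻ x in Ioo I₀.1 I₀.2, hat J x ^ q ∂μ := by
    intro J
    have hr : ∫⁻ x in Ici r, hat J x ^ q ∂μ = 0 := by
      rw [setLIntegral_congr_fun (g := fun _ => 0) measurableSet_Ici]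
      · simp
      · intro x hx
        simp [hat_of_right ((hJr J J.2).trans hx), ENNReal.zero_rpow_of_pos (by linarith : 0 < q)]
    calc ∫⁻ x, hat J x ^ q ∂μ
        ≤ ∫⁻ x in (Iic x₀ ∪ Ioo I₀.1 I₀.2) ∪ Ici r, hat J x ^ q ∂μ := by
          rw [← setLIntegral_univ]
          refine lintegral_mono_set fun x _ => ?_
          rcases le_or_gt r x with hx | hx
          · exact Or.inr hx
          · rcases le_or_gt x x₀ with hx' | hx'
            · exact Or.inl (Or.inl hx')
            · exact Or.inl (Or.inr ⟨hx', hx⟩)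
      _ ≤ _ := by
          refine (lintegral_union_le _ _ _).trans ?_
          rw [hr, add_zero]
          exact lintegral_union_le _ _ _
  have hcount := (components_countable (risingSet F t)).to_subtype
  have hleft : ENNReal.ofReal (t ^ p)
      * ∑' J : components (risingSet F t), ∫⁻ x in Iic x₀, hat J x ^ q ∂μ ≤ 2 ^ p * X := by
    rw [← lintegral_tsum fun J => ((measurable_hat _).pow_const q).aemeasurable, hX,
      ← lintegral_const_mul' _ _ (by finiteness), ← lintegral_const_mul' _ _ (by finiteness)]
    refine (setLIntegral_mono' measurableSet_Iic fun x hx => ?_).trans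
      (setLIntegral_le_lintegral (Iic x₀) _)
    simp only [mem_Iic] at hx
    have hrx : 0 < r - x := by linarith
    have hJ : ∀ J : components (risingSet F t), ENNReal.ofReal t * hat J x
        ≤ ENNReal.ofReal (F J.1.2 - F J.1.1) * ENNReal.ofReal (2 / (r - x)) := by
      intro J
      have hJ1 := J.2.1
      have hlJ := hJl J J.2
      have hJx : 0 < J.1.2 - x := by linarith
      have hlen : 0 ≤ F J.1.2 - F J.1.1 := sub_nonneg.2 (hF.mono hJ1.le)
      have key : t * (J.1.2 - x) ≤ F J.1.2 - F J.1.1 ∨ x ≤ J.1.1 := by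
        rcases le_or_gt x J.1.1 with h | h
        · exact Or.inr h
        · left
          have := le_sub_of_mem_components hF.cont J.2 (x := x) ⟨h, by linarith⟩
          rw [hFx x hx] at this
          rwa [hFx _ (h.le.trans hx)]
      rw [← ENNReal.ofReal_mul hlen]
      have hfin2 : (F J.1.2 - F J.1.1) / (J.1.2 - x)
          ≤ (F J.1.2 - F J.1.1) * (2 / (r - x)) := by
        rw [mul_div_assoc', div_le_div_iff₀ hJx hrx]
        nlinarith
      rcases key with h | h
      · calc ENNReal.ofReal t * hat J x ≤ ENNReal.ofReal t * 1 := by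
              gcongr
              exact hat_le_one hJ1 x
          _ ≤ _ := by
              rw [mul_one]
              refine ENNReal.ofReal_le_ofReal (le_trans ?_ hfin2)
              rwa [le_div_iff₀ hJx]
      · rw [hat_of_left hJ1 h, ← ENNReal.ofReal_mul ht.le, mul_div_assoc',
          ← sub_eq_of_mem_components hF.cont J.2]
        exact ENNReal.ofReal_le_ofReal hfin2
    have hsum : ∑' J : components (risingSet F t), ENNReal.ofReal t * hat J x
        ≤ 2 * rightMax F x := by
      calc ∑' J : components (risingSet F t), ENNReal.ofReal t * hat J x
          ≤ ∑' J : components (risingSet F t),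
              ENNReal.ofReal (F J.1.2 - F J.1.1) * ENNReal.ofReal (2 / (r - x)) :=
            ENNReal.tsum_le_tsum hJ
        _ ≤ ENNReal.ofReal (F r - F l) * ENNReal.ofReal (2 / (r - x)) := by
            rw [ENNReal.tsum_mul_right]
            gcongr
            refine (tsum_sub_le hF.cont hF.mono (components_countable _)
              (components_pairwiseDisjoint _) (x := l - (F r - F l) / t) (y := r) ?_).trans
              (ENNReal.ofReal_le_ofReal (hF.sub_le _ _))
            intro I hI y hy
            exact ⟨hF.le_of_mem_risingSet ht (hI.2.2.2 hy),
              hF.lt_of_mem_risingSet ht (hI.2.2.2 hy)⟩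
        _ = 2 * ENNReal.ofReal ((F r - F l) / (r - x)) := by
            rw [← ENNReal.ofReal_mul hm.le, show (2 : ℝ≥0∞) = ENNReal.ofReal 2 by simp,
              ← ENNReal.ofReal_mul (by norm_num)]
            congr 1
            ring
        _ ≤ _ := by
            gcongr
            exact hfar x hx
    have hpow : ∀ J : components (risingSet F t), ENNReal.ofReal (t ^ p) * hat J x ^ q
        ≤ (2 * rightMax F x) ^ (p - 1) * (ENNReal.ofReal t * hat J x) := by
      intro J
      calc ENNReal.ofReal (t ^ p) * hat J x ^ q
          ≤ ENNReal.ofReal t ^ p * hat J x ^ p := by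
            rw [ENNReal.ofReal_rpow_of_pos ht]
            gcongr 1
            exact ENNReal.rpow_le_rpow_of_exponent_ge (hat_le_one J.2.1 x) hpq.le
        _ = (ENNReal.ofReal t * hat J x) ^ (p - 1 + 1) := by
            rw [← ENNReal.mul_rpow_of_nonneg _ _ (by linarith)]
            ring_nf
        _ = (ENNReal.ofReal t * hat J x) ^ (p - 1) * (ENNReal.ofReal t * hat J x) := by
            rw [ENNReal.rpow_add_of_nonneg _ _ (by linarith) zero_le_one, ENNReal.rpow_one]
        _ ≤ _ := by
            refine mul_le_mul' (ENNReal.rpow_le_rpow ?_ (by linarith)) le_rfl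
            exact (ENNReal.le_tsum
              (f := fun J : components (risingSet F t) => ENNReal.ofReal t * hat J x) J).trans hsum
    calc ENNReal.ofReal (t ^ p) * ∑' J : components (risingSet F t), hat J x ^ q
        ≤ (2 * rightMax F x) ^ (p - 1)
            * ∑' J : components (risingSet F t), ENNReal.ofReal t * hat J x := by
          rw [← ENNReal.tsum_mul_left, ← ENNReal.tsum_mul_left]
          exact ENNReal.tsum_le_tsum hpow
      _ ≤ (2 * rightMax F x) ^ (p - 1) * (2 * rightMax F x) := by gcongr
      _ = (2 * rightMax F x) ^ p := by
          conv_rhs => rw [show p = p - 1 + 1 by ring]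
          rw [ENNReal.rpow_add_of_nonneg _ _ (by linarith) zero_le_one, ENNReal.rpow_one]
      _ = _ := ENNReal.mul_rpow_of_nonneg _ _ (by linarith)
  have hin : ∑' J : components (risingSet F t), ∫⁻ x in Ioo I₀.1 I₀.2, hat J x ^ q ∂μ ≤ N := by
    refine (hkey 1 le_rfl (by simp) I₀ hI₀lt _ (components_countable _) (fun J hJ => hJ.1)
      (components_pairwiseDisjoint _) hJr).trans ?_
    rw [one_mul, div_one, hN]
    gcongr
    exact Ioo_subset_Icc_self
  calc ENNReal.ofReal (t ^ p) * levelSum μ q F t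
      ≤ ENNReal.ofReal (t ^ p) * (∑' J : components (risingSet F t),
          (∫⁻ x in Iic x₀, hat J x ^ q ∂μ + ∫⁻ x in Ioo I₀.1 I₀.2, hat J x ^ q ∂μ)) := by
        gcongr
        exact ENNReal.tsum_le_tsum hsplit
    _ ≤ _ := by
        rw [ENNReal.tsum_add, mul_add]
        gcongr

/-! ### The good-lambda inequality -/

/-- The good-lambda inequality on a Whitney piece of a component `I` at height `t`: the points
where the averages of `dF` exceed `A * t` although the excess `dΦ` of `dF` over `t` has small
average up to the right end of `I`. The weak type inequality is applied to `dΦ` on `[τ, I.2]`,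
where `τ` is the leftmost of these points. -/
theorem volume_goodLambda_le {F : ℝ → ℝ} {t A γ : ℝ} (ht : 0 < t) (hA : 2 ≤ A) (hγ : 0 ≤ γ)
    {Φ : ℝ → ℝ} (hΦ : Continuous Φ) (hΦm : Monotone Φ)
    (hΦF : ∀ x y, x ≤ y → F y - F x - t * (y - x) ≤ Φ y - Φ x) {I : ℝ × ℝ}
    (hI : I ∈ components (risingSet F t)) (i : ℕ) :
    volume ({x | x ∈ Ioo I.1 I.2 ∧ x ∈ risingSet F (A * t) ∧ Φ I.2 - Φ x ≤ γ * t * (I.2 - x)}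
        ∩ Ioo (whitneyPoint I i) (whitneyPoint I (i + 1)))
      ≤ ENNReal.ofReal (4 * γ)
        * ENNReal.ofReal (whitneyPoint I (i + 2) - whitneyPoint I (i + 1)) := by
  set S := {x | x ∈ Ioo I.1 I.2 ∧ x ∈ risingSet F (A * t) ∧ Φ I.2 - Φ x ≤ γ * t * (I.2 - x)}
        ∩ Ioo (whitneyPoint I i) (whitneyPoint I (i + 1)) with hS
  rcases S.eq_empty_or_nonempty with h0 | hne
  · rw [h0]
    simp
  have hbdd : BddBelow S := ⟨whitneyPoint I i, fun x hx => hx.2.1.le⟩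
  set τ := sInf S with hτ
  have hτi : whitneyPoint I i ≤ τ := le_csInf hne fun x hx => hx.2.1.le
  have hτI : τ ≤ I.2 := by
    obtain ⟨x, hx⟩ := hne
    exact (csInf_le hbdd hx).trans hx.1.1.2.le
  have hτΦ : Φ I.2 - Φ τ ≤ γ * t * (I.2 - τ) := by
    have hcl : IsClosed {x | Φ I.2 - Φ x ≤ γ * t * (I.2 - x)} :=
      isClosed_le (by fun_prop) (by fun_prop)
    exact closure_minimal (fun x hx => hx.1.2.2) hcl (csInf_mem_closure hne hbdd)
  set Ψ : ℝ → ℝ := fun x => Φ (max τ (min x I.2)) with hΨ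
  have hΨcdf : IsCDF Ψ τ I.2 := isCDF_clamp hΦ hΦm hτI
  have hAt : 0 < (A - 1) * t := mul_pos (by linarith) ht
  have hsub : S ⊆ risingSet Ψ ((A - 1) * t) := by
    intro x hx
    have hτx : τ ≤ x := csInf_le hbdd hx
    have hxI := hx.1.1.2
    obtain ⟨y, hxy, hy⟩ := hx.1.2.1
    -- the interval of large average may be taken inside `I`
    obtain ⟨z, hxz, hzI, hz⟩ : ∃ z, x < z ∧ z ≤ I.2 ∧ A * t * (z - x) < F z - F x := by
      rcases le_or_gt y I.2 with h | h
      · exact ⟨y, hxy, h, hy⟩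
      · refine ⟨I.2, hxI, le_rfl, ?_⟩
        have := sub_le_of_notMem_risingSet hI.2.2.1 h.le
        have h2 : t * (y - I.2) ≤ A * t * (y - I.2) := by
          have : 0 ≤ t * (y - I.2) := mul_nonneg ht.le (by linarith)
          nlinarith
        nlinarith
    refine ⟨z, hxz, ?_⟩
    have e1 : Ψ x = Φ x := by simp only [hΨ]; rw [min_eq_left hxI.le, max_eq_right hτx]
    have e2 : Ψ z = Φ z := by
      simp only [hΨ]; rw [min_eq_left hzI, max_eq_right (hτx.trans hxz.le)]
    rw [e1, e2]
    have := hΦF x z hxz.le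
    nlinarith
  have e1 : Ψ τ = Φ τ := by simp only [hΨ]; rw [min_eq_left hτI, max_self]
  have e2 : Ψ I.2 = Φ I.2 := by simp only [hΨ]; rw [min_self, max_eq_right hτI]
  calc volume S ≤ volume (risingSet Ψ ((A - 1) * t)) := measure_mono hsub
    _ ≤ ENNReal.ofReal ((Ψ I.2 - Ψ τ) / ((A - 1) * t)) := hΨcdf.volume_risingSet_le hAt
    _ ≤ ENNReal.ofReal (4 * γ * (whitneyPoint I (i + 2) - whitneyPoint I (i + 1))) := by
        refine ENNReal.ofReal_le_ofReal ?_
        have h4 : 4 * (whitneyPoint I (i + 2) - whitneyPoint I (i + 1))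
            = I.2 - whitneyPoint I i := by
          rw [sub_whitneyPoint, whitneyPoint_succ_sub I (i + 1), pow_succ]
          ring
        rw [e1, e2, div_le_iff₀ hAt]
        have h5 : 4 * γ * (whitneyPoint I (i + 2) - whitneyPoint I (i + 1))
            = γ * (I.2 - whitneyPoint I i) := by rw [← h4]; ring
        rw [h5]
        have h6 : γ * t * (I.2 - τ) ≤ γ * t * (I.2 - whitneyPoint I i) := by gcongr
        have h7 : 0 ≤ γ * t * (I.2 - whitneyPoint I i) := by
          have : 0 ≤ I.2 - whitneyPoint I i := by linarith
          positivity
        nlinarith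
    _ = _ := ENNReal.ofReal_mul (by positivity)

theorem ofReal_zpow_rpow {A p : ℝ} (hA : 0 < A) (k : ℤ) (j : ℕ) :
    ENNReal.ofReal ((A ^ (k + j)) ^ p)
      = ENNReal.ofReal (A ^ p) ^ j * ENNReal.ofReal ((A ^ k) ^ p) := by
  rw [← ENNReal.ofReal_pow (by positivity), ← ENNReal.ofReal_mul (by positivity), zpow_add₀ hA.ne',
    Real.mul_rpow (by positivity) (by positivity), mul_comm, zpow_natCast, ← Real.rpow_natCast,
    ← Real.rpow_natCast, ← Real.rpow_mul hA.le, ← Real.rpow_mul hA.le, mul_comm p]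

/-- The discrete layer-cake formula, upper bound. -/
theorem tsum_zpow_indicator_le {A p : ℝ} (hA : 2 ≤ A) (hp : 1 ≤ p) (v : ℝ≥0∞) :
    ∑' k : ℤ, ENNReal.ofReal ((A ^ k) ^ p) * {u | ENNReal.ofReal (A ^ k) < u}.indicator 1 v
      ≤ 2 * v ^ p := by
  have hA0 : 0 < A := by linarith
  have hp0 : 0 < p := by linarith
  rcases eq_or_ne v 0 with rfl | h0
  · simp
  rcases eq_or_ne v ∞ with rfl | hv
  · rw [ENNReal.top_rpow_of_pos hp0, ENNReal.mul_top (by simp)]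
    exact le_top
  have hv0 : 0 < v.toReal := ENNReal.toReal_pos h0 hv
  obtain ⟨n, hn1, hn2⟩ := exists_mem_Ioc_zpow hv0 (by linarith : 1 < A)
  have hinj : Function.Injective (fun j : ℕ => n - (j : ℤ)) := fun a b h => by
    simpa using h
  rw [← hinj.tsum_eq]
  · have hterm : ∀ j : ℕ, ENNReal.ofReal ((A ^ (n - (j : ℤ))) ^ p)
        * {u | ENNReal.ofReal (A ^ (n - (j : ℤ))) < u}.indicator 1 v ≤ v ^ p * 2⁻¹ ^ j := by
      intro j
      have h1 : ENNReal.ofReal ((A ^ n) ^ p) ≤ v ^ p := by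
        rw [← ENNReal.ofReal_rpow_of_pos (by positivity)]
        refine ENNReal.rpow_le_rpow ?_ hp0.le
        exact ENNReal.ofReal_le_of_le_toReal hn1.le
      have h2 : ENNReal.ofReal ((A ^ n) ^ p)
          = ENNReal.ofReal (A ^ p) ^ j * ENNReal.ofReal ((A ^ (n - (j : ℤ))) ^ p) := by
        rw [← ofReal_zpow_rpow hA0, sub_add_cancel]
      have h3 : (2 : ℝ≥0∞) ≤ ENNReal.ofReal (A ^ p) := by
        rw [show (2 : ℝ≥0∞) = ENNReal.ofReal 2 by simp]
        refine ENNReal.ofReal_le_ofReal (hA.trans ?_)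
        exact Real.self_le_rpow_of_one_le (by linarith) hp
      have h4 : 2 ^ j * ENNReal.ofReal ((A ^ (n - (j : ℤ))) ^ p) ≤ v ^ p := by
        refine le_trans ?_ h1
        rw [h2]
        gcongr
      calc _ ≤ ENNReal.ofReal ((A ^ (n - (j : ℤ))) ^ p) * 1 := by
            gcongr
            exact indicator_le_self' (by simp) v
        _ ≤ _ := by
            rw [mul_one, ← ENNReal.inv_pow, ← div_eq_mul_inv,
              ENNReal.le_div_iff_mul_le (by simp) (by simp), mul_comm]
            exact h4
    refine (ENNReal.tsum_le_tsum hterm).trans (le_of_eq ?_)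
    rw [ENNReal.tsum_mul_left, ENNReal.tsum_geometric, ENNReal.one_sub_inv_two, inv_inv, mul_comm]
  · intro k hk
    rw [Function.mem_support] at hk
    have hlt : ENNReal.ofReal (A ^ k) < v := by
      by_contra hcon
      exact hk (by rw [indicator_of_notMem (by exact hcon), mul_zero])
    have hkn : k < n + 1 := by
      have := (ENNReal.ofReal_lt_iff_lt_toReal (by positivity) hv).1 hlt
      exact (zpow_lt_zpow_iff_right₀ (by linarith : 1 < A)).1 (this.trans_le hn2)
    exact ⟨(n - k).toNat, by simp only; omega⟩

/-- The discrete layer-cake formula, lower bound. -/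
theorem le_tsum_zpow_indicator {A p : ℝ} (hA : 2 ≤ A) (hp : 1 ≤ p) {v : ℝ≥0∞} (hv : v ≠ ∞) :
    v ^ p ≤ ENNReal.ofReal (A ^ p)
      * ∑' k : ℤ, ENNReal.ofReal ((A ^ k) ^ p) * {u | ENNReal.ofReal (A ^ k) < u}.indicator 1 v := by
  have hA0 : 0 < A := by linarith
  have hp0 : 0 < p := by linarith
  rcases eq_or_ne v 0 with rfl | h0
  · rw [ENNReal.zero_rpow_of_pos hp0]
    exact bot_le
  have hv0 : 0 < v.toReal := ENNReal.toReal_pos h0 hv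
  obtain ⟨n, hn1, hn2⟩ := exists_mem_Ioc_zpow hv0 (by linarith : 1 < A)
  have hlt : ENNReal.ofReal (A ^ n) < v := (ENNReal.ofReal_lt_iff_lt_toReal (by positivity) hv).2 hn1
  calc v ^ p ≤ ENNReal.ofReal (A ^ (n + 1)) ^ p := by
        gcongr
        exact (ENNReal.le_ofReal_iff_toReal_le hv (by positivity)).2 hn2
    _ = ENNReal.ofReal (A ^ p) * (ENNReal.ofReal ((A ^ n) ^ p)
          * {u | ENNReal.ofReal (A ^ n) < u}.indicator 1 v) := by
        rw [indicator_of_mem (by exact hlt), ENNReal.ofReal_rpow_of_pos (by positivity)]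
        have := ofReal_zpow_rpow (p := p) hA0 n 1
        simpa using this
    _ ≤ _ := by
        gcongr
        exact ENNReal.le_tsum (f := fun k : ℤ => ENNReal.ofReal ((A ^ k) ^ p)
          * {u | ENNReal.ofReal (A ^ k) < u}.indicator 1 v) n

theorem exists_pos_mul_rpow_le_half {c : ℝ≥0∞} (hc : c ≠ ∞) {ε : ℝ} (hε : 0 < ε) :
    ∃ γ : ℝ, 0 < γ ∧ c * ENNReal.ofReal (4 * γ) ^ ε ≤ 2⁻¹ := by
  set d : ℝ := 2 * (c.toReal + 1) with hd
  have hd0 : 0 < d := by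
    have : 0 ≤ c.toReal := ENNReal.toReal_nonneg
    positivity
  refine ⟨d⁻¹ ^ (1 / ε) / 4, by positivity, ?_⟩
  have e1 : ENNReal.ofReal (4 * (d⁻¹ ^ (1 / ε) / 4)) ^ ε = ENNReal.ofReal d⁻¹ := by
    rw [mul_div_cancel₀ _ (by norm_num : (4 : ℝ) ≠ 0), ENNReal.ofReal_rpow_of_pos (by positivity),
      ← Real.rpow_mul (by positivity), one_div_mul_cancel hε.ne', Real.rpow_one]
  rw [e1, ← ENNReal.ofReal_toReal hc, ← ENNReal.ofReal_mul ENNReal.toReal_nonneg,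
    show (2⁻¹ : ℝ≥0∞) = ENNReal.ofReal 2⁻¹ by
      rw [ENNReal.ofReal_inv_of_pos (by norm_num)]; norm_num]
  refine ENNReal.ofReal_le_ofReal ?_
  rw [← div_eq_mul_inv, div_le_iff₀ hd0]
  linarith

/-- Sufficiency for distribution functions. Here `G` plays the role of the sharp maximal function:
it dominates the averages over `(x, y)` of the excess `dΦ t` of `dF` over the height `t`, whenever
the average of `dF` over the next interval of the same length is at most `t`. -/
theorem TailCondition.exists_lintegral_rightMax_le {μ : Measure ℝ} {p q ε : ℝ}
    {K : ℝ≥0∞} (hμ : TailCondition μ q ε K) (hε : 0 < ε) (hK : K ≠ ∞) (hp : 1 < p) (hpq : p < q)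
    [NullSingletonClass μ] [IsLocallyFiniteMeasure μ] :
    ∃ C : ℝ≥0∞, C ≠ ∞ ∧ ∀ {F : ℝ → ℝ} {l r : ℝ}, IsCDF F l r → l < r → F l < F r →
      (∃ t₀, ∀ t ≥ t₀, risingSet F t = ∅) → ∫⁻ x, rightMax F x ^ p ∂μ ≠ ∞ →
      ∀ (Φ : ℝ → ℝ → ℝ) (G : ℝ → ℝ≥0∞), (∀ t, Continuous (Φ t)) → (∀ t, Monotone (Φ t)) →
        (∀ t, ∀ x y, x ≤ y → F y - F x - t * (y - x) ≤ Φ t y - Φ t x) →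
        (∀ t > 0, ∀ x y, x < y → F (y + (y - x)) - F y ≤ t * (y - x) →
          ENNReal.ofReal ((Φ t y - Φ t x) / (y - x)) ≤ G x) →
        ∫⁻ x, rightMax F x ^ p ∂μ ≤ C * ∫⁻ x, G x ^ p ∂μ := by
  have hq : 1 < q := hp.trans hpq
  have hp0 : 0 < p := by linarith
  obtain ⟨A, hA, D, hD, hlevel⟩ := hμ.exists_tsum_levelSum_le hε hK hpq hq
  have hA0 : 0 < A := by linarith
  set ρ := ENNReal.ofReal (A ^ p) with hρ
  have hρt : ρ ≠ ∞ := ENNReal.ofReal_ne_top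
  set K' := K * ENNReal.ofReal (2 * 4 ^ q) with hK'
  have hK't : K' ≠ ∞ := ENNReal.mul_ne_top hK ENNReal.ofReal_ne_top
  obtain ⟨γ, hγ, hγle⟩ := exists_pos_mul_rpow_le_half (c := ρ * K' * D) (by finiteness) hε
  have hγ0 : ENNReal.ofReal γ ≠ 0 := by simpa using hγ
  have hγp : (ENNReal.ofReal γ)⁻¹ ^ p ≠ ∞ := by finiteness
  refine ⟨ρ * (2 * (ρ * (2 * (ENNReal.ofReal γ)⁻¹ ^ p))), by finiteness, ?_⟩
  intro F l r hF hlr hFlr ⟨t₀, ht₀⟩ hfin Φ G hΦc hΦm hΦF hG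
  have hpos : ∀ k : ℤ, 0 < A ^ k := fun k => zpow_pos hA0 k
  set w : ℤ → ℝ≥0∞ := fun k => ENNReal.ofReal ((A ^ k) ^ p) with hw
  have hw1 : ∀ k, w (k + 1) = ρ * w k := fun k => by
    have := ofReal_zpow_rpow (p := p) hA0 k 1
    simpa using this
  have hwt : ∀ k, w k ≠ ∞ := fun k => ENNReal.ofReal_ne_top
  set Ω : ℤ → Set ℝ := fun k => risingSet F (A ^ k) with hΩ
  have hΩm : ∀ k, MeasurableSet (Ω k) := fun k => measurableSet_risingSet hF.cont _
  have hind : ∀ x, ∀ k : ℤ, {u | ENNReal.ofReal (A ^ k) < u}.indicator (1 : ℝ≥0∞ → ℝ≥0∞)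
      (rightMax F x) = (Ω k).indicator 1 x := by
    intro x k
    by_cases hx : x ∈ Ω k
    · rw [indicator_of_mem hx, indicator_of_mem (by exact (lt_rightMax_iff (hpos k).le).2 hx)]
      rfl
    · rw [indicator_of_notMem hx,
        indicator_of_notMem (by exact fun h => hx ((lt_rightMax_iff (hpos k).le).1 h))]
  have hlayer : ∑' k, w k * μ (Ω k) = ∫⁻ x, ∑' k, w k * (Ω k).indicator 1 x ∂μ := by
    rw [lintegral_tsum fun k => ((measurable_one.indicator (hΩm k)).const_mul _).aemeasurable]
    refine tsum_congr fun k => ?_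
    rw [lintegral_const_mul _ (measurable_one.indicator (hΩm k)), lintegral_indicator_one (hΩm k)]
  have hup : ∑' k, w k * μ (Ω k) ≤ 2 * ∫⁻ x, rightMax F x ^ p ∂μ := by
    rw [hlayer, ← lintegral_const_mul' _ _ (by simp)]
    refine lintegral_mono fun x => ?_
    have := tsum_zpow_indicator_le hA hp.le (rightMax F x)
    simp only [hind] at this
    exact this
  have hbdd : ∀ x, rightMax F x ≠ ∞ := by
    intro x
    have : ¬ ENNReal.ofReal (max t₀ 0) < rightMax F x := fun h => by
      have := (lt_rightMax_iff (le_max_right _ _)).1 h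
      rw [ht₀ _ (le_max_left _ _)] at this
      exact this
    exact ((not_lt.1 this).trans_lt ENNReal.ofReal_lt_top).ne
  have hlow : ∫⁻ x, rightMax F x ^ p ∂μ ≤ ρ * ∑' k, w k * μ (Ω k) := by
    rw [hlayer, ← lintegral_const_mul' _ _ hρt]
    refine lintegral_mono fun x => ?_
    have := le_tsum_zpow_indicator hA hp.le (hbdd x)
    simp only [hind] at this
    exact this
  have hmfin : ∑' k, w k * μ (Ω k) ≠ ∞ := (hup.trans_lt (by finiteness)).ne
  have hsl : ∑' k, w k * levelSum μ q F (A ^ k) ≤ D * ∑' k, w k * μ (Ω k) :=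
    hlevel hF (hμ.exists_levelSum_le_of_lintegral_ne_top hε hK hp hpq hF hlr hFlr ht₀ hfin)
      ⟨t₀, ht₀⟩ hmfin
  -- the exceptional set of the good-lambda inequality in a component
  set E : ℤ → ℝ × ℝ → Set ℝ := fun k I => {x | x ∈ Ioo I.1 I.2 ∧ x ∈ risingSet F (A * A ^ k) ∧
    Φ (A ^ k) I.2 - Φ (A ^ k) x ≤ γ * A ^ k * (I.2 - x)} with hE
  have hEm : ∀ k I, MeasurableSet (E k I) := by
    intro k I
    refine measurableSet_Ioo.inter ((measurableSet_risingSet hF.cont _).inter ?_)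
    have := hΦc (A ^ k)
    exact (isClosed_le (f := fun x => Φ (A ^ k) I.2 - Φ (A ^ k) x)
      (g := fun x => γ * A ^ k * (I.2 - x)) (by fun_prop) (by fun_prop)).measurableSet
  have hEle : ∀ k, ∀ I : components (Ω k), μ (E k I)
      ≤ K' * ENNReal.ofReal (4 * γ) ^ ε * ∫⁻ x, hat I x ^ q ∂μ := by
    intro k I
    refine (hμ.measure_le_of_density hε hq.le I.2.1 (hEm k I) (fun x hx => hx.1)
      (volume_goodLambda_le (hpos k) hA hγ.le (hΦc _) (hΦm _) (hΦF _) I.2)).trans (le_of_eq ?_)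
    rw [hK']
    ring
  set S : ℤ → Set ℝ := fun k => Ω (k + 1) \ ⋃ I ∈ components (Ω k), E k I with hS
  have hSm : ∀ k, MeasurableSet (S k) := fun k => (hΩm _).diff
    (MeasurableSet.biUnion (components_countable _) fun I _ => hEm k I)
  have hAA : ∀ k : ℤ, A * A ^ k = A ^ (k + 1) := fun k => by
    rw [zpow_add_one₀ hA0.ne', mul_comm]
  have hSG : ∀ k, ∀ x ∈ S k, ENNReal.ofReal (A ^ k) < (ENNReal.ofReal γ)⁻¹ * G x := by
    intro k x hx
    have hx1 : x ∈ risingSet F (A ^ (k + 1)) := hx.1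
    have hxk : x ∈ risingSet F (A ^ k) :=
      risingSet_anti (zpow_le_zpow_right₀ (by linarith) (by omega)) hx1
    obtain ⟨I, hI, hxI⟩ := hF.exists_component (hpos k) hxk
    have hnot : γ * A ^ k * (I.2 - x) < Φ (A ^ k) I.2 - Φ (A ^ k) x := by
      by_contra! hcon
      refine hx.2 (mem_iUnion₂.2 ⟨I, hI, hxI, ?_, hcon⟩)
      rw [hAA]
      exact hx1
    have hxlt : 0 < I.2 - x := sub_pos.2 hxI.2
    have hGx := hG (A ^ k) (hpos k) x I.2 hxI.2 (by
      have := sub_le_of_notMem_risingSet hI.2.2.1 (y := I.2 + (I.2 - x)) (by linarith)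
      rwa [add_sub_cancel_left] at this)
    have hlt : ENNReal.ofReal γ * ENNReal.ofReal (A ^ k) < G x := by
      refine lt_of_lt_of_le ?_ hGx
      rw [← ENNReal.ofReal_mul hγ.le, ENNReal.ofReal_lt_ofReal_iff_of_nonneg
        (mul_nonneg hγ.le (hpos k).le), lt_div_iff₀ hxlt]
      exact hnot
    rw [mul_comm, ← div_eq_mul_inv,
      ENNReal.lt_div_iff_mul_lt (Or.inl hγ0) (Or.inl ENNReal.ofReal_ne_top), mul_comm]
    exact hlt
  have hSsum : ∑' k, w k * μ (S k) ≤ 2 * (ENNReal.ofReal γ)⁻¹ ^ p * ∫⁻ x, G x ^ p ∂μ := by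
    calc ∑' k, w k * μ (S k) = ∫⁻ x, ∑' k, w k * (S k).indicator 1 x ∂μ := by
          rw [lintegral_tsum fun k => ((measurable_one.indicator (hSm k)).const_mul _).aemeasurable]
          refine tsum_congr fun k => ?_
          rw [lintegral_const_mul _ (measurable_one.indicator (hSm k)),
            lintegral_indicator_one (hSm k)]
      _ ≤ ∫⁻ x, 2 * (ENNReal.ofReal γ)⁻¹ ^ p * G x ^ p ∂μ := by
          refine lintegral_mono fun x => ?_
          rw [mul_assoc, ← ENNReal.mul_rpow_of_nonneg _ _ hp0.le]
          refine le_trans (ENNReal.tsum_le_tsum fun k => ?_)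
            (tsum_zpow_indicator_le hA hp.le ((ENNReal.ofReal γ)⁻¹ * G x))
          refine mul_le_mul' le_rfl ?_
          by_cases hx : x ∈ S k
          · rw [indicator_of_mem hx, indicator_of_mem (by exact hSG k x hx)]
            exact le_rfl
          · rw [indicator_of_notMem hx]
            exact bot_le
      _ = _ := lintegral_const_mul' _ _ (by finiteness)
  have hstep : ∀ k, w (k + 1) * μ (Ω (k + 1))
      ≤ ρ * (K' * ENNReal.ofReal (4 * γ) ^ ε) * (w k * levelSum μ q F (A ^ k))
        + ρ * (w k * μ (S k)) := by
    intro k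
    have h1 : μ (Ω (k + 1)) ≤ K' * ENNReal.ofReal (4 * γ) ^ ε * levelSum μ q F (A ^ k)
        + μ (S k) := by
      calc μ (Ω (k + 1)) ≤ μ ((⋃ I ∈ components (Ω k), E k I) ∪ S k) :=
            measure_mono fun x hx => by
              by_cases h : x ∈ ⋃ I ∈ components (Ω k), E k I
              · exact Or.inl h
              · exact Or.inr ⟨hx, h⟩
        _ ≤ μ (⋃ I ∈ components (Ω k), E k I) + μ (S k) := measure_union_le _ _
        _ ≤ (∑' I : components (Ω k), μ (E k I)) + μ (S k) := by
            gcongr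
            exact measure_biUnion_le μ (components_countable _) _
        _ ≤ _ := by
            gcongr
            rw [levelSum, ← ENNReal.tsum_mul_left]
            exact ENNReal.tsum_le_tsum (hEle k)
    rw [hw1]
    calc ρ * w k * μ (Ω (k + 1))
        ≤ ρ * w k * (K' * ENNReal.ofReal (4 * γ) ^ ε * levelSum μ q F (A ^ k) + μ (S k)) := by
          gcongr
      _ = _ := by ring
  have hfinal : ∑' k, w k * μ (Ω k) ≤ 2 * (ρ * (2 * (ENNReal.ofReal γ)⁻¹ ^ p)
      * ∫⁻ x, G x ^ p ∂μ) := by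
    refine le_two_mul_of_le_half_add hmfin ?_
    calc ∑' k, w k * μ (Ω k) = ∑' k, w (k + 1) * μ (Ω (k + 1)) :=
          ((Equiv.addRight (1 : ℤ)).tsum_eq fun k => w k * μ (Ω k)).symm
      _ ≤ ρ * (K' * ENNReal.ofReal (4 * γ) ^ ε) * ∑' k, w k * levelSum μ q F (A ^ k)
          + ρ * ∑' k, w k * μ (S k) := by
          rw [← ENNReal.tsum_mul_left, ← ENNReal.tsum_mul_left, ← ENNReal.tsum_add]
          exact ENNReal.tsum_le_tsum hstep
      _ ≤ ρ * (K' * ENNReal.ofReal (4 * γ) ^ ε) * (D * ∑' k, w k * μ (Ω k))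
          + ρ * (2 * (ENNReal.ofReal γ)⁻¹ ^ p * ∫⁻ x, G x ^ p ∂μ) := by gcongr
      _ = ρ * K' * D * ENNReal.ofReal (4 * γ) ^ ε * ∑' k, w k * μ (Ω k)
          + ρ * (2 * (ENNReal.ofReal γ)⁻¹ ^ p) * ∫⁻ x, G x ^ p ∂μ := by ring
      _ ≤ 2⁻¹ * ∑' k, w k * μ (Ω k)
          + ρ * (2 * (ENNReal.ofReal γ)⁻¹ ^ p) * ∫⁻ x, G x ^ p ∂μ := by gcongr
      _ = _ := by rw [div_eq_mul_inv, mul_comm (2⁻¹ : ℝ≥0∞)]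
  calc ∫⁻ x, rightMax F x ^ p ∂μ ≤ ρ * ∑' k, w k * μ (Ω k) := hlow
    _ ≤ ρ * (2 * (ρ * (2 * (ENNReal.ofReal γ)⁻¹ ^ p) * ∫⁻ x, G x ^ p ∂μ)) := by gcongr
    _ = _ := by ring

/-! ### From weights and functions to measures and distribution functions -/

/-- The measure `w dx`. -/
noncomputable def weightMeasure (w : ℝ → ℝ) : Measure ℝ :=
  volume.withDensity fun x => ENNReal.ofReal (w x)

instance (w : ℝ → ℝ) : NullSingletonClass (weightMeasure w) :=
  nullSingletonClass_withDensity _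

theorem IsWeight.isLocallyFiniteMeasure {w : ℝ → ℝ} (hw : IsWeight w) :
    IsLocallyFiniteMeasure (weightMeasure w) where
  finiteAtNhds x := by
    obtain ⟨s, hs, hi⟩ := hw.locallyIntegrable x
    refine ⟨s, hs, ?_⟩
    rw [weightMeasure, withDensity_apply' _ s]
    exact hi.lintegral_lt_top

theorem IsWeight.lintegral_weightMeasure {w : ℝ → ℝ} (hw : IsWeight w) (g : ℝ → ℝ≥0∞) :
    ∫⁻ x, g x ∂weightMeasure w = ∫⁻ x, g x * ENNReal.ofReal (w x) := by
  rw [weightMeasure, lintegral_withDensity_eq_lintegral_mul_non_measurable₀ _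
    hw.locallyIntegrable.aestronglyMeasurable.aemeasurable.ennreal_ofReal
    (Filter.Eventually.of_forall fun x => ENNReal.ofReal_lt_top)]
  exact lintegral_congr fun x => mul_comm _ _

theorem IsWeight.weightedNorm_eq {w : ℝ → ℝ} (hw : IsWeight w) (p : ℝ) (g : ℝ → ℝ≥0∞) :
    weightedNorm p w g = (∫⁻ x, g x ^ p ∂weightMeasure w) ^ (1 / p) := by
  rw [weightedNorm, hw.lintegral_weightMeasure]

theorem weightMeasure_apply (w : ℝ → ℝ) {E : Set ℝ} (hE : MeasurableSet E) :
    weightMeasure w E = ∫⁻ x in E, ENNReal.ofReal (w x) := withDensity_apply _ hE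

theorem IsWeight.exists_tailCondition {w : ℝ → ℝ} (hw : IsWeight w) {q : ℝ} (h : CPlus q w) :
    ∃ ε > 0, ∃ K : ℝ≥0∞, K ≠ ∞ ∧ TailCondition (weightMeasure w) q ε K := by
  obtain ⟨ε, C, hε, -, h⟩ := h
  refine ⟨ε, hε, ENNReal.ofReal C, ENNReal.ofReal_ne_top, ?_⟩
  intro a b c hab hbc habc E hE hEab
  have := h a b c hab hbc habc E hE hEab
  simp only [maximal_indicator_Ioo (hab.trans hbc)] at this
  rwa [weightMeasure_apply w hE, hw.lintegral_weightMeasure]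

theorem intervalIntegrable_of_locallyIntegrable {g : ℝ → ℝ} (hg : LocallyIntegrable g)
    (x y : ℝ) : IntervalIntegrable g volume x y :=
  (hg.integrableOn_isCompact isCompact_uIcc).intervalIntegrable

theorem locallyIntegrable_excess {f : ℝ → ℝ} (hf : LocallyIntegrable f) (t : ℝ) :
    LocallyIntegrable fun z => max (f z - t) 0 := fun x => by
  obtain ⟨s, hs, hi⟩ := (hf.sub (locallyIntegrable_const t)) x
  exact ⟨s, hs, hi.pos_part⟩

theorem setLIntegral_Ioc_ofReal {g : ℝ → ℝ} (hg : LocallyIntegrable g) (h0 : ∀ x, 0 ≤ g x)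
    {x y : ℝ} (hxy : x ≤ y) :
    ∫⁻ z in Ioc x y, ENNReal.ofReal (g z) = ENNReal.ofReal (∫ z in x..y, g z) := by
  rw [intervalIntegral.integral_of_le hxy, ofReal_integral_eq_lintegral_ofReal]
  · exact (hg.integrableOn_isCompact isCompact_Icc).mono_set Ioc_subset_Icc_self
  · exact Filter.Eventually.of_forall h0

theorem integral_sub_integral {g : ℝ → ℝ} (hg : LocallyIntegrable g) (l x y : ℝ) :
    (∫ z in l..y, g z) - ∫ z in l..x, g z = ∫ z in x..y, g z :=
  intervalIntegral.integral_interval_sub_left (intervalIntegrable_of_locallyIntegrable hg _ _)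
    (intervalIntegrable_of_locallyIntegrable hg _ _)

theorem monotone_integral {g : ℝ → ℝ} (hg : LocallyIntegrable g) (h0 : ∀ x, 0 ≤ g x) (l : ℝ) :
    Monotone fun x => ∫ z in l..x, g z := by
  intro x y hxy
  have := intervalIntegral.integral_nonneg (μ := volume) hxy fun z _ => h0 z
  rw [← integral_sub_integral hg l] at this
  simpa using this

theorem isCDF_integral {f : ℝ → ℝ} (hf : LocallyIntegrable f) (h0 : ∀ x, 0 ≤ f x) {l r : ℝ}
    (hl : ∀ x ≤ l, f x = 0) (hr : ∀ x, r ≤ x → f x = 0) :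
    IsCDF (fun x => ∫ z in l..x, f z) l r where
  cont := intervalIntegral.continuous_primitive (intervalIntegrable_of_locallyIntegrable hf) l
  mono := monotone_integral hf h0 l
  left := fun x hx => by
    rw [← sub_eq_zero, integral_sub_integral hf, intervalIntegral.integral_symm,
      intervalIntegral.integral_of_le hx, setIntegral_eq_zero_of_forall_eq_zero, neg_zero]
    exact fun z hz => hl z hz.2
  right := fun x hx => by
    rw [← sub_eq_zero, integral_sub_integral hf,
      intervalIntegral.integral_of_le hx, setIntegral_eq_zero_of_forall_eq_zero]
    exact fun z hz => hr z hz.1.le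

theorem maximal_eq_rightMax {f : ℝ → ℝ} (hf : LocallyIntegrable f) (h0 : ∀ x, 0 ≤ f x) (l x : ℝ) :
    maximal f x = rightMax (fun x => ∫ z in l..x, f z) x := by
  unfold maximal rightMax
  refine iSup_congr fun h => iSup_congr fun hh => ?_
  rw [integral_sub_integral hf, ENNReal.ofReal_div_of_pos hh,
    ← setLIntegral_Ioc_ofReal hf h0 (by linarith)]
  simp only [Real.enorm_of_nonneg (h0 _)]

/-- The average over `(x, y)` of the excess of `f` over `t` is at most `M^{♯,+} f (x)`, provided
that the average of `f` over the next interval of the same length is at most `t`. -/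
theorem ofReal_excess_le_sharpMaximal {f : ℝ → ℝ} (hf : LocallyIntegrable f) {t l x y : ℝ}
    (hxy : x < y) (hnext : ∫ z in y..(y + (y - x)), f z ≤ t * (y - x)) :
    ENNReal.ofReal (((∫ z in l..y, max (f z - t) 0) - ∫ z in l..x, max (f z - t) 0) / (y - x))
      ≤ sharpMaximal f x := by
  have hyx : 0 < y - x := sub_pos.2 hxy
  have hg := locallyIntegrable_excess hf t
  refine le_iSup₂_of_le (y - x) hyx ?_
  rw [integral_sub_integral hg, ENNReal.ofReal_div_of_pos hyx,
    ← setLIntegral_Ioc_ofReal hg (fun _ => le_max_right _ _) hxy.le, add_sub_cancel,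
    show x + 2 * (y - x) = y + (y - x) by ring]
  refine ENNReal.div_le_div_right (lintegral_mono fun z => ?_) _
  rw [ ENNReal.ofReal_max, ENNReal.ofReal_zero]
  refine max_le ?_ (by simp)
  refine ENNReal.ofReal_le_ofReal (sub_le_sub_left ?_ _)
  rw [one_div_mul_eq_div, div_le_iff₀ hyx]
  exact hnext

/-- Part (i): the `C_q⁺` condition implies the sharp maximal estimate in `L^p`, `p < q`. -/
theorem CPlus.sharpEstimate {p q : ℝ} {w : ℝ → ℝ} (hp : 1 < p) (hpq : p < q) (hw : IsWeight w)
    (h : CPlus q w) : SharpEstimate p w := by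
  obtain ⟨ε, hε, K, hK, hμ⟩ := hw.exists_tailCondition h
  have := hw.isLocallyFiniteMeasure
  obtain ⟨C, hC, hmain⟩ := hμ.exists_lintegral_rightMax_le hε hK hp hpq
  have hp0 : 0 < p := by linarith
  have hCp : C ^ (1 / p) ≠ ∞ := by finiteness
  refine ⟨(C ^ (1 / p)).toNNReal, fun f hf0 hfb hfc hfin => ?_⟩
  rw [ENNReal.coe_toNNReal hCp, hw.weightedNorm_eq, hw.weightedNorm_eq,
    ← ENNReal.mul_rpow_of_nonneg _ _ (by positivity)]
  refine ENNReal.rpow_le_rpow ?_ (by positivity)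
  rw [hw.weightedNorm_eq] at hfin
  have hfin' : ∫⁻ x, maximal f x ^ p ∂weightMeasure w ≠ ∞ := by
    intro htop
    rw [htop, ENNReal.top_rpow_of_pos (by positivity)] at hfin
    exact hfin.false
  have hf : LocallyIntegrable f := hfb.locallyIntegrable (by simp)
  obtain ⟨R, hR, hsupp⟩ : ∃ R : ℝ, 0 < R ∧ ∀ x, x ≤ -R ∨ R ≤ x → f x = 0 := by
    obtain ⟨R, hR⟩ := hfc.isCompact.isBounded.subset_closedBall 0
    refine ⟨max R 0 + 1, by positivity, fun x hx => ?_⟩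
    by_contra hne
    have := hR (subset_tsupport f hne)
    rw [mem_closedBall_zero_iff, Real.norm_eq_abs, abs_le] at this
    rcases hx with hx | hx <;> linarith [le_max_left R 0]
  obtain ⟨B, hB⟩ : ∃ B : ℝ, ∀ᵐ x, f x ≤ B := by
    refine ⟨(eLpNorm f ∞ volume).toReal, ?_⟩
    have h1 := ae_le_eLpNormEssSup (f := f) (μ := (volume : Measure ℝ))
    filter_upwards [h1] with x hx
    rw [← eLpNorm_exponent_top] at hx
    have := ENNReal.toReal_mono hfb.eLpNorm_ne_top hx
    rw [toReal_enorm, Real.norm_of_nonneg (hf0 x)] at this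
    exact this
  set F : ℝ → ℝ := fun x => ∫ z in (-R)..x, f z with hF
  have hcdf : IsCDF F (-R) R := isCDF_integral hf hf0 (fun x hx => hsupp x (Or.inl hx))
    (fun x hx => hsupp x (Or.inr hx))
  have hmax : ∀ x, maximal f x = rightMax F x := maximal_eq_rightMax hf hf0 (-R)
  simp only [hmax] at hfin' ⊢
  rcases (hcdf.mono (by linarith : -R ≤ R)).eq_or_lt with heq | hlt
  · have hzero : ∀ x, rightMax F x = 0 := by
      intro x
      rw [← nonpos_iff_eq_zero]
      refine iSup₂_le fun h hh => ?_
      rw [ENNReal.ofReal_of_nonpos]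
      have := hcdf.sub_le x (x + h)
      exact div_nonpos_of_nonpos_of_nonneg (by linarith) hh.le
    simp [hzero, ENNReal.zero_rpow_of_pos hp0]
  refine hmain hcdf (by linarith) hlt ⟨B, fun t ht => ?_⟩ hfin'
    (fun t x => ∫ z in (-R)..x, max (f z - t) 0) (sharpMaximal f) ?_ ?_ ?_ ?_
  · refine eq_empty_of_forall_notMem fun x ⟨y, hxy, hlt⟩ => hlt.not_ge ?_
    rw [integral_sub_integral hf]
    calc ∫ z in x..y, f z ≤ ∫ _z in x..y, B :=
          intervalIntegral.integral_mono_ae hxy.le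
            (intervalIntegrable_of_locallyIntegrable hf _ _) (by simp) hB
      _ = B * (y - x) := by simp [mul_comm]
      _ ≤ t * (y - x) := mul_le_mul_of_nonneg_right ht (by linarith)
  all_goals have hg := locallyIntegrable_excess hf
  · exact fun t => intervalIntegral.continuous_primitive
      (intervalIntegrable_of_locallyIntegrable (hg t)) _
  · exact fun t => monotone_integral (hg t) (fun _ => le_max_right _ _) _
  · intro t x y hxy
    rw [integral_sub_integral hf, integral_sub_integral (hg t)]
    have h1 : t * (y - x) = ∫ _z in x..y, t := by simp [mul_comm]
    rw [h1, ← intervalIntegral.integral_sub (intervalIntegrable_of_locallyIntegrable hf _ _)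
      (by simp)]
    exact intervalIntegral.integral_mono hxy
      (intervalIntegrable_of_locallyIntegrable (hf.sub (locallyIntegrable_const t)) _ _)
      (intervalIntegrable_of_locallyIntegrable (hg t) _ _)
      fun z => le_max_left _ _
  · intro t ht x y hxy hnext
    rw [integral_sub_integral hf] at hnext
    exact ofReal_excess_le_sharpMaximal hf hxy hnext

/-! ### The left maximal function and its small powers -/

/-- The analogue of `risingSet` for averages over intervals to the left. -/
def leftRisingSet (H : ℝ → ℝ) (t : ℝ) : Set ℝ := {x | ∃ y, y < x ∧ t * (x - y) < H x - H y}

theorem IsCDF.volume_leftRisingSet_le {H : ℝ → ℝ} {l r : ℝ} (hH : IsCDF H l r) {t : ℝ}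
    (ht : 0 < t) : volume (leftRisingSet H t) ≤ ENNReal.ofReal ((H r - H l) / t) := by
  have hG : IsCDF (fun x => -H (-x)) (-r) (-l) :=
    { cont := by have := hH.cont; fun_prop
      mono := fun x y hxy => neg_le_neg (hH.mono (neg_le_neg hxy))
      left := fun x hx => by rw [hH.right (-x) (by linarith), neg_neg]
      right := fun x hx => by rw [hH.left (-x) (by linarith), neg_neg] }
  have hset : leftRisingSet H t = (fun x => -x) ⁻¹' risingSet (fun x => -H (-x)) t := by
    ext x
    simp only [leftRisingSet, risingSet, mem_preimage, mem_ofPred_eq, neg_neg]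
    constructor
    · rintro ⟨y, hy, h⟩
      refine ⟨-y, by linarith, ?_⟩
      rw [neg_neg]
      linarith
    · rintro ⟨y, hy, h⟩
      exact ⟨-y, by linarith, by linarith⟩
  rw [hset, Measure.measure_preimage_neg]
  refine (hG.volume_risingSet_le ht).trans (le_of_eq ?_)
  simp only [neg_neg]
  ring_nf

/-- The left maximal function of the measure `dH`. It is used for distribution functions `H` of
density at most `1`, for which the supremum is at most `1`. -/
noncomputable def leftMax (H : ℝ → ℝ) (x : ℝ) : ℝ := ⨆ y : Iio x, (H x - H y) / (x - y)

theorem bddAbove_leftMax {H : ℝ → ℝ} (hL : ∀ x y, x ≤ y → H y - H x ≤ y - x) (x : ℝ) :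
    BddAbove (range fun y : Iio x => (H x - H y) / (x - y)) := by
  refine ⟨1, ?_⟩
  rintro _ ⟨y, rfl⟩
  have hy : (y : ℝ) < x := y.2
  exact (div_le_one (sub_pos.2 hy)).2 (hL y x hy.le)

theorem leftMax_le_one {H : ℝ → ℝ} (hL : ∀ x y, x ≤ y → H y - H x ≤ y - x) (x : ℝ) :
    leftMax H x ≤ 1 :=
  ciSup_le fun y => by
    have hy : (y : ℝ) < x := y.2
    exact (div_le_one (sub_pos.2 hy)).2 (hL y x hy.le)

theorem le_leftMax {H : ℝ → ℝ} (hL : ∀ x y, x ≤ y → H y - H x ≤ y - x) {x y : ℝ} (h : y < x) :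
    (H x - H y) / (x - y) ≤ leftMax H x :=
  le_ciSup (bddAbove_leftMax hL x) (⟨y, h⟩ : Iio x)

theorem lt_leftMax_iff {H : ℝ → ℝ} (hL : ∀ x y, x ≤ y → H y - H x ≤ y - x) {t x : ℝ} :
    t < leftMax H x ↔ x ∈ leftRisingSet H t := by
  rw [leftMax, lt_ciSup_iff (bddAbove_leftMax hL x)]
  simp only [leftRisingSet, mem_ofPred_eq, Subtype.exists, mem_Iio, exists_prop]
  refine exists_congr fun y => and_congr_right fun hy => ?_
  rw [lt_div_iff₀ (sub_pos.2 hy)]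

theorem measurable_leftMax {H : ℝ → ℝ} (hc : Continuous H)
    (hL : ∀ x y, x ≤ y → H y - H x ≤ y - x) : Measurable (leftMax H) := by
  refine measurable_of_Ioi fun t => ?_
  have : leftMax H ⁻¹' Ioi t = ⋃ y, {x | y < x ∧ t * (x - y) < H x - H y} := by
    ext x
    rw [mem_preimage, mem_Ioi, lt_leftMax_iff hL]
    simp [leftRisingSet]
  rw [this]
  refine (isOpen_iUnion fun y => ?_).measurableSet
  exact (isOpen_lt continuous_const continuous_id).inter
    (isOpen_lt (f := fun x => t * (x - y)) (g := fun x => H x - H y) (by fun_prop) (by fun_prop))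

/-- Integration of a small power of a function in weak `L¹`; the point is the factor `δ`. -/
theorem lintegral_rpow_sub_one_le (ν : Measure ℝ) {v : ℝ → ℝ} (hv : Measurable v) {δ : ℝ}
    (hδ : 0 < δ) (hδ2 : δ ≤ 1 / 2) {L : ℝ} (hL : 0 ≤ L)
    (h : ∀ s, 1 ≤ s → ν {x | s < v x} ≤ ENNReal.ofReal (L / s)) :
    ∫⁻ x, ENNReal.ofReal (max 1 (v x) ^ δ - 1) ∂ν ≤ ENNReal.ofReal (2 * δ * L) := by
  have hint : ∀ c : ℝ, 0 ≤ c → ∫ t in (0 : ℝ)..c, δ * (1 + t) ^ (δ - 1) = (1 + c) ^ δ - 1 := by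
    intro c hc
    rw [intervalIntegral.integral_const_mul,
      intervalIntegral.integral_comp_add_left (fun t => t ^ (δ - 1)) 1,
      integral_rpow (Or.inl (by linarith))]
    simp only [add_zero, sub_add_cancel, Real.one_rpow]
    field_simp
  have hpos : ∀ x, 0 ≤ max 1 (v x) - 1 := fun x => by linarith [le_max_left 1 (v x)]
  have h1 : ∀ x, ENNReal.ofReal (max 1 (v x) ^ δ - 1)
      = ENNReal.ofReal (∫ t in (0 : ℝ)..(max 1 (v x) - 1), δ * (1 + t) ^ (δ - 1)) := by
    intro x
    rw [hint _ (hpos x), add_sub_cancel]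
  simp_rw [h1]
  rw [lintegral_comp_eq_lintegral_meas_lt_mul ν (f := fun x => max 1 (v x) - 1)
    (g := fun t => δ * (1 + t) ^ (δ - 1)) (Filter.Eventually.of_forall hpos)
    (by fun_prop)]
  · calc ∫⁻ t in Ioi (0 : ℝ), ν {a | t < max 1 (v a) - 1} * ENNReal.ofReal (δ * (1 + t) ^ (δ - 1))
        ≤ ∫⁻ t in Ioi (0 : ℝ), (fun u => ENNReal.ofReal (L * δ * u ^ (δ - 2))) (t + 1) := by
          refine setLIntegral_mono' measurableSet_Ioi fun t ht => ?_
          simp only [mem_Ioi] at ht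
          have ht1 : 0 < 1 + t := by linarith
          have hset : {a | t < max 1 (v a) - 1} ⊆ {a | 1 + t < v a} := by
            intro a ha
            simp only [mem_ofPred_eq] at ha ⊢
            rcases lt_max_iff.1 (by linarith : 1 + t < max 1 (v a)) with h | h
            · linarith
            · exact h
          calc _ ≤ ENNReal.ofReal (L / (1 + t)) * ENNReal.ofReal (δ * (1 + t) ^ (δ - 1)) := by
                gcongr
                exact (measure_mono hset).trans (h (1 + t) (by linarith))
            _ = _ := by
                rw [← ENNReal.ofReal_mul (by positivity)]
                congr 1
                rw [add_comm t 1, show δ - 1 = (δ - 2) + 1 by ring, Real.rpow_add_one ht1.ne']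
                field_simp
      _ = ∫⁻ u in Ioi (1 : ℝ), ENNReal.ofReal (L * δ * u ^ (δ - 2)) := by
          have hpre : Ioi (0 : ℝ) = (fun t => t + 1) ⁻¹' Ioi 1 := by ext t; simp
          rw [hpre, (measurePreserving_add_right volume (1 : ℝ)).setLIntegral_comp_preimage
            measurableSet_Ioi (f := fun u => ENNReal.ofReal (L * δ * u ^ (δ - 2))) (by fun_prop)]
      _ = ENNReal.ofReal (L * δ * (1 / (1 - δ))) := by
          rw [← ofReal_integral_eq_lintegral_ofReal, integral_const_mul,
            integral_Ioi_rpow_of_lt (by linarith) zero_lt_one]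
          · congr 2
            rw [Real.one_rpow, show δ - 2 + 1 = -(1 - δ) by ring, neg_div_neg_eq]
          · exact (integrableOn_Ioi_rpow_of_lt (by linarith) zero_lt_one).const_mul _
          · filter_upwards [self_mem_ae_restrict measurableSet_Ioi] with u hu
            have : 0 < u := zero_lt_one.trans hu
            exact mul_nonneg (by positivity) (by positivity)
      _ ≤ _ := by
          refine ENNReal.ofReal_le_ofReal ?_
          have h2 : 1 / (1 - δ) ≤ 2 := by
            rw [div_le_iff₀ (by linarith)]
            linarith
          calc L * δ * (1 / (1 - δ)) ≤ L * δ * 2 := by gcongr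
            _ = _ := by ring
  · intro t ht
    refine ContinuousOn.intervalIntegrable ?_
    refine continuousOn_const.mul (ContinuousOn.rpow_const (by fun_prop) fun x hx => Or.inl ?_)
    rw [uIcc_of_le (le_of_lt ht)] at hx
    linarith [hx.1]
  · filter_upwards [self_mem_ae_restrict measurableSet_Ioi] with t ht
    have : 0 < t := ht
    positivity

/-- The left maximal function at height at least `lam`, in units of `lam`. -/
noncomputable def level (H : ℝ → ℝ) (lam : ℝ) (x : ℝ) : ℝ := max 1 (leftMax H x / lam)

theorem measurable_level {H : ℝ → ℝ} (hc : Continuous H)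
    (hL : ∀ x y, x ≤ y → H y - H x ≤ y - x) (lam : ℝ) : Measurable (level H lam) := by
  have := measurable_leftMax hc hL
  unfold level
  fun_prop

theorem level_lt_iff {H : ℝ → ℝ} (hL : ∀ x y, x ≤ y → H y - H x ≤ y - x) {lam : ℝ}
    (hlam : 0 < lam) {s x : ℝ} (hs : 1 ≤ s) :
    s < level H lam x ↔ x ∈ leftRisingSet H (s * lam) := by
  rw [level, lt_max_iff, or_iff_right hs.not_gt, lt_div_iff₀ hlam, lt_leftMax_iff hL]

theorem le_level {H : ℝ → ℝ} (hL : ∀ x y, x ≤ y → H y - H x ≤ y - x) {lam : ℝ}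
    (hlam : 0 < lam) {x y : ℝ} (h : y < x) : (H x - H y) / (x - y) / lam ≤ level H lam x :=
  le_max_of_le_right (div_le_div_of_nonneg_right (le_leftMax hL h) hlam.le)

/-- Weak type estimate for the left maximal function on `(x, x + h]`, relative to its infimum `κ`
over the next interval `(x + h, x + 2h]`: averages over long intervals are comparable to `κ`,
and those over short ones only see the mass of `dH` on `[x - h, x + h]`, which `κ` controls. -/
theorem volume_level_le {H : ℝ → ℝ} (hc : Continuous H) (hm : Monotone H)
    (hL : ∀ x y, x ≤ y → H y - H x ≤ y - x) {lam : ℝ} (hlam : 0 < lam) {x h κ : ℝ} (hh : 0 < h)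
    (hκ1 : 1 ≤ κ) (hκ : ∀ β, (∀ z ∈ Ioc (x + h) (x + 2 * h), β ≤ level H lam z) → β ≤ κ)
    {s : ℝ} (hs : 1 ≤ s) :
    volume ({y | s * κ < level H lam y} ∩ Ioc x (x + h)) ≤ ENNReal.ofReal (3 * h / s) := by
  rcases le_or_gt s 3 with hs3 | hs3
  · refine (measure_mono inter_subset_right).trans ?_
    rw [Real.volume_Ioc]
    refine ENNReal.ofReal_le_ofReal ?_
    rw [le_div_iff₀ (by linarith)]
    nlinarith
  have hκ0 : 0 < κ := by linarith
  have hsκ : 1 ≤ s * κ := by nlinarith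
  set Ψ : ℝ → ℝ := fun y => H (max (x - h) (min y (x + h))) with hΨ
  have hΨc : IsCDF Ψ (x - h) (x + h) := isCDF_clamp hc hm (by linarith)
  have hΨe : ∀ y, x - h ≤ y → y ≤ x + h → Ψ y = H y := fun y h1 h2 => by
    simp only [hΨ]; rw [min_eq_left h2, max_eq_right h1]
  have hmass : (H (x + h) - H (x - h)) / (3 * h) / lam ≤ κ := by
    refine hκ _ fun z hz => le_trans ?_ (le_level hL hlam (y := x - h) (by linarith [hz.1]))
    refine div_le_div_of_nonneg_right ?_ hlam.le
    have h1 : H (x + h) ≤ H z := hm hz.1.le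
    have h2 : 0 ≤ H (x + h) - H (x - h) := sub_nonneg.2 (hm (by linarith))
    exact div_le_div₀ (by linarith) (by linarith) (by linarith [hz.1]) (by linarith [hz.2])
  have hsub : {y | s * κ < level H lam y} ∩ Ioc x (x + h) ⊆ leftRisingSet Ψ (s * κ * lam) := by
    rintro y ⟨hy, hyx⟩
    obtain ⟨y', hy', hlt⟩ := (level_lt_iff hL hlam hsκ).1 hy
    rcases le_or_gt (y - y') h with hle | hgt
    · refine ⟨y', hy', ?_⟩
      rwa [hΨe y (by linarith [hyx.1]) hyx.2, hΨe y' (by linarith [hyx.1]) (by linarith [hyx.2])]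
    · exfalso
      have : s * κ / 3 ≤ κ := by
        refine hκ _ fun z hz => le_trans ?_ (le_level hL hlam (y := y') (by linarith [hz.1, hyx.2]))
        have hzy : z - y' ≤ 3 * (y - y') := by linarith [hz.2, hyx.1]
        have hz' : 0 < z - y' := by linarith [hz.1, hyx.2]
        rw [le_div_iff₀ hlam, le_div_iff₀ hz']
        have h1 : H y ≤ H z := hm (by linarith [hz.1, hyx.2])
        have h2 : 0 < s * κ * lam := by positivity
        nlinarith
      nlinarith
  calc _ ≤ volume (leftRisingSet Ψ (s * κ * lam)) := measure_mono hsub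
    _ ≤ ENNReal.ofReal ((Ψ (x + h) - Ψ (x - h)) / (s * κ * lam)) :=
        hΨc.volume_leftRisingSet_le (by positivity)
    _ ≤ _ := by
        refine ENNReal.ofReal_le_ofReal ?_
        rw [hΨe _ (by linarith) le_rfl, hΨe _ le_rfl (by linarith)]
        rw [div_div, div_le_iff₀ (by positivity)] at hmass
        rw [div_le_div_iff₀ (by positivity) (by linarith)]
        nlinarith

/-- The test function of the necessity part: a small power of the left maximal function at
height at least `lam`, minus `1`. -/
noncomputable def testFun (H : ℝ → ℝ) (lam δ : ℝ) (x : ℝ) : ℝ := level H lam x ^ δ - 1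

theorem one_le_level (H : ℝ → ℝ) (lam x : ℝ) : 1 ≤ level H lam x := le_max_left _ _

theorem testFun_nonneg (H : ℝ → ℝ) (lam : ℝ) {δ : ℝ} (hδ : 0 ≤ δ) (x : ℝ) :
    0 ≤ testFun H lam δ x := sub_nonneg.2 (Real.one_le_rpow (one_le_level H lam x) hδ)

theorem measurable_testFun {H : ℝ → ℝ} (hc : Continuous H)
    (hL : ∀ x y, x ≤ y → H y - H x ≤ y - x) (lam δ : ℝ) : Measurable (testFun H lam δ) := by
  have := measurable_level hc hL lam
  unfold testFun
  fun_prop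

theorem testFun_le {H : ℝ → ℝ} (hL : ∀ x y, x ≤ y → H y - H x ≤ y - x) {lam δ : ℝ}
    (hlam : 0 < lam) (hδ : 0 ≤ δ) (x : ℝ) : testFun H lam δ x ≤ max 1 (1 / lam) ^ δ := by
  have h1 : level H lam x ≤ max 1 (1 / lam) :=
    max_le_max le_rfl (div_le_div_of_nonneg_right (leftMax_le_one hL x) hlam.le)
  have h2 := Real.rpow_le_rpow (by linarith [one_le_level H lam x]) h1 hδ
  unfold testFun
  linarith

/-- A positive oscillation of the test function is at most a multiple of `δ` times one plus its
average over the following interval. -/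
theorem lintegral_testFun_sub_le {H : ℝ → ℝ} (hc : Continuous H) (hm : Monotone H)
    (hL : ∀ x y, x ≤ y → H y - H x ≤ y - x) {lam δ : ℝ} (hlam : 0 < lam) (hδ : 0 < δ)
    (hδ2 : δ ≤ 1 / 2) (hloc : LocallyIntegrable (testFun H lam δ)) {x h : ℝ} (hh : 0 < h) :
    ∫⁻ y in Ioc x (x + h), ENNReal.ofReal (testFun H lam δ y
        - (1 / h) * ∫ z in (x + h)..(x + 2 * h), testFun H lam δ z)
      ≤ ENNReal.ofReal (6 * δ * h)
        * (1 + ENNReal.ofReal ((1 / h) * ∫ z in (x + h)..(x + 2 * h), testFun H lam δ z)) := by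
  set m := (1 / h) * ∫ z in (x + h)..(x + 2 * h), testFun H lam δ z with hmdef
  set κ := sInf (level H lam '' Ioc (x + h) (x + 2 * h)) with hκdef
  have hne : (level H lam '' Ioc (x + h) (x + 2 * h)).Nonempty :=
    (nonempty_Ioc.2 (by linarith)).image _
  have hbdd : BddBelow (level H lam '' Ioc (x + h) (x + 2 * h)) :=
    ⟨1, by rintro _ ⟨z, -, rfl⟩; exact one_le_level H lam z⟩
  have hκ1 : 1 ≤ κ := le_csInf hne (by rintro _ ⟨z, -, rfl⟩; exact one_le_level H lam z)
  have hκ0 : 0 < κ := by linarith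
  have hκle : ∀ z ∈ Ioc (x + h) (x + 2 * h), κ ≤ level H lam z := fun z hz =>
    csInf_le hbdd ⟨z, hz, rfl⟩
  have hκ : ∀ β, (∀ z ∈ Ioc (x + h) (x + 2 * h), β ≤ level H lam z) → β ≤ κ := fun β hβ =>
    le_csInf hne (by rintro _ ⟨z, hz, rfl⟩; exact hβ z hz)
  have hκm : κ ^ δ ≤ 1 + m := by
    have h1 : ∫ z in (x + h)..(x + 2 * h), (κ ^ δ - 1)
        ≤ ∫ z in (x + h)..(x + 2 * h), testFun H lam δ z := by
      rw [intervalIntegral.integral_of_le (by linarith),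
        intervalIntegral.integral_of_le (by linarith)]
      refine setIntegral_mono_on (by simp)
        ((intervalIntegrable_of_locallyIntegrable hloc _ _).1) measurableSet_Ioc fun z hz => ?_
      have := Real.rpow_le_rpow hκ0.le (hκle z hz) hδ.le
      unfold testFun
      linarith
    have h2 : ∫ z in (x + h)..(x + 2 * h), (κ ^ δ - 1) = h * (κ ^ δ - 1) := by
      rw [intervalIntegral.integral_const, smul_eq_mul]
      ring
    rw [h2] at h1
    have h3 : κ ^ δ - 1 ≤ m := by
      rw [hmdef, one_div_mul_eq_div, le_div_iff₀ hh]
      linarith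
    linarith
  have hκδ : 0 < κ ^ δ := Real.rpow_pos_of_pos hκ0 δ
  have hlm := measurable_level hc hL lam
  have hpt : ∀ y, ENNReal.ofReal (testFun H lam δ y - m)
      ≤ ENNReal.ofReal (κ ^ δ) * ENNReal.ofReal (max 1 (level H lam y / κ) ^ δ - 1) := by
    intro y
    rw [← ENNReal.ofReal_mul hκδ.le]
    refine ENNReal.ofReal_le_ofReal ?_
    have h1 : level H lam y ^ δ ≤ κ ^ δ * max 1 (level H lam y / κ) ^ δ := by
      rw [← Real.mul_rpow hκ0.le (by positivity)]
      refine Real.rpow_le_rpow (by linarith [one_le_level H lam y]) ?_ hδ.le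
      calc level H lam y = κ * (level H lam y / κ) := by field_simp
        _ ≤ _ := by
            gcongr
            exact le_max_right _ _
    unfold testFun
    linarith
  have hweak := lintegral_rpow_sub_one_le (volume.restrict (Ioc x (x + h)))
    (v := fun y => level H lam y / κ) (by fun_prop) hδ hδ2 (L := 3 * h) (by positivity)
    (fun s hs => by
      rw [Measure.restrict_apply (measurableSet_lt measurable_const (by fun_prop))]
      simp only [lt_div_iff₀ hκ0]
      exact volume_level_le hc hm hL hlam hh hκ1 hκ hs)
  calc _ ≤ ∫⁻ y in Ioc x (x + h), ENNReal.ofReal (κ ^ δ)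
          * ENNReal.ofReal (max 1 (level H lam y / κ) ^ δ - 1) := lintegral_mono hpt
    _ = ENNReal.ofReal (κ ^ δ) * ∫⁻ y in Ioc x (x + h),
          ENNReal.ofReal (max 1 (level H lam y / κ) ^ δ - 1) :=
        lintegral_const_mul' _ _ ENNReal.ofReal_ne_top
    _ ≤ ENNReal.ofReal (1 + m) * ENNReal.ofReal (2 * δ * (3 * h)) := by gcongr
    _ ≤ (1 + ENNReal.ofReal m) * ENNReal.ofReal (2 * δ * (3 * h)) := by
        gcongr
        exact (ENNReal.ofReal_add_le).trans (by simp)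
    _ = _ := by
        rw [mul_comm, show 2 * δ * (3 * h) = 6 * δ * h by ring]

/-! ### Necessity of the one-sided `C_p` condition -/

theorem testFun_eq_zero {H : ℝ → ℝ} {lam δ x : ℝ} (hlam : 0 < lam) (h : leftMax H x ≤ lam) :
    testFun H lam δ x = 0 := by
  have : leftMax H x / lam ≤ 1 := (div_le_one hlam).2 h
  simp [testFun, level, this]

section

variable {H : ℝ → ℝ} {a b c lam δ : ℝ}

theorem testFun_eq_zero_of_le (hH : IsCDF H a b) (hlam : 0 < lam) {x : ℝ} (hx : x ≤ a) :
    testFun H lam δ x = 0 := by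
  refine testFun_eq_zero hlam (le_trans (ciSup_le fun y => ?_) hlam.le)
  have hy : (y : ℝ) < x := y.2
  rw [hH.left x hx, hH.left y (hy.le.trans hx), sub_self, zero_div]

/-- The height `lam = |U| / (c - b)` is the one for which the test function vanishes beyond `c`. -/
theorem testFun_eq_zero_of_ge (hH : IsCDF H a b) (hlam : 0 < lam)
    (hmass : H b - H a = lam * (c - b)) {x : ℝ} (hx : c ≤ x) :
    testFun H lam δ x = 0 := by
  refine testFun_eq_zero hlam (ciSup_le fun y => ?_)
  have hy : (y : ℝ) < x := y.2
  rw [div_le_iff₀ (sub_pos.2 hy)]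
  rcases le_total b y with h | h
  · rw [hH.right x (h.trans hy.le), hH.right y h, sub_self]
    exact mul_nonneg hlam.le (by linarith)
  · refine (hH.sub_le y x).trans ?_
    rw [hmass]
    gcongr

theorem locallyIntegrable_testFun (hc : Continuous H)
    (hL : ∀ x y, x ≤ y → H y - H x ≤ y - x) (hlam : 0 < lam) (hδ : 0 ≤ δ) :
    LocallyIntegrable (testFun H lam δ) := by
  refine (locallyIntegrable_const (max 1 (1 / lam) ^ δ)).mono
    (measurable_testFun hc hL lam δ).aestronglyMeasurable (Filter.Eventually.of_forall fun x => ?_)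
  rw [Real.norm_of_nonneg (testFun_nonneg H lam hδ x)]
  exact (testFun_le hL hlam hδ x).trans (le_abs_self _)

theorem lintegral_testFun_le (hH : IsCDF H a b)
    (hL : ∀ x y, x ≤ y → H y - H x ≤ y - x) (hlam : 0 < lam)
    (hmass : H b - H a = lam * (c - b)) (hbc : b < c) (hδ : 0 < δ) (hδ2 : δ ≤ 1 / 2) :
    ∫⁻ x, ENNReal.ofReal (testFun H lam δ x) ≤ ENNReal.ofReal (2 * δ * (c - b)) := by
  have := lintegral_rpow_sub_one_le volume (measurable_level hH.cont hL lam) hδ hδ2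
    (L := c - b) (by linarith) fun s hs => by
      have hset : {x | s < level H lam x} = leftRisingSet H (s * lam) := by
        ext x
        exact level_lt_iff hL hlam hs
      rw [hset]
      refine (hH.volume_leftRisingSet_le (by positivity)).trans (le_of_eq ?_)
      rw [hmass]
      congr 1
      field_simp
  simpa only [testFun, max_eq_right (one_le_level H lam _)] using this

/-- The pointwise estimate behind the necessity: the sharp maximal function of the test function is
dominated, with the small factor `δ`, by its maximal function and by `M⁺ χ_(a,c)`. -/
theorem sharpMaximal_testFun_le (hH : IsCDF H a b)
    (hL : ∀ x y, x ≤ y → H y - H x ≤ y - x) (hlam : 0 < lam)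
    (hmass : H b - H a = lam * (c - b)) (hab : a < b) (hbc : b < c) (hδ : 0 < δ)
    (hδ2 : δ ≤ 1 / 2) (x : ℝ) :
    sharpMaximal (testFun H lam δ) x
      ≤ ENNReal.ofReal (12 * δ) * (hat (a, c) x + maximal (testFun H lam δ) x) := by
  have hac : a < c := hab.trans hbc
  set f := testFun H lam δ with hf
  have hloc : LocallyIntegrable f := locallyIntegrable_testFun hH.cont hL hlam hδ.le
  have hf0 : ∀ x, 0 ≤ f x := testFun_nonneg H lam hδ.le
  refine iSup₂_le fun h hh => ?_
  have hh0 : ENNReal.ofReal h ≠ 0 := by simpa using hh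
  set m := (1 / h) * ∫ z in (x + h)..(x + 2 * h), f z with hm
  have hm0 : 0 ≤ m := mul_nonneg (by positivity)
    (intervalIntegral.integral_nonneg (by linarith) fun z _ => hf0 z)
  have hle : ∀ y, ENNReal.ofReal (f y - m) ≤ ENNReal.ofReal (f y) := fun y =>
    ENNReal.ofReal_le_ofReal (by linarith)
  have hzero : (∀ y ∈ Ioc x (x + h), f y = 0) →
      (∫⁻ y in Ioc x (x + h), ENNReal.ofReal (f y - m)) / ENNReal.ofReal h = 0 := by
    intro h0
    rw [setLIntegral_congr_fun (g := fun _ => 0) measurableSet_Ioc]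
    · simp
    · intro y hy
      simp only [h0 y hy, zero_sub]
      exact ENNReal.ofReal_of_nonpos (by linarith)
  rcases le_or_gt c x with hcx | hxc
  · rw [hzero fun y hy => testFun_eq_zero_of_ge hH hlam hmass (hcx.trans hy.1.le)]
    exact bot_le
  rcases le_or_gt (2 * a - c) x with hxa | hxa
  · have hhat : 1 ≤ 2 * hat (a, c) x := by
      rw [hat, if_pos (by exact hxc), show (2 : ℝ≥0∞) = ENNReal.ofReal 2 by simp,
        ← ENNReal.ofReal_mul (by norm_num), ENNReal.one_le_ofReal, mul_div_assoc']
      have h1 : min x a ≤ a := min_le_right _ _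
      have h2 : 2 * a - c ≤ min x a := le_min hxa (by linarith)
      simp only
      rw [one_le_div (by linarith)]
      linarith
    have hmM : ENNReal.ofReal m ≤ 2 * maximal f x := by
      have h1 : ∫ z in (x + h)..(x + 2 * h), f z ≤ ∫ z in x..(x + 2 * h), f z := by
        rw [← intervalIntegral.integral_add_adjacent_intervals (a := x) (b := x + h)
          (intervalIntegrable_of_locallyIntegrable hloc _ _)
          (intervalIntegrable_of_locallyIntegrable hloc _ _)]
        have := intervalIntegral.integral_nonneg (μ := volume) (by linarith : x ≤ x + h)
          fun z _ => hf0 z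
        linarith
      have h2 : ENNReal.ofReal (∫ z in x..(x + 2 * h), f z) / ENNReal.ofReal (2 * h)
          ≤ maximal f x := by
        refine le_iSup₂_of_le (2 * h) (by linarith) ?_
        rw [← setLIntegral_Ioc_ofReal hloc hf0 (by linarith)]
        simp only [Real.enorm_of_nonneg (hf0 _)]
        exact le_rfl
      calc ENNReal.ofReal m
          ≤ ENNReal.ofReal (2 * ((∫ z in x..(x + 2 * h), f z) / (2 * h))) := by
            refine ENNReal.ofReal_le_ofReal ?_
            rw [hm, one_div_mul_eq_div, mul_div_assoc', mul_div_mul_left _ _ (by norm_num)]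
            exact div_le_div_of_nonneg_right h1 hh.le
        _ ≤ _ := by
            rw [ENNReal.ofReal_mul (by norm_num), ENNReal.ofReal_div_of_pos (by linarith)]
            gcongr
            simp
    refine ENNReal.div_le_of_le_mul ?_
    calc _ ≤ ENNReal.ofReal (6 * δ * h) * (1 + ENNReal.ofReal m) :=
          lintegral_testFun_sub_le hH.cont hH.mono hL hlam hδ hδ2 hloc hh
      _ ≤ ENNReal.ofReal (6 * δ * h) * (2 * hat (a, c) x + 2 * maximal f x) := by gcongr
      _ = _ := by
          rw [show (12 : ℝ) * δ = 2 * (6 * δ) by ring,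
            ENNReal.ofReal_mul (p := 2) (by norm_num),
            ENNReal.ofReal_mul (p := 6 * δ) (by positivity)]
          simp only [ENNReal.ofReal_ofNat]
          ring
  · rcases le_or_gt (x + h) a with hxh | hxh
    · rw [hzero fun y hy => testFun_eq_zero_of_le hH hlam (hy.2.trans hxh)]
      exact bot_le
    · calc (∫⁻ y in Ioc x (x + h), ENNReal.ofReal (f y - m)) / ENNReal.ofReal h
          ≤ ENNReal.ofReal (2 * δ * (c - b)) / ENNReal.ofReal h := by
            gcongr
            exact ((lintegral_mono hle).trans (setLIntegral_le_lintegral _ _)).trans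
              (lintegral_testFun_le hH hL hlam hmass hbc hδ hδ2)
        _ ≤ ENNReal.ofReal (12 * δ) * hat (a, c) x := by
            rw [hat_of_left hac (by simp only; linarith), ← ENNReal.ofReal_div_of_pos hh,
              ← ENNReal.ofReal_mul (by positivity)]
            refine ENNReal.ofReal_le_ofReal ?_
            simp only
            have hcx : 0 < c - x := by linarith
            rw [mul_div_assoc', div_le_div_iff₀ hh hcx]
            have e1 : (c - b) * (c - x) ≤ (c - a) * (2 * h) :=
              mul_le_mul (by linarith) (by linarith) hcx.le (by linarith)
            have e2 : 0 ≤ δ * ((c - a) * h) := by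
              have : 0 < c - a := by linarith
              positivity
            nlinarith
        _ ≤ _ := by
            gcongr
            exact le_self_add

end

/-- A point of an open set `U` has left maximal average at least `1` with respect to `χ_U dx`. -/
theorem leftMax_integral_indicator {U : Set ℝ} (hU : IsOpen U) (a : ℝ)
    (hL : ∀ x y, x ≤ y → (∫ z in a..y, U.indicator (1 : ℝ → ℝ) z)
      - ∫ z in a..x, U.indicator (1 : ℝ → ℝ) z ≤ y - x) {x : ℝ} (hx : x ∈ U) :
    1 ≤ leftMax (fun x => ∫ z in a..x, U.indicator (1 : ℝ → ℝ) z) x := by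
  have hloc : LocallyIntegrable (U.indicator (1 : ℝ → ℝ)) :=
    (locallyIntegrable_const (1 : ℝ)).indicator hU.measurableSet
  obtain ⟨r, hr, hball⟩ := Metric.isOpen_iff.1 hU x hx
  have hy : x - r / 2 < x := by linarith
  refine le_trans ?_ (le_leftMax hL hy)
  rw [integral_sub_integral hloc, sub_sub_cancel, one_le_div (by linarith)]
  refine le_of_eq ?_
  rw [intervalIntegral.integral_congr (g := fun _ => (1 : ℝ))]
  · simp
  · intro z hz
    rw [uIcc_of_le hy.le] at hz
    have : z ∈ U := hball (by
      rw [Metric.mem_ball, Real.dist_eq, abs_lt]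
      constructor <;> linarith [hz.1, hz.2])
    simp [this]

theorem ofReal_le_maximal_of_isOpen {f : ℝ → ℝ} {U : Set ℝ} (hU : IsOpen U) {s : ℝ}
    (hs : ∀ x ∈ U, s ≤ f x) {x : ℝ} (hx : x ∈ U) : ENNReal.ofReal s ≤ maximal f x := by
  obtain ⟨r, hr, hball⟩ := Metric.isOpen_iff.1 hU x hx
  refine le_iSup₂_of_le (r / 2) (by linarith) ?_
  rw [ENNReal.le_div_iff_mul_le (Or.inl (by simpa using hr)) (Or.inl ENNReal.ofReal_ne_top)]
  calc ENNReal.ofReal s * ENNReal.ofReal (r / 2)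
      = ∫⁻ _y in Ioc x (x + r / 2), ENNReal.ofReal s := by
        rw [setLIntegral_const, Real.volume_Ioc, add_sub_cancel_left]
    _ ≤ _ := by
        refine setLIntegral_mono' measurableSet_Ioc fun y hy => ?_
        rw [← ofReal_norm]
        refine ENNReal.ofReal_le_ofReal ((hs y (hball ?_)).trans (le_abs_self _))
        rw [Metric.mem_ball, Real.dist_eq, abs_lt]
        constructor <;> linarith [hy.1, hy.2]

/-- A bounded function supported in `(a, c)` has maximal function dominated by `M⁺ χ_(a,c)`. -/
theorem maximal_le_mul_hat {f : ℝ → ℝ} {a c B : ℝ} (hac : a < c) (hf0 : ∀ x, 0 ≤ f x)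
    (hB : ∀ x, f x ≤ B) (hsupp : ∀ x ∉ Ioo a c, f x = 0) (x : ℝ) :
    maximal f x ≤ ENNReal.ofReal B * hat (a, c) x := by
  rw [← maximal_indicator_Ioo hac]
  refine iSup₂_le fun h hh => ?_
  refine le_trans ?_ (mul_le_mul' le_rfl (le_iSup₂_of_le h hh le_rfl))
  rw [← mul_div_assoc, ← lintegral_const_mul' _ _ ENNReal.ofReal_ne_top]
  gcongr with y
  by_cases hy : y ∈ Ioo a c
  · rw [indicator_of_mem hy, Real.enorm_of_nonneg (hf0 y)]
    simpa using ENNReal.ofReal_le_ofReal (hB y)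
  · rw [hsupp y hy]
    simp

/-- The core of the necessity: for a suitable `δ`, the sharp maximal estimate bounds the maximal
function of the test function of an open set by `M⁺ χ_(a,c)`. -/
theorem SharpEstimate.lintegral_maximal_testFun_le {p : ℝ} {w : ℝ → ℝ} (hp : 1 < p)
    (hw : IsWeight w) {C : ℝ≥0}
    (hC : ∀ f : ℝ → ℝ, (∀ x, 0 ≤ f x) → MemLp f ∞ volume → HasCompactSupport f →
      weightedNorm p w (maximal f) < ∞ →
      weightedNorm p w (maximal f) ≤ C * weightedNorm p w (sharpMaximal f))
    {H : ℝ → ℝ} {a b c lam : ℝ} (hH : IsCDF H a b)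
    (hL : ∀ x y, x ≤ y → H y - H x ≤ y - x) (hlam : 0 < lam)
    (hmass : H b - H a = lam * (c - b)) (hab : a < b) (hbc : b < c)
    (hfin : ∫⁻ x, hat (a, c) x ^ p ∂weightMeasure w ≠ ∞) :
    ∫⁻ x, maximal (testFun H lam (1 / (24 * (C + 1)))) x ^ p ∂weightMeasure w
      ≤ ∫⁻ x, hat (a, c) x ^ p ∂weightMeasure w := by
  have hac := hab.trans hbc
  have hp0 : 0 < p := by linarith
  have hC0 : (0 : ℝ) ≤ C := C.2
  set δ : ℝ := 1 / (24 * (C + 1)) with hδ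
  have hδ0 : 0 < δ := by positivity
  have hδ2 : δ ≤ 1 / 2 := by
    rw [hδ]
    exact one_div_le_one_div_of_le (by norm_num) (by linarith)
  set f := testFun H lam δ with hf
  set ψ := ∫⁻ x, hat (a, c) x ^ p ∂weightMeasure w with hψ
  have hf0 : ∀ x, 0 ≤ f x := testFun_nonneg H lam hδ0.le
  have hfB : ∀ x, f x ≤ max 1 (1 / lam) ^ δ := testFun_le hL hlam hδ0.le
  have hsupp : ∀ x ∉ Ioo a c, f x = 0 := by
    intro x hx
    rcases le_or_gt x a with h | h
    · exact testFun_eq_zero_of_le hH hlam h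
    · exact testFun_eq_zero_of_ge hH hlam hmass (not_lt.1 fun h' => hx ⟨h, h'⟩)
  have hmem : MemLp f ∞ volume :=
    memLp_top_of_bound (measurable_testFun hH.cont hL lam δ).aestronglyMeasurable
      (max 1 (1 / lam) ^ δ) (Filter.Eventually.of_forall fun x => by
        rw [Real.norm_of_nonneg (hf0 x)]
        exact hfB x)
  have hcs : HasCompactSupport f := HasCompactSupport.intro isCompact_Icc fun x hx =>
    hsupp x fun h => hx (Ioo_subset_Icc_self h)
  have hXfin : ∫⁻ x, maximal f x ^ p ∂weightMeasure w ≠ ∞ := by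
    have : ∫⁻ x, maximal f x ^ p ∂weightMeasure w
        ≤ ENNReal.ofReal (max 1 (1 / lam) ^ δ) ^ p * ψ := by
      rw [hψ, ← lintegral_const_mul' _ _ (by finiteness)]
      refine lintegral_mono fun x => ?_
      simp only
      rw [← ENNReal.mul_rpow_of_nonneg _ _ hp0.le]
      exact ENNReal.rpow_le_rpow (maximal_le_mul_hat hac hf0 hfB hsupp x) hp0.le
    exact (this.trans_lt (by finiteness)).ne
  have hS := hC f hf0 hmem hcs (by
    rw [hw.weightedNorm_eq]
    finiteness)
  rw [hw.weightedNorm_eq, hw.weightedNorm_eq] at hS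
  set X := ∫⁻ x, maximal f x ^ p ∂weightMeasure w with hX
  have hS' : X ≤ (C : ℝ≥0∞) ^ p * ∫⁻ x, sharpMaximal f x ^ p ∂weightMeasure w := by
    have := ENNReal.rpow_le_rpow hS hp0.le
    rwa [ENNReal.mul_rpow_of_nonneg _ _ hp0.le, ← ENNReal.rpow_mul, ← ENNReal.rpow_mul,
      one_div_mul_cancel hp0.ne', ENNReal.rpow_one, ENNReal.rpow_one] at this
  have hCδ : (C : ℝ≥0∞) * ENNReal.ofReal (12 * δ) ≤ 2⁻¹ := by
    rw [← ENNReal.ofReal_coe_nnreal, ← ENNReal.ofReal_mul hC0,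
      show (2⁻¹ : ℝ≥0∞) = ENNReal.ofReal 2⁻¹ by
        rw [ENNReal.ofReal_inv_of_pos (by norm_num)]; norm_num]
    refine ENNReal.ofReal_le_ofReal ?_
    rw [hδ, mul_one_div, mul_div_assoc', div_le_iff₀ (by positivity)]
    linarith
  have hpt : ∀ x, (C : ℝ≥0∞) ^ p * sharpMaximal f x ^ p
      ≤ 2⁻¹ * (hat (a, c) x ^ p + maximal f x ^ p) := by
    intro x
    rw [← ENNReal.mul_rpow_of_nonneg _ _ hp0.le]
    calc ((C : ℝ≥0∞) * sharpMaximal f x) ^ p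
        ≤ (2⁻¹ * (hat (a, c) x + maximal f x)) ^ p := by
          refine ENNReal.rpow_le_rpow ?_ hp0.le
          calc (C : ℝ≥0∞) * sharpMaximal f x
              ≤ C * (ENNReal.ofReal (12 * δ) * (hat (a, c) x + maximal f x)) := by
                gcongr
                exact sharpMaximal_testFun_le hH hL hlam hmass hab hbc hδ0 hδ2 x
            _ ≤ _ := by
                rw [← mul_assoc]
                gcongr
      _ = 2⁻¹ ^ p * (hat (a, c) x + maximal f x) ^ p := ENNReal.mul_rpow_of_nonneg _ _ hp0.le
      _ ≤ 2⁻¹ ^ p * (2 ^ (p - 1) * (hat (a, c) x ^ p + maximal f x ^ p)) := by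
          gcongr
          exact ENNReal.rpow_add_le_mul_rpow_add_rpow _ _ hp.le
      _ = _ := by
          rw [← mul_assoc]
          congr 1
          rw [ENNReal.inv_rpow, ← ENNReal.rpow_neg,
            ← ENNReal.rpow_add _ _ (by norm_num) (by norm_num)]
          rw [show -p + (p - 1) = -1 by ring, ENNReal.rpow_neg_one]
  have hhalf : X ≤ X / 2 + ψ / 2 := by
    calc X ≤ ∫⁻ x, (C : ℝ≥0∞) ^ p * sharpMaximal f x ^ p ∂weightMeasure w := by
          rwa [lintegral_const_mul' _ _ (by finiteness)]
      _ ≤ ∫⁻ x, 2⁻¹ * (hat (a, c) x ^ p + maximal f x ^ p) ∂weightMeasure w := lintegral_mono hpt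
      _ = 2⁻¹ * (ψ + X) := by
          rw [lintegral_const_mul' _ _ (by norm_num),
            lintegral_add_left ((measurable_hat _).pow_const p)]
      _ = _ := by
          simp only [div_eq_mul_inv]
          ring
  calc X ≤ 2 * (ψ / 2) := le_two_mul_of_le_half_add hXfin hhalf
    _ = ψ := ENNReal.mul_div_cancel (by norm_num) (by norm_num)

/-- Part (ii): the sharp maximal estimate in `L^p` implies the `C_p⁺` condition. -/
theorem SharpEstimate.cPlus {p : ℝ} {w : ℝ → ℝ} (hp : 1 < p) (hw : IsWeight w)
    (h : SharpEstimate p w) : CPlus p w := by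
  obtain ⟨C, hC⟩ := h
  have hp0 : 0 < p := by linarith
  have hC0 : (0 : ℝ) ≤ C := C.2
  set δ : ℝ := 1 / (24 * (C + 1)) with hδ
  have hδ0 : 0 < δ := by positivity
  refine ⟨δ * p, (2 * 2 ^ δ) ^ p, by positivity, by positivity, ?_⟩
  intro a b c hab hbc _ E hE hEab
  have hac := hab.trans hbc
  simp only [maximal_indicator_Ioo hac]
  rw [← weightMeasure_apply w hE, ← hw.lintegral_weightMeasure]
  set μ := weightMeasure w with hμ
  set ψ := ∫⁻ x, hat (a, c) x ^ p ∂μ with hψ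
  have hcb : 0 < c - b := sub_pos.2 hbc
  rcases eq_or_ne (volume E) 0 with hE0 | hE0
  · rw [show μ E = 0 from withDensity_absolutelyContinuous _ _ hE0]
    exact bot_le
  have hEt : volume E ≠ ∞ := ((measure_mono hEab).trans_lt (by simp)).ne
  rcases eq_or_ne ψ ∞ with hψt | hψt
  · rw [hψt, ENNReal.mul_top]
    · exact le_top
    · refine mul_ne_zero (by simp only [ne_eq, ENNReal.ofReal_eq_zero, not_le]; positivity) ?_
      have h1 : volume E / ENNReal.ofReal (c - b) ≠ 0 :=
        (ENNReal.div_pos hE0 ENNReal.ofReal_ne_top).ne'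
      have h2 : volume E / ENNReal.ofReal (c - b) ≠ ∞ :=
        ENNReal.div_ne_top hEt (by simpa using hbc)
      exact (ENNReal.rpow_pos (pos_iff_ne_zero.2 h1) h2).ne'
  -- an open set between `E` and `(a, b)` of comparable measure
  obtain ⟨V, hEV, hVo, hVlt⟩ := E.exists_isOpen_lt_of_lt (2 * volume E) (by
    rw [two_mul]
    exact ENNReal.lt_add_right hEt hE0)
  set U := V ∩ Ioo a b with hU
  have hUo : IsOpen U := hVo.inter isOpen_Ioo
  have hEU : E ⊆ U := subset_inter hEV hEab
  have hUle : volume U ≤ 2 * volume E := (measure_mono inter_subset_left).trans hVlt.le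
  have hUt : volume U ≠ ∞ := (hUle.trans_lt (by finiteness)).ne
  have hU0 : 0 < (volume U).toReal :=
    ENNReal.toReal_pos ((pos_iff_ne_zero.2 hE0).trans_le (measure_mono hEU)).ne' hUt
  have hloc : LocallyIntegrable (U.indicator (1 : ℝ → ℝ)) :=
    (locallyIntegrable_const (1 : ℝ)).indicator hUo.measurableSet
  have hind0 : ∀ x, 0 ≤ U.indicator (1 : ℝ → ℝ) x := fun x =>
    indicator_nonneg (fun _ _ => zero_le_one) x
  set H : ℝ → ℝ := fun x => ∫ z in a..x, U.indicator (1 : ℝ → ℝ) z with hHdef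
  have hH : IsCDF H a b := isCDF_integral hloc hind0
    (fun x hx => indicator_of_notMem (fun h => h.2.1.not_ge hx) _)
    (fun x hx => indicator_of_notMem (fun h => h.2.2.not_ge hx) _)
  have hL : ∀ x y, x ≤ y → H y - H x ≤ y - x := by
    intro x y hxy
    rw [hHdef, integral_sub_integral hloc]
    calc ∫ z in x..y, U.indicator (1 : ℝ → ℝ) z ≤ ∫ _z in x..y, (1 : ℝ) :=
          intervalIntegral.integral_mono hxy (intervalIntegrable_of_locallyIntegrable hloc _ _)
            (by simp) fun z => indicator_le_self' (fun _ _ => zero_le_one) z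
      _ = y - x := by simp
  set lam := (volume U).toReal / (c - b) with hlamdef
  have hlam : 0 < lam := by positivity
  have hmass : H b - H a = lam * (c - b) := by
    rw [hlamdef, div_mul_cancel₀ _ hcb.ne', hHdef, integral_sub_integral hloc,
      intervalIntegral.integral_of_le hab.le, integral_indicator_one hUo.measurableSet,
      measureReal_def, Measure.restrict_apply hUo.measurableSet,
      inter_eq_left.2 fun x hx => Ioo_subset_Ioc_self hx.2]
  have hX := SharpEstimate.lintegral_maximal_testFun_le hp hw hC hH hL hlam hmass hab hbc hψt
  rw [← hδ, ← hψ] at hX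
  have hlamδ : 0 < lam ^ δ := by positivity
  -- the estimate for the open set
  have hμU : μ U ≤ ENNReal.ofReal (2 * lam ^ δ) ^ p * ψ := by
    rcases le_or_gt 1 (2 * lam ^ δ) with hbig | hsmall
    · calc μ U = ∫⁻ _x in U, 1 ∂μ := by simp
        _ ≤ ∫⁻ x in U, hat (a, c) x ^ p ∂μ := by
            refine setLIntegral_mono' hUo.measurableSet fun x hx => ?_
            rw [hat_of_mem (by exact hx.2.1.le) (by exact hx.2.2.trans hbc), ENNReal.one_rpow]
        _ ≤ 1 * ψ := by
            rw [one_mul]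
            exact setLIntegral_le_lintegral _ _
        _ ≤ _ := by
            gcongr
            exact ENNReal.one_le_rpow (ENNReal.one_le_ofReal.2 hbig) hp0
    · have hval : ∀ x ∈ U, 1 / (2 * lam ^ δ) ≤ testFun H lam δ x := by
        intro x hx
        have h1 : 1 / lam ≤ level H lam x :=
          le_max_of_le_right (div_le_div_of_nonneg_right
            (leftMax_integral_indicator hUo a hL hx) hlam.le)
        have h2 := Real.rpow_le_rpow (by positivity) h1 hδ0.le
        rw [Real.div_rpow zero_le_one hlam.le, Real.one_rpow] at h2
        have h3 : 1 ≤ 1 / (2 * lam ^ δ) := by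
          rw [one_le_div (by positivity)]
          exact hsmall.le
        have h4 : 1 / lam ^ δ = 2 * (1 / (2 * lam ^ δ)) := by field_simp
        unfold testFun
        linarith
      have h5 : ENNReal.ofReal (1 / (2 * lam ^ δ)) ^ p * μ U ≤ ψ := by
        calc _ = ∫⁻ _x in U, ENNReal.ofReal (1 / (2 * lam ^ δ)) ^ p ∂μ :=
              (setLIntegral_const _ _).symm
          _ ≤ ∫⁻ x in U, maximal (testFun H lam δ) x ^ p ∂μ := by
              refine setLIntegral_mono' hUo.measurableSet fun x hx => ?_
              exact ENNReal.rpow_le_rpow (ofReal_le_maximal_of_isOpen hUo hval hx) hp0.le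
          _ ≤ _ := (setLIntegral_le_lintegral _ _).trans hX
      rw [one_div, ENNReal.ofReal_inv_of_pos (by positivity), ENNReal.inv_rpow, mul_comm,
        ← div_eq_mul_inv, ENNReal.div_le_iff_le_mul (Or.inl ?_) (Or.inl (by finiteness))] at h5
      · rwa [mul_comm] at h5
      · exact (ENNReal.rpow_pos (by simpa using hlamδ) ENNReal.ofReal_ne_top).ne'
  have hlamE : ENNReal.ofReal lam ≤ 2 * (volume E / ENNReal.ofReal (c - b)) := by
    rw [hlamdef, ENNReal.ofReal_div_of_pos hcb, ENNReal.ofReal_toReal hUt, ← mul_div_assoc]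
    gcongr
  calc μ E ≤ μ U := measure_mono hEU
    _ ≤ ENNReal.ofReal (2 * lam ^ δ) ^ p * ψ := hμU
    _ ≤ _ := by
        gcongr
        calc ENNReal.ofReal (2 * lam ^ δ) ^ p = (2 * ENNReal.ofReal lam ^ δ) ^ p := by
              rw [ENNReal.ofReal_mul (by norm_num), ENNReal.ofReal_rpow_of_pos hlam]
              simp
          _ ≤ (2 * (2 * (volume E / ENNReal.ofReal (c - b))) ^ δ) ^ p := by gcongr
          _ = _ := by
              rw [ENNReal.mul_rpow_of_nonneg _ _ hδ0.le, ← mul_assoc,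
                ENNReal.mul_rpow_of_nonneg _ _ hp0.le, ← ENNReal.rpow_mul]
              congr 1
              rw [← ENNReal.ofReal_rpow_of_pos (by positivity), ENNReal.ofReal_mul (by norm_num),
                ← ENNReal.ofReal_rpow_of_pos (by norm_num)]
              simp

end OneSided

theorem theorem1 :
    (∀ (p q : ℝ) (w : ℝ → ℝ), 1 < p → p < q → OneSided.IsWeight w → OneSided.CPlus q w →
      OneSided.SharpEstimate p w) ∧
    (∀ (p : ℝ) (w : ℝ → ℝ), 1 < p → OneSided.IsWeight w → OneSided.SharpEstimate p w →
      OneSided.CPlus p w) :=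
  ⟨fun _ _ _ hp hpq hw h => h.sharpEstimate hp hpq hw, fun _ _ hp hw h => h.cPlus hp hw⟩
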